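/- Let $p\ge 0$ be a fixed integer and let $T=T_N$ be positive integers with $T/\sqrt N\to\infty$ as $N\to\infty$. For each $N$ consider the panel regression model $y_i=x_i\beta_i+\epsilon_i$, $1\le i\le N$, where $x_i$ is a non-random $T\times p$ matrix with $x_i'x_i$ invertible, $\beta_i\in\mathbb R^p$, and $\epsilon_1,\dots,\epsilon_N$ are independent random vectors with $\epsilon_i\sim N_T(0,\sigma_i^2 I_T)$, $\sigma_i>0$. (For $p=0$ there are no regressors and $y_i=\epsilon_i$; the quantities $x_i,\beta_i,\sigma_i$ may depend on $N$.) Let $\hat\beta_i=(x_i'x_i)^{-1}x_i'y_i$ be the least squares estimator, $\hat\epsilon_i=y_i-x_i\hat\beta_i=(\hat\epsilon_{i1},\dots,\hat\epsilon_{iT})'$ the residual vector, $P_i=I_T-x_i(x_i'x_i)^{-1}x_i'$ (with $P_i=I_T$ if $p=0$), and $$\hat\rho_{ij}=\frac{\sum_{t=1}^T\hat\epsilon_{it}\hat\epsilon_{jt}}{\sqrt{\sum_{t=1}^T\hat\epsilon_{it}^2\,\sum_{t=1}^T\hat\epsilon_{jt}^2}} .$$ Put $$a_{2N}=3\left[\frac{(T-p-8)(T-p+2)+24}{(T-p+2)(T-p-2)(T-p-4)}\right]^2,\qquad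 a_{1N}=a_{2N}-\frac1{(T-p)^2},$$ $$\mu_{Nij}=\frac{1}{T-p}\,\mathrm{tr}(P_iP_j),\qquad v_{Nij}=\Big(a_{1N}\,[\mathrm{tr}(P_iP_j)]^2+2a_{2N}\,\mathrm{tr}[(P_iP_j)^2]\Big)^{1/2},$$ and let $$Q_N=\sqrt{\frac{2}{N(N-1)}}\sum_{i=1}^{N-1}\sum_{j=i+1}^{N}\frac{(T-p)\hat\rho_{ij}^2-\mu_{Nij}}{v_{Nij}},$$ the bias-adjusted statistic of Pesaran et al., which is well defined (almost surely) for all large $N$. Then $Q_N$ converges to $N(0,1)$ in distribution as $N\to\infty$. -/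

import Mathlib

open MeasureTheory ProbabilityTheory Filter Topology
open scoped Matrix

namespace PanelData

noncomputable section

/-- The ordinary least squares estimator `(x'x)⁻¹ x' y` of the slope of the regression of `y ∈ ℝᵀ`
on the `T × p` design matrix `x`. -/
def olsEstimator {T p : ℕ} (x : Matrix (Fin T) (Fin p) ℝ) (y : Fin T → ℝ) : Fin p → ℝ :=
  (xᵀ * x)⁻¹ *ᵥ (xᵀ *ᵥ y)

/-- The vector of OLS residuals `y - x β̂`. -/
def olsResidual {T p : ℕ} (x : Matrix (Fin T) (Fin p) ℝ) (y : Fin T → ℝ) : Fin T → ℝ :=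
  y - x *ᵥ olsEstimator x y

/-- The projection matrix `P = I - x (x'x)⁻¹ x'`. It is the identity matrix if `p = 0`. -/
def residualProj {T p : ℕ} (x : Matrix (Fin T) (Fin p) ℝ) : Matrix (Fin T) (Fin T) ℝ :=
  1 - x * (xᵀ * x)⁻¹ * xᵀ

/-- The sample correlation of two residual vectors:
`(∑ₜ uₜ vₜ) / √((∑ₜ uₜ²) (∑ₜ vₜ²))`. -/
def sampleCorr {T : ℕ} (u v : Fin T → ℝ) : ℝ :=
  (∑ t, u t * v t) / √((∑ t, u t ^ 2) * ∑ t, v t ^ 2)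

/-- The residual correlation `ρ̂ᵢⱼ` of the sections `i` and `j` of a panel with `N` sections,
design matrices `x i` and responses `y i`. -/
def rhoHat {N T p : ℕ} (x : Fin N → Matrix (Fin T) (Fin p) ℝ) (y : Fin N → Fin T → ℝ)
    (i j : Fin N) : ℝ :=
  sampleCorr (olsResidual (x i) (y i)) (olsResidual (x j) (y j))

/-- The centering `μ_{Nij} = tr(Pᵢ Pⱼ) / (T - p)`. -/
def muAdj {N T p : ℕ} (x : Fin N → Matrix (Fin T) (Fin p) ℝ) (i j : Fin N) : ℝ :=
  1 / ((T : ℝ) - p) * (residualProj (x i) * residualProj (x j)).trace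

/-- The coefficient `a_{2N}`. -/
def a2 (T p : ℕ) : ℝ :=
  3 * ((((T : ℝ) - p - 8) * ((T : ℝ) - p + 2) + 24) /
    (((T : ℝ) - p + 2) * ((T : ℝ) - p - 2) * ((T : ℝ) - p - 4))) ^ 2

/-- The coefficient `a_{1N}`. -/
def a1 (T p : ℕ) : ℝ :=
  a2 T p - 1 / ((T : ℝ) - p) ^ 2

/-- The scaling `v_{Nij}`: the square root of
`a_{1N} [tr(Pᵢ Pⱼ)]² + 2 a_{2N} tr[(Pᵢ Pⱼ)²]`. -/
def vAdj {N T p : ℕ} (x : Fin N → Matrix (Fin T) (Fin p) ℝ) (i j : Fin N) : ℝ :=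
  √(a1 T p * (residualProj (x i) * residualProj (x j)).trace ^ 2 +
    2 * a2 T p * ((residualProj (x i) * residualProj (x j)) ^ 2).trace)

/-- The bias-adjusted statistic `Q_N` (`LM_adj`) as a function of the design matrices and the
responses. -/
def lmAdj {N T p : ℕ} (x : Fin N → Matrix (Fin T) (Fin p) ℝ) (y : Fin N → Fin T → ℝ) : ℝ :=
  √(2 / ((N : ℝ) * ((N : ℝ) - 1))) *
    ∑ i, ∑ j ∈ Finset.Ioi i,
      (((T : ℝ) - p) * rhoHat x y i j ^ 2 - muAdj x i j) / vAdj x i j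

end

end PanelData

/-!
Write `n = T - p` and let `sᵢ` be the direction of the residual vector of section `i`. Since the
residual vector is the projection of a spherical normal vector to a subspace of dimension `n`, the
directions `sᵢ` are independent and uniformly distributed on the unit spheres of these subspaces,
and `ρ̂ᵢⱼ = ⟪sᵢ, sⱼ⟫` (`PanelData.lmAdj_eq`, `PanelData.isIsotropic_errorLaw`).

The Hoeffding decomposition `n ρ̂ᵢⱼ² - μᵢⱼ = Hᵢⱼ(sᵢ, sⱼ) + gᵢⱼ(sᵢ) + gⱼᵢ(sⱼ)`
(`PanelData.dirKernel_add_projLength`) has a kernel `H` which integrates to zero in either variable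
and a linear part `gᵢⱼ(sᵢ) = ‖Pⱼ sᵢ‖² - tr (Pᵢ Pⱼ) / n`. As `I - Pⱼ` has rank `p`, the second moment
of `gᵢⱼ` is at most `3 p² / n²`, and the linear part contributes a term of second moment `O(N / n²)`
to the statistic, which is negligible because `T / √N → ∞`
(`PanelData.integral_sq_sum_projLength_le`).

What remains is a degenerate `U`-statistic in independent variables. Grouping the pairs by their
larger index makes it a sum of martingale differences. A characteristic function estimate for
martingales whose conditional variances add up to nearly `1`
(`PanelData.IsMartingaleDiff.norm_integral_exp_sub_le`) reduces its asymptotic normality to three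
moment conditions on the kernels (`PanelData.IsDegenerate.norm_integral_exp_sub_le`): bounded fourth
moments, second moments close to the squared normalization `vᵢⱼ²`, which tends to `2`, and
conditional covariances `∫ Hᵢₖ(a, ·) Hₗₖ(b, ·)` which are small in mean square. They follow from the
moments up to order eight of the linear forms of a uniformly distributed direction, which are
computed from rotation invariance alone (`PanelData.IsIsotropic.integral_inner_sq_mul_inner_sq`,
`PanelData.IsIsotropic.integral_inner_pow_eight_le`). All estimates are explicit in `N` and `n`, and
Lévy's continuity theorem concludes.
-/

namespace PanelData

/-! ### Taylor bounds for exponentials -/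

section

/-- Taylor bound of order two for `x ↦ exp (i x)`, with a crude constant. -/
lemma norm_exp_mul_I_sub_taylor_le (x : ℝ) :
    ‖Complex.exp (x * Complex.I) - (1 + x * Complex.I - (x : ℂ) ^ 2 / 2)‖ ≤ 4 * |x| ^ 3 := by
  rcases le_total |x| 1 with h | h
  · have h1 : ‖(x : ℂ) * Complex.I‖ ≤ 1 := by simpa using h
    have := Complex.exp_bound h1 (n := 3) (by norm_num)
    simp only [Finset.sum_range_succ, Finset.sum_range_zero] at this
    have e : (0 + ((x : ℂ) * Complex.I) ^ 0 / (Nat.factorial 0 : ℂ)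
        + ((x : ℂ) * Complex.I) ^ 1 / (Nat.factorial 1 : ℂ)
        + ((x : ℂ) * Complex.I) ^ 2 / (Nat.factorial 2 : ℂ))
        = 1 + x * Complex.I - (x : ℂ) ^ 2 / 2 := by
      simp [mul_pow, Nat.factorial]; ring
    rw [e] at this
    refine this.trans ?_
    have h3 : 0 ≤ |x| ^ 3 := by positivity
    simp [Nat.factorial]
    nlinarith
  · have h1 : ‖Complex.exp (x * Complex.I)‖ = 1 := Complex.norm_exp_ofReal_mul_I x
    have h2 : ‖Complex.exp (x * Complex.I) - (1 + x * Complex.I - (x : ℂ) ^ 2 / 2)‖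
        ≤ 1 + (1 + |x| + |x| ^ 2 / 2) := by
      refine (norm_sub_le _ _).trans ?_
      rw [h1]
      gcongr
      refine (norm_sub_le _ _).trans ?_
      gcongr
      · refine (norm_add_le _ _).trans ?_
        simp
      · simp
    refine h2.trans ?_
    nlinarith [mul_nonneg (sub_nonneg.2 h) (sub_nonneg.2 h), sq_nonneg (|x|),
      mul_nonneg (mul_nonneg (abs_nonneg x) (sub_nonneg.2 h)) (abs_nonneg x)]

lemma abs_exp_neg_sub_taylor_le {a : ℝ} (ha : 0 ≤ a) : |Real.exp (-a) - (1 - a)| ≤ a ^ 2 := by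
  have h1 : 0 ≤ Real.exp (-a) - (1 - a) := by linarith [Real.add_one_le_exp (-a)]
  rw [abs_of_nonneg h1]
  rcases le_total a 1 with h | h
  · have := Real.norm_exp_sub_one_sub_id_le (x := -a) (by simpa [abs_of_nonneg ha] using h)
    have h3 := le_of_abs_le this
    simp only [norm_neg, Real.norm_eq_abs, sq_abs] at h3
    linarith
  · have : Real.exp (-a) ≤ 1 := Real.exp_le_one_iff.2 (by linarith)
    nlinarith

lemma abs_exp_sub_exp_le (a b : ℝ) :
    |Real.exp a - Real.exp b| ≤ Real.exp (max a b) * |a - b| := by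
  wlog h : b ≤ a generalizing a b
  · rw [abs_sub_comm, abs_sub_comm a b, max_comm]; exact this b a (le_of_not_ge h)
  rw [max_eq_left h, abs_of_nonneg (by linarith [Real.exp_le_exp.2 h]),
    abs_of_nonneg (by linarith)]
  have h1 : Real.exp b = Real.exp a * Real.exp (b - a) := by rw [← Real.exp_add]; ring_nf
  have h2 := Real.add_one_le_exp (b - a)
  have := Real.exp_pos a
  rw [h1]
  nlinarith

lemma norm_exp_mul_I_sub_exp_mul_I_le (a b : ℝ) :
    ‖Complex.exp (a * Complex.I) - Complex.exp (b * Complex.I)‖ ≤ |a - b| := by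
  have h : Complex.exp (a * Complex.I) - Complex.exp (b * Complex.I)
      = Complex.exp (b * Complex.I) * (Complex.exp (Complex.I * ((a - b : ℝ) : ℂ)) - 1) := by
    rw [mul_sub, ← Complex.exp_add]
    push_cast; ring_nf
  rw [h, norm_mul, Complex.norm_exp_ofReal_mul_I, one_mul]
  exact Real.norm_exp_I_mul_ofReal_sub_one_le

end

/-! ### Martingale differences -/

section

variable {Ω : Type*} {m0 : MeasurableSpace Ω}

/-- A bounded martingale difference sequence `X` together with its conditional variances `s`, in
weak form: instead of conditional expectations, the defining identities are tested against bounded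
functions which are measurable with respect to the past. -/
structure IsMartingaleDiff (μ : Measure Ω) (F : ℕ → MeasurableSpace Ω) (X s : ℕ → Ω → ℝ)
    (K : ℝ) : Prop where
  mono : Monotone F
  le : ∀ k, F k ≤ m0
  meas_X : ∀ k, Measurable[F (k + 1)] (X k)
  meas_s : ∀ k, Measurable[F k] (s k)
  nonneg : ∀ k ω, 0 ≤ s k ω
  abs_X_le : ∀ k ω, |X k ω| ≤ K
  s_le : ∀ k ω, s k ω ≤ K
  integral_mul_X : ∀ k (B : Ω → ℝ), Measurable[F k] B → (∃ M, ∀ ω, |B ω| ≤ M) →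
    ∫ ω, B ω * X k ω ∂μ = 0
  integral_mul_sq : ∀ k (B : Ω → ℝ), Measurable[F k] B → (∃ M, ∀ ω, |B ω| ≤ M) →
    ∫ ω, B ω * X k ω ^ 2 ∂μ = ∫ ω, B ω * s k ω ∂μ

lemma integrable_of_abs_le {μ : Measure Ω} [IsFiniteMeasure μ] {f : Ω → ℝ} (hf : Measurable f)
    (C : ℝ) (h : ∀ ω, |f ω| ≤ C) : Integrable f μ :=
  Integrable.of_bound hf.aestronglyMeasurable C (Eventually.of_forall h)

lemma integrable_of_norm_le {μ : Measure Ω} [IsFiniteMeasure μ] {f : Ω → ℂ} (hf : Measurable f)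
    (C : ℝ) (h : ∀ ω, ‖f ω‖ ≤ C) : Integrable f μ :=
  Integrable.of_bound hf.aestronglyMeasurable C (Eventually.of_forall h)

/-- A real identity between integrals against the real and imaginary parts of a test function
passes to the complex test function. -/
lemma integral_complex_mul_eq {μ : Measure Ω} [IsFiniteMeasure μ]
    {f g : Ω → ℝ} (hf : Measurable f) (hg : Measurable g) {C : ℝ}
    (hfC : ∀ ω, |f ω| ≤ C) (hgC : ∀ ω, |g ω| ≤ C)
    {B : Ω → ℂ} (hB : Measurable B) {M : ℝ} (hM : ∀ ω, ‖B ω‖ ≤ M)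
    (hre : ∫ ω, (B ω).re * f ω ∂μ = ∫ ω, (B ω).re * g ω ∂μ)
    (him : ∫ ω, (B ω).im * f ω ∂μ = ∫ ω, (B ω).im * g ω ∂μ) :
    ∫ ω, B ω * f ω ∂μ = ∫ ω, B ω * g ω ∂μ := by
  have key : ∀ φ : Ω → ℝ, Measurable φ → (∀ ω, |φ ω| ≤ C) →
      ∫ ω, B ω * φ ω ∂μ = ((∫ ω, (B ω).re * φ ω ∂μ : ℝ) : ℂ)
        + ((∫ ω, (B ω).im * φ ω ∂μ : ℝ) : ℂ) * Complex.I := by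
    intro φ hφ hφC
    have hint : ∀ b : Ω → ℝ, Measurable b → (∀ ω, |b ω| ≤ M) →
        Integrable (fun ω => b ω * φ ω) μ := fun b hb hbM =>
      integrable_of_abs_le (hb.mul hφ) (M * C) fun ω => by
        rw [abs_mul]
        exact mul_le_mul (hbM ω) (hφC ω) (abs_nonneg _) ((abs_nonneg _).trans (hbM ω))
    rw [← integral_complex_ofReal, ← integral_complex_ofReal, ← integral_mul_const,
      ← integral_add
        (hint _ (by fun_prop) fun ω => (Complex.abs_re_le_norm _).trans (hM ω)).ofReal
        ((hint _ (by fun_prop) fun ω =>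
          (Complex.abs_im_le_norm _).trans (hM ω)).ofReal.mul_const _)]
    congr 1
    ext ω
    conv_lhs => rw [← Complex.re_add_im (B ω)]
    push_cast
    ring
  rw [key f hf hfC, key g hg hgC, hre, him]

namespace IsMartingaleDiff

variable {μ : Measure Ω} {F : ℕ → MeasurableSpace Ω} {X s : ℕ → Ω → ℝ} {K : ℝ}

lemma measurable_X (h : IsMartingaleDiff μ F X s K) (k : ℕ) : Measurable (X k) :=
  (h.meas_X k).mono (h.le _) le_rfl

lemma measurable_s (h : IsMartingaleDiff μ F X s K) (k : ℕ) : Measurable (s k) :=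
  (h.meas_s k).mono (h.le _) le_rfl

lemma meas_sum_X (h : IsMartingaleDiff μ F X s K) (k : ℕ) :
    Measurable[F k] fun ω => ∑ j ∈ Finset.range k, X j ω :=
  Finset.measurable_fun_sum _ fun j hj =>
    (h.meas_X j).mono (h.mono (by simpa using hj)) le_rfl

lemma meas_sum_s (h : IsMartingaleDiff μ F X s K) (k : ℕ) :
    Measurable[F k] fun ω => ∑ j ∈ Finset.range (k + 1), s j ω :=
  Finset.measurable_fun_sum _ fun j hj =>
    (h.meas_s j).mono (h.mono (by simpa using Nat.lt_succ_iff.1 (Finset.mem_range.1 hj))) le_rfl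

/-- Stopping a martingale difference sequence before its conditional variances exceed `2`. As the
conditional variance is predictable, this keeps the martingale property. -/
lemma truncate (h : IsMartingaleDiff μ F X s K) :
    IsMartingaleDiff μ F
      (fun k ω => if ∑ j ∈ Finset.range (k + 1), s j ω ≤ 2 then X k ω else 0)
      (fun k ω => if ∑ j ∈ Finset.range (k + 1), s j ω ≤ 2 then s k ω else 0) K where
  mono := h.mono
  le := h.le
  meas_X k := by
    refine Measurable.ite ?_ (h.meas_X k) measurable_const
    exact h.mono (Nat.le_succ k) _ (h.meas_sum_s k measurableSet_Iic)
  meas_s k := Measurable.ite (h.meas_sum_s k measurableSet_Iic) (h.meas_s k) measurable_const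
  nonneg k ω := by split_ifs <;> [exact h.nonneg k ω; exact le_rfl]
  abs_X_le k ω := by
    split_ifs
    · exact h.abs_X_le k ω
    · simpa using (abs_nonneg _).trans (h.abs_X_le k ω)
  s_le k ω := by
    split_ifs
    · exact h.s_le k ω
    · exact (abs_nonneg _).trans (h.abs_X_le k ω)
  integral_mul_X k B hB hM := by
    obtain ⟨M, hM⟩ := hM
    have := h.integral_mul_X k
      (fun ω => if ∑ j ∈ Finset.range (k + 1), s j ω ≤ 2 then B ω else 0)
      (Measurable.ite (h.meas_sum_s k measurableSet_Iic) hB measurable_const)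
      ⟨M, fun ω => by split_ifs <;> [exact hM ω; simpa using (abs_nonneg _).trans (hM ω)]⟩
    calc _ = _ := by
          congr 1
          ext ω
          split_ifs <;> simp
      _ = _ := this
  integral_mul_sq k B hB hM := by
    obtain ⟨M, hM⟩ := hM
    have := h.integral_mul_sq k
      (fun ω => if ∑ j ∈ Finset.range (k + 1), s j ω ≤ 2 then B ω else 0)
      (Measurable.ite (h.meas_sum_s k measurableSet_Iic) hB measurable_const)
      ⟨M, fun ω => by split_ifs <;> [exact hM ω; simpa using (abs_nonneg _).trans (hM ω)]⟩
    calc _ = _ := by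
          congr 1
          ext ω
          split_ifs <;> simp
      _ = _ := this
      _ = _ := by
          congr 1
          ext ω
          split_ifs <;> simp

lemma truncated_sum_le (hs : ∀ k, ∀ ω, 0 ≤ s k ω) (n : ℕ) (ω : Ω) :
    ∑ k ∈ Finset.range n, (if ∑ j ∈ Finset.range (k + 1), s j ω ≤ 2 then s k ω else 0) ≤ 2 := by
  induction n with
  | zero => simp
  | succ m ih =>
    by_cases hm : ∑ j ∈ Finset.range (m + 1), s j ω ≤ 2
    · refine le_trans (Finset.sum_le_sum fun k _ => ?_) hm
      split_ifs <;> [exact le_rfl; exact hs k ω]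
    · rw [Finset.sum_range_succ, if_neg hm, add_zero]
      exact ih

lemma truncated_eq (hs : ∀ k, ∀ ω, 0 ≤ s k ω) (Y : ℕ → Ω → ℝ) {n : ℕ} {ω : Ω}
    (hω : ∑ j ∈ Finset.range n, s j ω ≤ 2) :
    ∑ k ∈ Finset.range n, (if ∑ j ∈ Finset.range (k + 1), s j ω ≤ 2 then Y k ω else 0)
      = ∑ k ∈ Finset.range n, Y k ω := by
  refine Finset.sum_congr rfl fun k hk => if_pos (le_trans ?_ hω)
  exact Finset.sum_le_sum_of_subset_of_nonneg
    (Finset.range_mono (Finset.mem_range.1 hk)) fun j _ _ => hs j ω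

variable [IsProbabilityMeasure μ]

/-- By duality, the conditional variance inherits the fourth moment of the increment. -/
lemma sq_s_le (h : IsMartingaleDiff μ F X s K) (k : ℕ) :
    ∫ ω, s k ω ^ 2 ∂μ ≤ ∫ ω, X k ω ^ 4 ∂μ := by
  have hsb : ∀ ω, |s k ω| ≤ K := fun ω => by rw [abs_of_nonneg (h.nonneg k ω)]; exact h.s_le k ω
  have hK : ∀ ω : Ω, 0 ≤ K := fun ω => (abs_nonneg _).trans (h.abs_X_le k ω)
  have h1 := h.integral_mul_sq k (s k) (h.meas_s k) ⟨K, hsb⟩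
  have hXm := h.measurable_X k
  have hsm := h.measurable_s k
  have i1 : Integrable (fun ω => s k ω ^ 2) μ :=
    integrable_of_abs_le (by fun_prop) (K ^ 2) fun ω => by
      rw [abs_pow]; exact pow_le_pow_left₀ (abs_nonneg _) (hsb ω) 2
  have i2 : Integrable (fun ω => X k ω ^ 4) μ :=
    integrable_of_abs_le (by fun_prop) (K ^ 4) fun ω => by
      rw [abs_pow]; exact pow_le_pow_left₀ (abs_nonneg _) (h.abs_X_le k ω) 4
  have i3 : Integrable (fun ω => s k ω * X k ω ^ 2) μ :=
    integrable_of_abs_le (by fun_prop) (K * K ^ 2) fun ω => by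
      rw [abs_mul, abs_pow]
      exact mul_le_mul (hsb ω) (pow_le_pow_left₀ (abs_nonneg _) (h.abs_X_le k ω) 2)
        (by positivity) (hK ω)
  -- `∫ s ^ 2 = ∫ s X ^ 2 ≤ (∫ s ^ 2 + ∫ X ^ 4) / 2`
  have h2 : ∫ ω, s k ω * X k ω ^ 2 ∂μ
      ≤ ∫ ω, (1 / 2 * s k ω ^ 2 + 1 / 2 * X k ω ^ 4) ∂μ := by
    refine integral_mono i3 ((i1.const_mul _).add (i2.const_mul _)) fun ω => ?_
    change _ ≤ 1 / 2 * s k ω ^ 2 + 1 / 2 * X k ω ^ 4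
    nlinarith [sq_nonneg (s k ω - X k ω ^ 2)]
  rw [integral_add (i1.const_mul _) (i2.const_mul _), integral_const_mul, integral_const_mul, h1]
    at h2
  have h3 : ∫ ω, s k ω * s k ω ∂μ = ∫ ω, s k ω ^ 2 ∂μ := by simp_rw [sq]
  rw [h3] at h2
  linarith

/-- One step of the telescoping argument: replacing the increment `X k` by its conditional variance
changes the compensated exponential only by third-order terms. -/
lemma norm_integral_step_le (h : IsMartingaleDiff μ F X s K) (k : ℕ) (t : ℝ) {B : Ω → ℂ}
    (hB : Measurable[F k] B) {M : ℝ} (hM : ∀ ω, ‖B ω‖ ≤ M) :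
    ‖∫ ω, B ω * (Complex.exp ((t * X k ω : ℝ) * Complex.I)
        - (Real.exp (-(t ^ 2 / 2 * s k ω)) : ℂ)) ∂μ‖
      ≤ M * (4 * |t| ^ 3 * ∫ ω, |X k ω| ^ 3 ∂μ + t ^ 4 / 4 * ∫ ω, X k ω ^ 4 ∂μ) := by
  have hXm := h.measurable_X k
  have hsm := h.measurable_s k
  have hBm : Measurable B := hB.mono (h.le k) le_rfl
  have hM0 : ∀ ω : Ω, 0 ≤ M := fun ω => (norm_nonneg _).trans (hM ω)
  have hsb : ∀ ω, |s k ω| ≤ K := fun ω => by rw [abs_of_nonneg (h.nonneg k ω)]; exact h.s_le k ω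
  have hK : ∀ ω : Ω, 0 ≤ K := fun ω => (abs_nonneg _).trans (h.abs_X_le k ω)
  have hX2 : ∀ ω, |X k ω ^ 2| ≤ K ^ 2 := fun ω => by
    rw [abs_pow]; exact pow_le_pow_left₀ (abs_nonneg _) (h.abs_X_le k ω) 2
  have hre : Measurable[F k] fun ω => (B ω).re := Complex.measurable_re.comp hB
  have him : Measurable[F k] fun ω => (B ω).im := Complex.measurable_im.comp hB
  have hreM : ∃ M, ∀ ω, |(B ω).re| ≤ M := ⟨M, fun ω => (Complex.abs_re_le_norm _).trans (hM ω)⟩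
  have himM : ∃ M, ∀ ω, |(B ω).im| ≤ M := ⟨M, fun ω => (Complex.abs_im_le_norm _).trans (hM ω)⟩
  have e1 : ∫ ω, B ω * (X k ω : ℂ) ∂μ = 0 := by
    have := integral_complex_mul_eq (μ := μ) hXm (measurable_const (a := (0 : ℝ)))
      (C := K) (h.abs_X_le k) (fun ω => by simpa using hK ω) hBm hM
      (by rw [h.integral_mul_X k _ hre hreM]; simp) (by rw [h.integral_mul_X k _ him himM]; simp)
    simpa using this
  have e2 : ∫ ω, B ω * ((X k ω ^ 2 : ℝ) : ℂ) ∂μ = ∫ ω, B ω * (s k ω : ℂ) ∂μ :=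
    integral_complex_mul_eq (μ := μ) (hXm.pow_const 2) hsm
      (C := max (K ^ 2) K) (fun ω => (hX2 ω).trans (le_max_left _ _))
      (fun ω => (hsb ω).trans (le_max_right _ _)) hBm hM
      (h.integral_mul_sq k _ hre hreM) (h.integral_mul_sq k _ him himM)
  have bmul : ∀ {f : Ω → ℂ} {C : ℝ}, Measurable f → (∀ ω, ‖f ω‖ ≤ C) →
      Integrable (fun ω => B ω * f ω) μ := fun {f C} hf hfC =>
    integrable_of_norm_le (hBm.mul hf) (M * C) fun ω => by
      rw [norm_mul]; exact mul_le_mul (hM ω) (hfC ω) (norm_nonneg _) (hM0 ω)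
  have i1 : Integrable (fun ω => B ω * (X k ω : ℂ)) μ :=
    bmul (C := K) (by fun_prop) fun ω => by simpa using h.abs_X_le k ω
  have i2 : Integrable (fun ω => B ω * ((X k ω ^ 2 : ℝ) : ℂ)) μ :=
    bmul (C := K ^ 2) (by fun_prop) fun ω => by
      rw [Complex.norm_real]; exact hX2 ω
  have i3 : Integrable (fun ω => B ω * (s k ω : ℂ)) μ :=
    bmul (C := K) (by fun_prop) fun ω => by
      rw [Complex.norm_real]; exact hsb ω
  have i0 : Integrable (fun ω => B ω * (Complex.exp ((t * X k ω : ℝ) * Complex.I)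
        - (Real.exp (-(t ^ 2 / 2 * s k ω)) : ℂ))) μ :=
    bmul (C := 1 + 1) (by fun_prop) fun ω => by
      refine (norm_sub_le _ _).trans (add_le_add (Complex.norm_exp_ofReal_mul_I _).le ?_)
      rw [Complex.norm_real, Real.norm_eq_abs, Real.abs_exp]
      exact Real.exp_le_one_iff.2 (by have := h.nonneg k ω; simp; positivity)
  have e3 : ∫ ω, B ω * (Complex.exp ((t * X k ω : ℝ) * Complex.I)
        - (Real.exp (-(t ^ 2 / 2 * s k ω)) : ℂ)) ∂μ
      = ∫ ω, (B ω * (Complex.exp ((t * X k ω : ℝ) * Complex.I)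
        - (Real.exp (-(t ^ 2 / 2 * s k ω)) : ℂ))
        - (t * Complex.I) * (B ω * (X k ω : ℂ))
        + (t ^ 2 / 2 : ℂ) * (B ω * ((X k ω ^ 2 : ℝ) : ℂ) - B ω * (s k ω : ℂ))) ∂μ := by
    have ia : Integrable (fun ω => B ω * (Complex.exp ((t * X k ω : ℝ) * Complex.I)
        - (Real.exp (-(t ^ 2 / 2 * s k ω)) : ℂ))
        - (t * Complex.I) * (B ω * (X k ω : ℂ))) μ := i0.sub (i1.const_mul _)
    have ib : Integrable (fun ω => (t ^ 2 / 2 : ℂ) *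
        (B ω * ((X k ω ^ 2 : ℝ) : ℂ) - B ω * (s k ω : ℂ))) μ := (i2.sub i3).const_mul _
    rw [integral_add ia ib, integral_sub i0 (i1.const_mul _), integral_const_mul,
      integral_const_mul, integral_sub i2 i3, e1, e2]
    simp
  have j3 : Integrable (fun ω => |X k ω| ^ 3) μ :=
    integrable_of_abs_le (by fun_prop) (K ^ 3) fun ω => by
      rw [abs_pow, abs_abs]; exact pow_le_pow_left₀ (abs_nonneg _) (h.abs_X_le k ω) 3
  have j2 : Integrable (fun ω => s k ω ^ 2) μ :=
    integrable_of_abs_le (by fun_prop) (K ^ 2) fun ω => by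
      rw [abs_pow]; exact pow_le_pow_left₀ (abs_nonneg _) (hsb ω) 2
  -- the first and second order terms have been subtracted without changing the integral
  rw [e3]
  calc _ ≤ ∫ ω, M * (4 * |t| ^ 3 * |X k ω| ^ 3 + t ^ 4 / 4 * s k ω ^ 2) ∂μ := by
        refine norm_integral_le_of_norm_le
          (((j3.const_mul _).add (j2.const_mul _)).const_mul _) (Eventually.of_forall fun ω => ?_)
        have r : B ω * (Complex.exp ((t * X k ω : ℝ) * Complex.I)
            - (Real.exp (-(t ^ 2 / 2 * s k ω)) : ℂ))
            - (t * Complex.I) * (B ω * (X k ω : ℂ))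
            + (t ^ 2 / 2 : ℂ) * (B ω * ((X k ω ^ 2 : ℝ) : ℂ) - B ω * (s k ω : ℂ))
            = B ω * ((Complex.exp ((t * X k ω : ℝ) * Complex.I)
                - (1 + (t * X k ω : ℝ) * Complex.I - ((t * X k ω : ℝ) : ℂ) ^ 2 / 2))
              - ((Real.exp (-(t ^ 2 / 2 * s k ω)) - (1 - t ^ 2 / 2 * s k ω) : ℝ) : ℂ)) := by
          push_cast; ring
        rw [r, norm_mul]
        refine mul_le_mul (hM ω) ?_ (norm_nonneg _) (hM0 ω)
        refine (norm_sub_le _ _).trans (add_le_add ?_ ?_)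
        · refine (norm_exp_mul_I_sub_taylor_le _).trans (le_of_eq ?_)
          rw [abs_mul, mul_pow]; ring
        · rw [Complex.norm_real, Real.norm_eq_abs]
          refine (abs_exp_neg_sub_taylor_le (by have := h.nonneg k ω; positivity)).trans
            (le_of_eq ?_)
          ring
    _ = M * (4 * |t| ^ 3 * ∫ ω, |X k ω| ^ 3 ∂μ + t ^ 4 / 4 * ∫ ω, s k ω ^ 2 ∂μ) := by
        rw [integral_const_mul, integral_add (j3.const_mul _) (j2.const_mul _),
          integral_const_mul, integral_const_mul]
    _ ≤ _ := by
        have : Nonempty Ω := nonempty_of_isProbabilityMeasure μ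
        have := h.sq_s_le k
        have hM0' := hM0 (Classical.arbitrary Ω)
        gcongr

/-- Normal approximation when the sum of the conditional variances is bounded by `2`. -/
lemma norm_integral_exp_sub_le_of_sum_le (h : IsMartingaleDiff μ F X s K) (n : ℕ)
    (hV : ∀ ω, ∑ j ∈ Finset.range n, s j ω ≤ 2) (t : ℝ) :
    ‖∫ ω, Complex.exp ((t * ∑ j ∈ Finset.range n, X j ω : ℝ) * Complex.I) ∂μ
        - (Real.exp (-(t ^ 2 / 2)) : ℂ)‖
      ≤ Real.exp (t ^ 2) * ∑ k ∈ Finset.range n,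
          (4 * |t| ^ 3 * ∫ ω, |X k ω| ^ 3 ∂μ + t ^ 4 / 4 * ∫ ω, X k ω ^ 4 ∂μ)
        + Real.exp (t ^ 2) * (t ^ 2 / 2) *
          ∫ ω, |∑ j ∈ Finset.range n, s j ω - 1| ∂μ := by
  have hVm : ∀ m ≤ n, ∀ ω, ∑ j ∈ Finset.range m, s j ω ≤ 2 := fun m hm ω =>
    (Finset.sum_le_sum_of_subset_of_nonneg (Finset.range_mono hm)
      fun j _ _ => h.nonneg j ω).trans (hV ω)
  have hXm := h.measurable_X
  have hsm := h.measurable_s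
  -- the compensated exponential, a martingale up to small errors
  let A : ℕ → Ω → ℂ := fun m ω =>
    Complex.exp ((t * ∑ j ∈ Finset.range m, X j ω : ℝ) * Complex.I) *
      (Real.exp (t ^ 2 / 2 * ∑ j ∈ Finset.range m, s j ω) : ℂ)
  have hexp : ∀ m ≤ n, ∀ ω, Real.exp (t ^ 2 / 2 * ∑ j ∈ Finset.range m, s j ω)
      ≤ Real.exp (t ^ 2) := fun m hm ω => by
    rw [Real.exp_le_exp]
    nlinarith [hVm m hm ω, sq_nonneg t]
  have hAm : ∀ m, Measurable (A m) := fun m => by fun_prop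
  have hAint : ∀ m ≤ n, Integrable (A m) μ := fun m hm =>
    integrable_of_norm_le (hAm m) (Real.exp (t ^ 2)) fun ω => by
      rw [norm_mul, Complex.norm_exp_ofReal_mul_I, one_mul, Complex.norm_real, Real.norm_eq_abs,
        Real.abs_exp]
      exact hexp m hm ω
  have hstep : ∀ k ∈ Finset.range n, ‖∫ ω, A (k + 1) ω ∂μ - ∫ ω, A k ω ∂μ‖ ≤ Real.exp (t ^ 2) *
      (4 * |t| ^ 3 * ∫ ω, |X k ω| ^ 3 ∂μ + t ^ 4 / 4 * ∫ ω, X k ω ^ 4 ∂μ) := by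
    intro k hk
    have hk' : k + 1 ≤ n := Finset.mem_range.1 hk
    let B : Ω → ℂ := fun ω =>
      Complex.exp ((t * ∑ j ∈ Finset.range k, X j ω : ℝ) * Complex.I) *
        (Real.exp (t ^ 2 / 2 * ∑ j ∈ Finset.range (k + 1), s j ω) : ℂ)
    have hB : Measurable[F k] B := by
      have m1 := h.meas_sum_X k
      have m2 := h.meas_sum_s k
      have c1 : Measurable fun u : ℝ => Complex.exp ((t * u : ℝ) * Complex.I) := by fun_prop
      have c2 : Measurable fun u : ℝ => (Real.exp (t ^ 2 / 2 * u) : ℂ) := by fun_prop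
      exact (c1.comp m1).mul (c2.comp m2)
    have hBM : ∀ ω, ‖B ω‖ ≤ Real.exp (t ^ 2) := fun ω => by
      rw [norm_mul, Complex.norm_exp_ofReal_mul_I, one_mul, Complex.norm_real, Real.norm_eq_abs,
        Real.abs_exp]
      exact hexp (k + 1) hk' ω
    rw [← integral_sub (hAint _ hk') (hAint _ (by omega))]
    refine le_trans (le_of_eq ?_) (h.norm_integral_step_le k t hB hBM)
    congr 2
    ext ω
    have e1 : Complex.exp ((t * ∑ j ∈ Finset.range (k + 1), X j ω : ℝ) * Complex.I)
        = Complex.exp ((t * ∑ j ∈ Finset.range k, X j ω : ℝ) * Complex.I) *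
          Complex.exp ((t * X k ω : ℝ) * Complex.I) := by
      rw [← Complex.exp_add, Finset.sum_range_succ]
      push_cast
      ring_nf
    have e2 : (Real.exp (t ^ 2 / 2 * ∑ j ∈ Finset.range k, s j ω) : ℂ)
        = (Real.exp (t ^ 2 / 2 * ∑ j ∈ Finset.range (k + 1), s j ω) : ℂ) *
          (Real.exp (-(t ^ 2 / 2 * s k ω)) : ℂ) := by
      rw [← Complex.ofReal_mul, ← Real.exp_add, Finset.sum_range_succ]
      ring_nf
    simp only [A, B]
    rw [e1, e2]
    ring
  have htel : ‖∫ ω, A n ω ∂μ - 1‖ ≤ Real.exp (t ^ 2) * ∑ k ∈ Finset.range n,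
      (4 * |t| ^ 3 * ∫ ω, |X k ω| ^ 3 ∂μ + t ^ 4 / 4 * ∫ ω, X k ω ^ 4 ∂μ) := by
    have h0 : ∫ ω, A 0 ω ∂μ = 1 := by simp [A]
    rw [← h0, ← Finset.sum_range_sub (fun m => ∫ ω, A m ω ∂μ), Finset.mul_sum]
    exact (norm_sum_le _ _).trans (Finset.sum_le_sum hstep)
  have hE : Integrable (fun ω => Complex.exp ((t * ∑ j ∈ Finset.range n, X j ω : ℝ) *
      Complex.I)) μ :=
    integrable_of_norm_le (by fun_prop) 1 fun ω => (Complex.norm_exp_ofReal_mul_I _).le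
  have hVint : Integrable (fun ω => |∑ j ∈ Finset.range n, s j ω - 1|) μ :=
    integrable_of_abs_le (by fun_prop) 2 fun ω => by
      have h1 := hV ω
      have h2 : 0 ≤ ∑ j ∈ Finset.range n, s j ω := Finset.sum_nonneg fun j _ => h.nonneg j ω
      rw [abs_abs, abs_le]
      constructor <;> linarith
  have hdiff : ‖(∫ ω, Complex.exp ((t * ∑ j ∈ Finset.range n, X j ω : ℝ) * Complex.I) ∂μ) *
        (Real.exp (t ^ 2 / 2) : ℂ) - ∫ ω, A n ω ∂μ‖
      ≤ Real.exp (t ^ 2) * (t ^ 2 / 2) * ∫ ω, |∑ j ∈ Finset.range n, s j ω - 1| ∂μ := by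
    rw [← integral_mul_const, ← integral_sub (hE.mul_const _) (hAint n le_rfl),
      ← integral_const_mul]
    refine norm_integral_le_of_norm_le (hVint.const_mul _) (Eventually.of_forall fun ω => ?_)
    simp only [A]
    rw [← mul_sub, norm_mul, Complex.norm_exp_ofReal_mul_I, one_mul, ← Complex.ofReal_sub,
      Complex.norm_real, Real.norm_eq_abs]
    refine (abs_exp_sub_exp_le _ _).trans ?_
    have e : t ^ 2 / 2 - t ^ 2 / 2 * ∑ j ∈ Finset.range n, s j ω
        = -(t ^ 2 / 2 * (∑ j ∈ Finset.range n, s j ω - 1)) := by ring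
    rw [e, abs_neg, abs_mul, abs_of_nonneg (by positivity : 0 ≤ t ^ 2 / 2), ← mul_assoc]
    gcongr
    refine max_le (by nlinarith [sq_nonneg t]) ?_
    nlinarith [hV ω, sq_nonneg t]
  have e : ∫ ω, Complex.exp ((t * ∑ j ∈ Finset.range n, X j ω : ℝ) * Complex.I) ∂μ
        - (Real.exp (-(t ^ 2 / 2)) : ℂ)
      = (Real.exp (-(t ^ 2 / 2)) : ℂ) * ((∫ ω, A n ω ∂μ - 1)
        + ((∫ ω, Complex.exp ((t * ∑ j ∈ Finset.range n, X j ω : ℝ) * Complex.I) ∂μ) *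
        (Real.exp (t ^ 2 / 2) : ℂ) - ∫ ω, A n ω ∂μ)) := by
    have : (Real.exp (-(t ^ 2 / 2)) : ℂ) * (Real.exp (t ^ 2 / 2) : ℂ) = 1 := by
      rw [← Complex.ofReal_mul, ← Real.exp_add]; simp
    generalize ∫ ω, Complex.exp ((t * ∑ j ∈ Finset.range n, X j ω : ℝ) * Complex.I) ∂μ = z
    linear_combination (-z) * this
  rw [e, norm_mul, Complex.norm_real, Real.norm_eq_abs, Real.abs_exp]
  have h1 : Real.exp (-(t ^ 2 / 2)) ≤ 1 := Real.exp_le_one_iff.2 (by simp; positivity)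
  calc _ ≤ 1 * _ := mul_le_mul_of_nonneg_right h1 (norm_nonneg _)
    _ ≤ _ := by
      rw [one_mul]
      exact (norm_add_le _ _).trans (add_le_add htel hdiff)

/-- Quantitative martingale central limit theorem: the characteristic function of the sum of a
martingale difference sequence is close to that of `N(0,1)` as soon as the absolute moments of
orders three and four of the increments are small and the sum of the conditional variances is close
to `1` in mean square. -/
theorem norm_integral_exp_sub_le (h : IsMartingaleDiff μ F X s K) (n : ℕ) (t : ℝ) :
    ‖∫ ω, Complex.exp ((t * ∑ j ∈ Finset.range n, X j ω : ℝ) * Complex.I) ∂μ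
        - (Real.exp (-(t ^ 2 / 2)) : ℂ)‖
      ≤ Real.exp (t ^ 2) * ∑ k ∈ Finset.range n,
          (4 * |t| ^ 3 * ∫ ω, |X k ω| ^ 3 ∂μ + t ^ 4 / 4 * ∫ ω, X k ω ^ 4 ∂μ)
        + Real.exp (t ^ 2) * (t ^ 2 / 2) *
          ∫ ω, |∑ j ∈ Finset.range n, s j ω - 1| ∂μ
        + 2 * ∫ ω, (∑ j ∈ Finset.range n, s j ω - 1) ^ 2 ∂μ := by
  have hXm := h.measurable_X
  have hsm := h.measurable_s
  have hXm' := h.truncate.measurable_X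
  have hsm' := h.truncate.measurable_s
  have hmain := h.truncate.norm_integral_exp_sub_le_of_sum_le n (truncated_sum_le h.nonneg n) t
  have hsb : ∀ k ω, |s k ω| ≤ K := fun k ω => by
    rw [abs_of_nonneg (h.nonneg k ω)]; exact h.s_le k ω
  have hSb : ∀ ω, |∑ j ∈ Finset.range n, s j ω - 1| ≤ n * K + 1 := fun ω => by
    refine (abs_sub _ _).trans ?_
    rw [abs_one]
    gcongr
    refine (Finset.abs_sum_le_sum_abs _ _).trans ?_
    refine (Finset.sum_le_sum fun k _ => hsb k ω).trans ?_
    simp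
  have hVint : Integrable (fun ω => |∑ j ∈ Finset.range n, s j ω - 1|) μ :=
    integrable_of_abs_le (by fun_prop) (n * K + 1) fun ω => by rw [abs_abs]; exact hSb ω
  have hV2int : Integrable (fun ω => (∑ j ∈ Finset.range n, s j ω - 1) ^ 2) μ :=
    integrable_of_abs_le (by fun_prop) ((n * K + 1) ^ 2) fun ω => by
      rw [abs_pow]; exact pow_le_pow_left₀ (abs_nonneg _) (hSb ω) 2
  have m3 : ∀ k, Integrable (fun ω => |X k ω| ^ 3) μ := fun k =>
    integrable_of_abs_le (by fun_prop) (K ^ 3) fun ω => by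
      rw [abs_pow, abs_abs]; exact pow_le_pow_left₀ (abs_nonneg _) (h.abs_X_le k ω) 3
  have m4 : ∀ k, Integrable (fun ω => X k ω ^ 4) μ := fun k =>
    integrable_of_abs_le (by fun_prop) (K ^ 4) fun ω => by
      rw [abs_pow]; exact pow_le_pow_left₀ (abs_nonneg _) (h.abs_X_le k ω) 4
  have b3 : ∀ k, ∫ ω, |if ∑ j ∈ Finset.range (k + 1), s j ω ≤ 2 then X k ω else 0| ^ 3 ∂μ
      ≤ ∫ ω, |X k ω| ^ 3 ∂μ := fun k =>
    integral_mono_of_nonneg (Eventually.of_forall fun ω => by positivity) (m3 k)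
      (Eventually.of_forall fun ω => by dsimp only; split_ifs <;> simp)
  have b4 : ∀ k, ∫ ω, (if ∑ j ∈ Finset.range (k + 1), s j ω ≤ 2 then X k ω else 0) ^ 4 ∂μ
      ≤ ∫ ω, X k ω ^ 4 ∂μ := fun k =>
    integral_mono_of_nonneg (Eventually.of_forall fun ω => by positivity) (m4 k)
      (Eventually.of_forall fun ω => by
        dsimp only; split_ifs <;> [exact le_rfl; (simp; positivity)])
  have b1 : ∫ ω, |∑ k ∈ Finset.range n,
      (if ∑ j ∈ Finset.range (k + 1), s j ω ≤ 2 then s k ω else 0) - 1| ∂μ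
      ≤ ∫ ω, |∑ j ∈ Finset.range n, s j ω - 1| ∂μ := by
    refine integral_mono_of_nonneg (Eventually.of_forall fun ω => by positivity) hVint
      (Eventually.of_forall fun ω => ?_)
    dsimp only
    by_cases hω : ∑ j ∈ Finset.range n, s j ω ≤ 2
    · rw [truncated_eq h.nonneg s hω]
    · have h1 := truncated_sum_le h.nonneg n ω
      have h2 : 0 ≤ ∑ k ∈ Finset.range n,
          (if ∑ j ∈ Finset.range (k + 1), s j ω ≤ 2 then s k ω else 0) :=
        Finset.sum_nonneg fun k _ => h.truncate.nonneg k ω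
      rw [abs_of_nonneg (by linarith : 0 ≤ ∑ j ∈ Finset.range n, s j ω - 1), abs_le]
      constructor <;> linarith
  have hZ : ∀ Y : ℕ → Ω → ℝ, (∀ k, Measurable (Y k)) → Integrable (fun ω =>
      Complex.exp ((t * ∑ j ∈ Finset.range n, Y j ω : ℝ) * Complex.I)) μ := fun Y hY =>
    integrable_of_norm_le (by fun_prop) 1 fun ω => (Complex.norm_exp_ofReal_mul_I _).le
  have hcomp : ‖∫ ω, Complex.exp ((t * ∑ j ∈ Finset.range n, X j ω : ℝ) * Complex.I) ∂μ
      - ∫ ω, Complex.exp ((t * ∑ k ∈ Finset.range n,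
        (if ∑ j ∈ Finset.range (k + 1), s j ω ≤ 2 then X k ω else 0) : ℝ) * Complex.I) ∂μ‖
      ≤ 2 * ∫ ω, (∑ j ∈ Finset.range n, s j ω - 1) ^ 2 ∂μ := by
    rw [← integral_sub (hZ X hXm) (hZ _ hXm'), ← integral_const_mul]
    refine norm_integral_le_of_norm_le (hV2int.const_mul _) (Eventually.of_forall fun ω => ?_)
    by_cases hω : ∑ j ∈ Finset.range n, s j ω ≤ 2
    · rw [truncated_eq h.nonneg X hω, sub_self, norm_zero]
      positivity
    · -- the exponentials differ by at most `2`, and here `1 ≤ (∑ s - 1) ^ 2`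
      refine (norm_sub_le _ _).trans ?_
      rw [Complex.norm_exp_ofReal_mul_I, Complex.norm_exp_ofReal_mul_I]
      nlinarith
  refine (norm_sub_le_norm_sub_add_norm_sub _ _ _).trans
    ((add_le_add hcomp hmain).trans ?_)
  rw [add_comm]
  refine add_le_add_left (add_le_add (mul_le_mul_of_nonneg_left ?_ (by positivity))
    (mul_le_mul_of_nonneg_left b1 (by positivity))) _
  exact Finset.sum_le_sum fun k _ => add_le_add
    (mul_le_mul_of_nonneg_left (b3 k) (by positivity))
    (mul_le_mul_of_nonneg_left (b4 k) (by positivity))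

end IsMartingaleDiff

end

/-! ### Bounded measurable functions -/

section

/-- A bounded measurable real function. All random variables of the argument are of this kind, so
that integrability never is an issue. -/
structure BddMeas {Ω : Type*} [MeasurableSpace Ω] (f : Ω → ℝ) : Prop where
  meas : Measurable f
  bdd : ∃ C, ∀ ω, |f ω| ≤ C

namespace BddMeas

variable {Ω Ω' : Type*} [MeasurableSpace Ω] [MeasurableSpace Ω'] {f g : Ω → ℝ}

lemma integrable (hf : BddMeas f) (μ : Measure Ω) [IsFiniteMeasure μ] : Integrable f μ := by
  obtain ⟨C, hC⟩ := hf.bdd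
  exact integrable_of_abs_le hf.meas C hC

lemma const (c : ℝ) : BddMeas fun _ : Ω => c := ⟨measurable_const, |c|, fun _ => le_rfl⟩

lemma add (hf : BddMeas f) (hg : BddMeas g) : BddMeas fun ω => f ω + g ω := by
  obtain ⟨C, hC⟩ := hf.bdd
  obtain ⟨D, hD⟩ := hg.bdd
  exact ⟨hf.meas.add hg.meas, C + D, fun ω => (abs_add_le _ _).trans (add_le_add (hC ω) (hD ω))⟩

lemma mul (hf : BddMeas f) (hg : BddMeas g) : BddMeas fun ω => f ω * g ω := by
  obtain ⟨C, hC⟩ := hf.bdd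
  obtain ⟨D, hD⟩ := hg.bdd
  refine ⟨hf.meas.mul hg.meas, C * D, fun ω => ?_⟩
  rw [abs_mul]
  exact mul_le_mul (hC ω) (hD ω) (abs_nonneg _) ((abs_nonneg _).trans (hC ω))

lemma const_mul (c : ℝ) (hf : BddMeas f) : BddMeas fun ω => c * f ω := (const c).mul hf

lemma neg (hf : BddMeas f) : BddMeas fun ω => - f ω := by
  simpa using hf.const_mul (-1)

lemma sub (hf : BddMeas f) (hg : BddMeas g) : BddMeas fun ω => f ω - g ω := by
  simpa [sub_eq_add_neg] using hf.add hg.neg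

lemma pow (hf : BddMeas f) (n : ℕ) : BddMeas fun ω => f ω ^ n := by
  obtain ⟨C, hC⟩ := hf.bdd
  refine ⟨hf.meas.pow_const n, C ^ n, fun ω => ?_⟩
  rw [abs_pow]
  exact pow_le_pow_left₀ (abs_nonneg _) (hC ω) n

lemma abs (hf : BddMeas f) : BddMeas fun ω => |f ω| := by
  obtain ⟨C, hC⟩ := hf.bdd
  exact ⟨hf.meas.abs, C, fun ω => by rw [abs_abs]; exact hC ω⟩

lemma sum {ι : Type*} (s : Finset ι) {f : ι → Ω → ℝ} (hf : ∀ i ∈ s, BddMeas (f i)) :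
    BddMeas fun ω => ∑ i ∈ s, f i ω := by
  classical
  induction s using Finset.induction_on with
  | empty => simpa using const 0
  | insert a s ha ih =>
    simp_rw [Finset.sum_insert ha]
    exact (hf a (Finset.mem_insert_self a s)).add
      (ih fun i hi => hf i (Finset.mem_insert_of_mem hi))

lemma comp (hf : BddMeas f) {φ : Ω' → Ω} (hφ : Measurable φ) : BddMeas fun ω => f (φ ω) := by
  obtain ⟨C, hC⟩ := hf.bdd
  exact ⟨hf.meas.comp hφ, C, fun ω => hC _⟩

lemma integral_right {f : Ω' × Ω → ℝ} (hf : BddMeas f) (μ : Measure Ω) [IsProbabilityMeasure μ] :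
    BddMeas fun a => ∫ b, f (a, b) ∂μ := by
  obtain ⟨C, hC⟩ := hf.bdd
  refine ⟨(hf.meas.stronglyMeasurable.integral_prod_right (f := fun a b => f (a, b))).measurable,
    C, fun a => ?_⟩
  have := norm_integral_le_of_norm_le_const (μ := μ) (f := fun b => f (a, b)) (C := C)
    (Eventually.of_forall fun b => hC _)
  simpa using this

end BddMeas

lemma sq_integral_le {Ω : Type*} [MeasurableSpace Ω] (μ : Measure Ω) [IsProbabilityMeasure μ]
    {f : Ω → ℝ} (hf : BddMeas f) : (∫ ω, f ω ∂μ) ^ 2 ≤ ∫ ω, f ω ^ 2 ∂μ := by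
  have h : 0 ≤ ∫ ω, (f ω - ∫ ω, f ω ∂μ) ^ 2 ∂μ := integral_nonneg fun ω => sq_nonneg _
  have e : ∀ ω, (f ω - ∫ ω, f ω ∂μ) ^ 2
      = f ω ^ 2 - (2 * ∫ ω, f ω ∂μ) * f ω + (∫ ω, f ω ∂μ) ^ 2 := fun ω => by ring
  simp_rw [e] at h
  rw [integral_add (((hf.pow 2).sub (hf.const_mul _)).integrable μ)
    (integrable_const _), integral_sub ((hf.pow 2).integrable μ) ((hf.const_mul _).integrable μ),
    integral_const_mul, integral_const] at h
  simp only [probReal_univ, one_smul] at h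
  nlinarith

lemma sq_integral_mul_le {Ω : Type*} [MeasurableSpace Ω] (μ : Measure Ω) [IsProbabilityMeasure μ]
    {f g : Ω → ℝ} (hf : BddMeas f) (hg : BddMeas g) :
    (∫ ω, f ω * g ω ∂μ) ^ 2 ≤ (∫ ω, f ω ^ 2 ∂μ) * ∫ ω, g ω ^ 2 ∂μ := by
  have key : ∀ r : ℝ, 0 ≤ (∫ ω, g ω ^ 2 ∂μ) * (r * r) + (2 * ∫ ω, f ω * g ω ∂μ) * r
      + ∫ ω, f ω ^ 2 ∂μ := fun r => by
    have h : 0 ≤ ∫ ω, (f ω + r * g ω) ^ 2 ∂μ := integral_nonneg fun ω => sq_nonneg _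
    have e : ∀ ω, (f ω + r * g ω) ^ 2
        = f ω ^ 2 + (2 * r) * (f ω * g ω) + r ^ 2 * g ω ^ 2 := fun ω => by ring
    simp_rw [e] at h
    rw [integral_add (((hf.pow 2).add ((hf.mul hg).const_mul _)).integrable μ)
      (((hg.pow 2).const_mul _).integrable μ), integral_add ((hf.pow 2).integrable μ)
      (((hf.mul hg).const_mul _).integrable μ), integral_const_mul, integral_const_mul] at h
    linarith
  have := discrim_le_zero key
  rw [discrim] at this
  linarith

end

/-! ### Product measures and degenerate kernels -/

section

variable {ι α : Type*} [MeasurableSpace α]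

/-- A family of bounded kernels `h i k`, each of which integrates to zero in either variable. -/
structure IsDegenerate (ν : ι → Measure α) (h : ι → ι → α → α → ℝ) : Prop where
  bddMeas : ∀ i k, BddMeas fun p : α × α => h i k p.1 p.2
  left : ∀ i k b, ∫ a, h i k a b ∂(ν i) = 0
  right : ∀ i k a, ∫ b, h i k a b ∂(ν k) = 0

lemma IsDegenerate.bddMeas_eval {ν : ι → Measure α} {h : ι → ι → α → α → ℝ}
    (hh : IsDegenerate ν h) (i k : ι) :
    BddMeas fun x : ι → α => h i k (x i) (x k) :=
  (hh.bddMeas i k).comp (by fun_prop : Measurable fun x : ι → α => (x i, x k))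

variable [Fintype ι] [DecidableEq ι] (ν : ι → Measure α)
  [∀ i, IsProbabilityMeasure (ν i)]

/-- Resampling one coordinate of a product measure leaves it invariant. -/
lemma measurePreserving_update (k : ι) :
    MeasurePreserving (fun p : (ι → α) × α => Function.update p.1 k p.2)
      ((Measure.pi ν).prod (ν k)) (Measure.pi ν) := by
  refine ⟨measurable_update', (Measure.pi_eq fun s hs => ?_).symm⟩
  rw [Measure.map_apply measurable_update' (MeasurableSet.univ_pi hs)]
  have : (fun p : (ι → α) × α => Function.update p.1 k p.2) ⁻¹' Set.univ.pi s
      = (Set.univ.pi (Function.update s k Set.univ)) ×ˢ s k := by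
    ext ⟨x, v⟩
    simp only [Set.mem_preimage, Set.mem_univ_pi, Set.mem_prod]
    constructor
    · intro h
      refine ⟨fun i => ?_, by simpa using h k⟩
      rcases eq_or_ne i k with rfl | hi
      · simp
      · simpa [hi] using h i
    · rintro ⟨h1, h2⟩ i
      rcases eq_or_ne i k with rfl | hi
      · simpa using h2
      · simpa [hi] using h1 i
  rw [this, Measure.prod_prod, Measure.pi_pi, ← Finset.prod_erase_mul _ _ (Finset.mem_univ k),
    ← Finset.prod_erase_mul _ _ (Finset.mem_univ k)]
  simp only [Function.update_self, measure_univ, mul_one]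
  congr 1
  refine Finset.prod_congr rfl fun i hi => ?_
  rw [Function.update_of_ne (Finset.ne_of_mem_erase hi)]

/-- Integrating out the coordinate `k`. -/
lemma integral_pi_update (k : ι) {f : (ι → α) → ℝ} (hf : BddMeas f) :
    ∫ x, f x ∂(Measure.pi ν) = ∫ x, ∫ v, f (Function.update x k v) ∂(ν k) ∂(Measure.pi ν) := by
  have h := measurePreserving_update ν k
  conv_lhs => rw [← h.map_eq]
  rw [integral_map h.measurable.aemeasurable hf.meas.aestronglyMeasurable,
    integral_prod _ ((hf.comp measurable_update').integrable _)]

lemma integral_pi_eval (k : ι) {f : α → ℝ} (hf : BddMeas f) :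
    ∫ x, f (x k) ∂(Measure.pi ν) = ∫ v, f v ∂(ν k) := by
  rw [integral_pi_update ν k (hf.comp (measurable_pi_apply k))]
  simp

lemma integral_pi_eval₂ {i k : ι} (hik : i ≠ k) {f : α × α → ℝ} (hf : BddMeas f) :
    ∫ x, f (x i, x k) ∂(Measure.pi ν) = ∫ a, ∫ b, f (a, b) ∂(ν k) ∂(ν i) := by
  rw [integral_pi_update ν k (hf.comp (by fun_prop : Measurable fun x : ι → α => (x i, x k)))]
  simp only [Function.update_self, Function.update_of_ne hik]
  exact integral_pi_eval ν i (hf.integral_right (ν k))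

namespace IsDegenerate

variable {ν} {h : ι → ι → α → α → ℝ}

lemma integral_mul_left (hh : IsDegenerate ν h) {i k : ι} (hik : i ≠ k) {ψ : (ι → α) → ℝ}
    (hψ : BddMeas ψ) (hψi : ∀ x v, ψ (Function.update x i v) = ψ x) :
    ∫ x, h i k (x i) (x k) * ψ x ∂(Measure.pi ν) = 0 := by
  rw [integral_pi_update ν i ((hh.bddMeas_eval i k).mul hψ)]
  simp [hψi, Function.update_of_ne hik.symm, integral_mul_const, hh.left]

lemma integral_mul_right (hh : IsDegenerate ν h) {i k : ι} (hik : i ≠ k) {ψ : (ι → α) → ℝ}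
    (hψ : BddMeas ψ) (hψk : ∀ x v, ψ (Function.update x k v) = ψ x) :
    ∫ x, h i k (x i) (x k) * ψ x ∂(Measure.pi ν) = 0 := by
  rw [integral_pi_update ν k ((hh.bddMeas_eval i k).mul hψ)]
  simp [hψk, Function.update_of_ne hik, integral_mul_const, hh.right]

/-- Distinct summands of a degenerate `U`-statistic are orthogonal. -/
lemma integral_mul_eq_zero [LinearOrder ι] (hh : IsDegenerate ν h) {p q : ι × ι}
    (hp : p.1 < p.2) (hq : q.1 < q.2) (hpq : p ≠ q) :
    ∫ x, h p.1 p.2 (x p.1) (x p.2) * h q.1 q.2 (x q.1) (x q.2) ∂(Measure.pi ν) = 0 := by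
  by_cases h1 : p.1 = q.1 ∨ p.1 = q.2
  · have h2 : p.2 ≠ q.1 ∧ p.2 ≠ q.2 := by
      refine ⟨fun e => ?_, fun e => ?_⟩
      · rcases h1 with e1 | e1
        · exact absurd (e1.trans e.symm) hp.ne
        · rw [e1, e] at hp
          exact absurd hp hq.not_gt
      · rcases h1 with e1 | e1
        · exact hpq (Prod.ext e1 e)
        · exact absurd (e1.trans e.symm) hp.ne
    refine hh.integral_mul_right hp.ne (hh.bddMeas_eval _ _) fun x v => ?_
    rw [Function.update_of_ne h2.1.symm, Function.update_of_ne h2.2.symm]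
  · push Not at h1
    refine hh.integral_mul_left hp.ne (hh.bddMeas_eval _ _) fun x v => ?_
    rw [Function.update_of_ne h1.1.symm, Function.update_of_ne h1.2.symm]

/-- The second moment of a degenerate `U`-statistic. -/
lemma integral_sum_sq [LinearOrder ι] (hh : IsDegenerate ν h) :
    ∫ x, (∑ p : ι × ι with p.1 < p.2, h p.1 p.2 (x p.1) (x p.2)) ^ 2 ∂(Measure.pi ν)
      = ∑ p : ι × ι with p.1 < p.2, ∫ a, ∫ b, h p.1 p.2 a b ^ 2 ∂(ν p.2) ∂(ν p.1) := by
  simp_rw [sq (∑ p : ι × ι with p.1 < p.2, _), Finset.sum_mul_sum]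
  rw [integral_finsetSum _ fun p _ => (BddMeas.sum _ fun q _ =>
    (hh.bddMeas_eval p.1 p.2).mul (hh.bddMeas_eval q.1 q.2)).integrable _]
  refine Finset.sum_congr rfl fun p hp => ?_
  rw [integral_finsetSum _ fun q _ =>
    ((hh.bddMeas_eval p.1 p.2).mul (hh.bddMeas_eval q.1 q.2)).integrable _,
    Finset.sum_eq_single p]
  · simp_rw [← sq]
    exact integral_pi_eval₂ ν (Finset.mem_filter.1 hp).2.ne ((hh.bddMeas p.1 p.2).pow 2)
  · intro q hq hqp
    exact hh.integral_mul_eq_zero (Finset.mem_filter.1 hp).2 (Finset.mem_filter.1 hq).2 hqp.symm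
  · exact fun h => absurd hp h

/-- Integrating the square of a row of a degenerate `U`-statistic against a function which does not
involve the row indices: the cross terms vanish. -/
lemma integral_row_sq_mul (hh : IsDegenerate ν h) {k : ι} (I : Finset ι) (hk : k ∉ I)
    {ψ : (ι → α) → ℝ} (hψ : BddMeas ψ) (hψI : ∀ i ∈ I, ∀ x v, ψ (Function.update x i v) = ψ x) :
    ∫ x, (∑ i ∈ I, h i k (x i) (x k)) ^ 2 * ψ x ∂(Measure.pi ν)
      = ∑ i ∈ I, ∫ x, h i k (x i) (x k) ^ 2 * ψ x ∂(Measure.pi ν) := by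
  simp_rw [sq (∑ i ∈ I, _), Finset.sum_mul_sum, Finset.sum_mul]
  rw [integral_finsetSum _ fun p _ => (BddMeas.sum _ fun q _ =>
    ((hh.bddMeas_eval p k).mul (hh.bddMeas_eval q k)).mul hψ).integrable _]
  refine Finset.sum_congr rfl fun i hi => ?_
  have hik : i ≠ k := fun e => hk (e ▸ hi)
  rw [integral_finsetSum _ fun q _ =>
    (((hh.bddMeas_eval i k).mul (hh.bddMeas_eval q k)).mul hψ).integrable _,
    Finset.sum_eq_single i]
  · simp_rw [← sq]
  · intro q hq hqi
    simp_rw [mul_assoc]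
    refine hh.integral_mul_left hik ((hh.bddMeas_eval q k).mul hψ) fun x v => ?_
    rw [hψI i hi, Function.update_of_ne hqi, Function.update_of_ne hik.symm]
  · exact fun h => absurd hi h

/-- Rosenthal-type bound for a row of a degenerate `U`-statistic. Adding a summand leaves only the
mixed moment of orders two and two, as the summands with a simple factor integrate to zero. -/
lemma integral_row_pow_four_le (hh : IsDegenerate ν h) {k : ι} {C : ℝ}
    (hC : ∀ i, i ≠ k → ∫ a, ∫ b, h i k a b ^ 4 ∂(ν k) ∂(ν i) ≤ C) (I : Finset ι) (hk : k ∉ I) :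
    ∫ x, (∑ i ∈ I, h i k (x i) (x k)) ^ 4 ∂(Measure.pi ν) ≤ 3 * (I.card : ℝ) ^ 2 * C := by
  induction I using Finset.induction_on with
  | empty => simp
  | insert m I hm ih =>
    have hkI : k ∉ I := fun e => hk (Finset.mem_insert_of_mem e)
    have hmk : m ≠ k := fun e => hk (e ▸ Finset.mem_insert_self m I)
    have hne : ∀ i ∈ I, i ≠ k := fun i hi e => hkI (e ▸ hi)
    have hnm : ∀ i ∈ I, i ≠ m := fun i hi e => hm (e ▸ hi)
    have ih := ih hkI
    have bf := fun i => hh.bddMeas_eval i k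
    have bS : BddMeas fun x : ι → α => ∑ i ∈ I, h i k (x i) (x k) :=
      BddMeas.sum _ fun i _ => bf i
    have hSm : ∀ x v, ∑ i ∈ I, h i k (Function.update x m v i) (Function.update x m v k)
        = ∑ i ∈ I, h i k (x i) (x k) := fun x v =>
      Finset.sum_congr rfl fun i hi => by
        rw [Function.update_of_ne (hnm i hi), Function.update_of_ne hmk.symm]
    have hηI : ∀ i ∈ I, ∀ (x : ι → α) (v : α),
        h m k (Function.update x i v m) (Function.update x i v k)
        = h m k (x m) (x k) := fun i hi x v => by
      rw [Function.update_of_ne (hnm i hi).symm, Function.update_of_ne (hne i hi).symm]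
    have h4 : ∀ i, i ≠ k → ∫ x, h i k (x i) (x k) ^ 4 ∂(Measure.pi ν) ≤ C := fun i hi => by
      rw [integral_pi_eval₂ ν hi ((hh.bddMeas i k).pow 4)]
      exact hC i hi
    have e3 : ∫ x, h m k (x m) (x k) * (∑ i ∈ I, h i k (x i) (x k)) ^ 3 ∂(Measure.pi ν) = 0 :=
      hh.integral_mul_left hmk (bS.pow 3) fun x v => by rw [hSm]
    have e1 : ∫ x, (∑ i ∈ I, h i k (x i) (x k)) * h m k (x m) (x k) ^ 3 ∂(Measure.pi ν) = 0 := by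
      simp_rw [Finset.sum_mul]
      rw [integral_finsetSum _ fun i _ => ((bf i).mul ((bf m).pow 3)).integrable _]
      refine Finset.sum_eq_zero fun i hi => ?_
      exact hh.integral_mul_left (hne i hi) ((bf m).pow 3) fun x v => by rw [hηI i hi]
    have e2 : ∫ x, (∑ i ∈ I, h i k (x i) (x k)) ^ 2 * h m k (x m) (x k) ^ 2 ∂(Measure.pi ν)
        ≤ I.card * C := by
      rw [hh.integral_row_sq_mul I hkI ((bf m).pow 2) fun i hi x v => by rw [hηI i hi],
        ← nsmul_eq_mul]
      refine Finset.sum_le_card_nsmul _ _ _ fun i hi => ?_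
      calc _ ≤ ∫ x, (1 / 2 * h i k (x i) (x k) ^ 4 + 1 / 2 * h m k (x m) (x k) ^ 4)
              ∂(Measure.pi ν) := by
            refine integral_mono ((((bf i).pow 2).mul ((bf m).pow 2)).integrable _)
              (((((bf i).pow 4).const_mul _).add (((bf m).pow 4).const_mul _)).integrable _)
              fun x => ?_
            dsimp only
            nlinarith [sq_nonneg (h i k (x i) (x k) ^ 2 - h m k (x m) (x k) ^ 2)]
        _ ≤ C := by
            rw [integral_add ((((bf i).pow 4).const_mul _).integrable _)
              ((((bf m).pow 4).const_mul _).integrable _), integral_const_mul,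
              integral_const_mul]
            linarith [h4 i (hne i hi), h4 m hmk]
    simp_rw [Finset.sum_insert hm]
    have e : ∀ x : ι → α, (h m k (x m) (x k) + ∑ i ∈ I, h i k (x i) (x k)) ^ 4
        = (∑ i ∈ I, h i k (x i) (x k)) ^ 4
          + (4 * (h m k (x m) (x k) * (∑ i ∈ I, h i k (x i) (x k)) ^ 3)
          + (6 * ((∑ i ∈ I, h i k (x i) (x k)) ^ 2 * h m k (x m) (x k) ^ 2)
          + (4 * ((∑ i ∈ I, h i k (x i) (x k)) * h m k (x m) (x k) ^ 3)
          + h m k (x m) (x k) ^ 4))) := fun x => by ring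
    simp_rw [e]
    have b1 := (bf m).pow 4
    have b2 := (bS.mul ((bf m).pow 3)).const_mul 4
    have b3 := ((bS.pow 2).mul ((bf m).pow 2)).const_mul 6
    have b4 := ((bf m).mul (bS.pow 3)).const_mul 4
    rw [integral_add ((bS.pow 4).integrable _) ((b4.add (b3.add (b2.add b1))).integrable _),
      integral_add (b4.integrable _) ((b3.add (b2.add b1)).integrable _),
      integral_add (b3.integrable _) ((b2.add b1).integrable _),
      integral_add (b2.integrable _) (b1.integrable _), integral_const_mul, integral_const_mul,
      integral_const_mul, e1, e3, Finset.card_insert_of_notMem hm]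
    have h5 := h4 m hmk
    have hC0 : 0 ≤ C := le_trans (integral_nonneg fun x => by positivity) h5
    push_cast
    nlinarith

end IsDegenerate

end

/-! ### The filtration of the coordinates -/

section

variable {N : ℕ} {α : Type*} [MeasurableSpace α]

/-- The `σ`-algebra of the events which only involve the coordinates `0, …, k - 1`. It is described
by its events, so that measurable functions visibly do not change with the later coordinates. -/
@[reducible] def pastSigma (N : ℕ) (α : Type*) [MeasurableSpace α] (k : ℕ) :
    MeasurableSpace (Fin N → α) where
  MeasurableSet' s := MeasurableSet s ∧
    ∀ x y : Fin N → α, (∀ i : Fin N, (i : ℕ) < k → x i = y i) → x ∈ s → y ∈ s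
  measurableSet_empty := ⟨MeasurableSet.empty, fun _ _ _ h => h⟩
  measurableSet_compl s hs :=
    ⟨hs.1.compl, fun x y h hx hy => hx (hs.2 y x (fun i hi => (h i hi).symm) hy)⟩
  measurableSet_iUnion s hs := ⟨MeasurableSet.iUnion fun i => (hs i).1, fun x y h hx => by
    obtain ⟨i, hi⟩ := Set.mem_iUnion.1 hx
    exact Set.mem_iUnion.2 ⟨i, (hs i).2 x y h hi⟩⟩

lemma pastSigma_le (k : ℕ) : pastSigma N α k ≤ (inferInstance : MeasurableSpace (Fin N → α)) :=
  fun _ hs => hs.1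

lemma pastSigma_mono : Monotone (pastSigma N α) := fun _ _ hkl _ hs =>
  ⟨hs.1, fun x y h => hs.2 x y fun i hi => h i (hi.trans_le hkl)⟩

lemma measurable_pastSigma {k : ℕ} {f : (Fin N → α) → ℝ} (hf : Measurable f)
    (h : ∀ x y : Fin N → α, (∀ i : Fin N, (i : ℕ) < k → x i = y i) → f x = f y) :
    Measurable[pastSigma N α k] f := fun s hs =>
  ⟨hf hs, fun x y hxy hx => by rwa [Set.mem_preimage, ← h x y hxy]⟩

lemma update_eq_of_measurable_pastSigma {f : (Fin N → α) → ℝ} {k : Fin N}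
    (hf : Measurable[pastSigma N α k] f) (x : Fin N → α) (v : α) :
    f (Function.update x k v) = f x := by
  have h := (hf (measurableSet_singleton (f x))).2 x (Function.update x k v) (fun i hi => by
    rw [Function.update_of_ne (by rintro rfl; exact lt_irrefl _ hi)]) rfl
  exact h

end

/-! ### Sums over pairs of indices -/

section

variable {N : ℕ}

lemma sum_Ioi_eq_sum_pairs (f : Fin N → Fin N → ℝ) :
    ∑ i, ∑ j ∈ Finset.Ioi i, f i j = ∑ p : Fin N × Fin N with p.1 < p.2, f p.1 p.2 := by
  rw [Finset.sum_filter, Fintype.sum_prod_type]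
  refine Finset.sum_congr rfl fun i _ => ?_
  rw [← Finset.sum_filter]
  congr 1
  ext j
  simp

lemma sum_Iio_eq_sum_pairs (f : Fin N → Fin N → ℝ) :
    ∑ k, ∑ i ∈ Finset.Iio k, f i k = ∑ p : Fin N × Fin N with p.1 < p.2, f p.1 p.2 := by
  rw [Finset.sum_filter, Fintype.sum_prod_type_right]
  refine Finset.sum_congr rfl fun i _ => ?_
  rw [← Finset.sum_filter]
  congr 1
  ext j
  simp

/-- A symmetric sum over `i, l < k`, split into the diagonal `i = l` and twice the part `i < l`. -/
lemma sum_Iio_Iio_eq (A : Fin N → Fin N → Fin N → ℝ) (hA : ∀ k i l, A k i l = A k l i) :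
    ∑ k, ∑ i ∈ Finset.Iio k, ∑ l ∈ Finset.Iio k, A k i l
      = ∑ i, ∑ k ∈ Finset.Ioi i, A k i i
        + 2 * ∑ p : Fin N × Fin N with p.1 < p.2, ∑ k ∈ Finset.Ioi p.2, A k p.1 p.2 := by
  have hIio : ∀ (k : Fin N) (f : Fin N → ℝ),
      ∑ i ∈ Finset.Iio k, f i = ∑ i, if i < k then f i else 0 :=
    fun k f => by rw [← Finset.sum_filter]; congr 1; ext; simp
  have hIoi : ∀ (k : Fin N) (f : Fin N → ℝ),
      ∑ i ∈ Finset.Ioi k, f i = ∑ i, if k < i then f i else 0 :=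
    fun k f => by rw [← Finset.sum_filter]; congr 1; ext; simp
  have h0 : ∑ k, ∑ i ∈ Finset.Iio k, ∑ l ∈ Finset.Iio k, A k i l
      = ∑ k, ∑ i, ∑ l, if i < k ∧ l < k then A k i l else 0 := by
    simp_rw [hIio, ite_and]
    refine Finset.sum_congr rfl fun k _ => Finset.sum_congr rfl fun i _ => ?_
    split_ifs <;> simp
  have h1 : ∑ i, ∑ k ∈ Finset.Ioi i, A k i i
      = ∑ k, ∑ i, ∑ l, if l = i ∧ i < k then A k i l else 0 := by
    rw [Finset.sum_comm' (t' := Finset.univ) (s' := fun k => Finset.Iio k) (by simp)]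
    simp_rw [hIio, ite_and]
    refine Finset.sum_congr rfl fun k _ => Finset.sum_congr rfl fun i _ => ?_
    simp
  have h2 : ∑ p : Fin N × Fin N with p.1 < p.2, ∑ k ∈ Finset.Ioi p.2, A k p.1 p.2
      = ∑ k, ∑ i, ∑ l, if i < l ∧ l < k then A k i l else 0 := by
    simp_rw [Finset.sum_filter, Fintype.sum_prod_type, hIoi]
    have : ∀ i l : Fin N, (if i < l then ∑ k, (if l < k then A k i l else 0) else 0)
        = ∑ k, if i < l ∧ l < k then A k i l else 0 := fun i l => by
      by_cases h : i < l <;> simp [h]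
    simp_rw [this]
    calc _ = ∑ i, ∑ k, ∑ l, (if i < l ∧ l < k then A k i l else 0) :=
          Finset.sum_congr rfl fun i _ => Finset.sum_comm
      _ = _ := Finset.sum_comm
  have h3 : ∑ k, ∑ i, ∑ l, (if i < l ∧ l < k then A k i l else 0)
      = ∑ k, ∑ i, ∑ l, if l < i ∧ i < k then A k i l else 0 := by
    refine Finset.sum_congr rfl fun k _ => ?_
    rw [Finset.sum_comm]
    simp_rw [hA k]
  rw [h0, h1, two_mul]
  nth_rewrite 2 [h2]
  rw [h2, h3]
  nth_rewrite 1 [← h3]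
  simp_rw [← Finset.sum_add_distrib]
  refine Finset.sum_congr rfl fun k _ => Finset.sum_congr rfl fun i _ =>
    Finset.sum_congr rfl fun l _ => ?_
  rcases lt_trichotomy i l with h | h | h
  · have e : (i < k ∧ l < k) ↔ l < k := ⟨fun x => x.2, fun x => ⟨h.trans x, x⟩⟩
    simp [h, h.ne', h.not_gt, e]
  · subst h
    simp
  · have e : (i < k ∧ l < k) ↔ i < k := ⟨fun x => x.1, fun x => ⟨x, h.trans x⟩⟩
    simp [h, h.ne, h.not_gt, e]

lemma card_pairs (N : ℕ) :
    ((Finset.univ.filter fun p : Fin N × Fin N => p.1 < p.2).card : ℝ) = N * (N - 1) / 2 := by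
  have h := sum_Iio_eq_sum_pairs (N := N) fun _ _ => 1
  simp only [Finset.sum_const, Fin.card_Iio, nsmul_eq_mul, mul_one] at h
  rw [← h, ← Finset.sum_range (fun k => (k : ℝ)), ← Nat.cast_sum]
  have h2 := Finset.sum_range_id_mul_two N
  have h3 : ((∑ k ∈ Finset.range N, k : ℕ) : ℝ) * 2 = N * ((N - 1 : ℕ) : ℝ) := by
    exact_mod_cast h2
  rcases Nat.eq_zero_or_pos N with rfl | hN
  · simp
  · rw [Nat.cast_sub hN] at h3
    push_cast at h3 ⊢
    linarith

end

/-! ### The rows of a degenerate U-statistic -/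

section

namespace IsDegenerate

variable {N : ℕ} {α : Type*} {h : Fin N → Fin N → α → α → ℝ}

/-- The `k`-th row `c ∑_{i < k} h i k (x i) (x k)` of a scaled `U`-statistic (zero for `k ≥ N`). -/
noncomputable def row (h : Fin N → Fin N → α → α → ℝ) (c : ℝ) (k : ℕ) (x : Fin N → α) : ℝ :=
  if hk : k < N then c * ∑ i ∈ Finset.Iio (⟨k, hk⟩ : Fin N), h i ⟨k, hk⟩ (x i) (x ⟨k, hk⟩) else 0

lemma row_coe (c : ℝ) (k : Fin N) (x : Fin N → α) :
    row h c k x = c * ∑ i ∈ Finset.Iio k, h i k (x i) (x k) := by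
  simp [row]

lemma sum_row (c : ℝ) (x : Fin N → α) :
    ∑ k ∈ Finset.range N, row h c k x
      = c * ∑ p : Fin N × Fin N with p.1 < p.2, h p.1 p.2 (x p.1) (x p.2) := by
  rw [Finset.sum_range, ← sum_Iio_eq_sum_pairs (fun i k => h i k (x i) (x k)), Finset.mul_sum]
  simp_rw [row_coe]

variable [MeasurableSpace α] {ν : Fin N → Measure α}

/-- The conditional covariance of `h i k (a, ·)` and `h l k (b, ·)`, integrated over the
`k`-th coordinate. -/
noncomputable def condCov (ν : Fin N → Measure α) (h : Fin N → Fin N → α → α → ℝ) (k i l : Fin N)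
    (a b : α) : ℝ :=
  ∫ v, h i k a v * h l k b v ∂(ν k)

/-- The conditional variance of the `k`-th row given the coordinates before `k`. -/
noncomputable def rowVar (ν : Fin N → Measure α) (h : Fin N → Fin N → α → α → ℝ) (c : ℝ) (k : ℕ)
    (x : Fin N → α) : ℝ :=
  if hk : k < N then
    ∫ v, (c * ∑ i ∈ Finset.Iio (⟨k, hk⟩ : Fin N), h i ⟨k, hk⟩ (x i) v) ^ 2 ∂(ν ⟨k, hk⟩) else 0

lemma rowVar_coe (c : ℝ) (k : Fin N) (x : Fin N → α) :
    rowVar ν h c k x = ∫ v, (c * ∑ i ∈ Finset.Iio k, h i k (x i) v) ^ 2 ∂(ν k) := by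
  simp [rowVar]

lemma bddMeas_rowArg (hh : IsDegenerate ν h) (c : ℝ) (k : Fin N) :
    BddMeas fun p : (Fin N → α) × α => c * ∑ i ∈ Finset.Iio k, h i k (p.1 i) p.2 :=
  (BddMeas.sum _ fun i _ => (hh.bddMeas i k).comp
    (by fun_prop : Measurable fun p : (Fin N → α) × α => (p.1 i, p.2))).const_mul c

lemma bddMeas_row (hh : IsDegenerate ν h) (c : ℝ) (k : Fin N) : BddMeas (row h c k) := by
  rw [funext (row_coe (h := h) c k)]
  exact (BddMeas.sum _ fun i _ => hh.bddMeas_eval i k).const_mul c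

variable [∀ i, IsProbabilityMeasure (ν i)]

lemma bddMeas_rowVar (hh : IsDegenerate ν h) (c : ℝ) (k : Fin N) : BddMeas (rowVar ν h c k) := by
  rw [funext (rowVar_coe (ν := ν) (h := h) c k)]
  exact ((hh.bddMeas_rowArg c k).pow 2).integral_right (ν k)

/-- The rows of a degenerate `U`-statistic form a martingale difference sequence. -/
lemma isMartingaleDiff (hh : IsDegenerate ν h) (c : ℝ) :
    ∃ K, IsMartingaleDiff (Measure.pi ν) (pastSigma N α) (row h c) (rowVar ν h c) K := by
  choose C hC using fun k : Fin N => (hh.bddMeas_row c k).bdd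
  choose D hD using fun k : Fin N => (hh.bddMeas_rowVar c k).bdd
  have hle : ∀ k, C k ≤ ∑ j, (|C j| + |D j|) ∧ D k ≤ ∑ j, (|C j| + |D j|) := fun k => by
    have := Finset.single_le_sum (f := fun j => |C j| + |D j|) (fun j _ => by positivity)
      (Finset.mem_univ k)
    have h1 := le_abs_self (C k)
    have h2 := le_abs_self (D k)
    have h3 := abs_nonneg (C k)
    have h4 := abs_nonneg (D k)
    constructor <;> linarith
  have hK0 : 0 ≤ ∑ j, (|C j| + |D j|) := Finset.sum_nonneg fun j _ => by positivity
  refine ⟨∑ j, (|C j| + |D j|), pastSigma_mono, pastSigma_le, fun k => ?_, fun k => ?_,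
    fun k x => ?_, fun k x => ?_, fun k x => ?_, fun k B hB hM => ?_, fun k B hB hM => ?_⟩
  · by_cases hk : k < N
    · refine measurable_pastSigma (hh.bddMeas_row c ⟨k, hk⟩).meas fun x y hxy => ?_
      rw [row, row, dif_pos hk, dif_pos hk]
      congr 1
      refine Finset.sum_congr rfl fun i hi => ?_
      have hi : (i : ℕ) < k := Fin.lt_def.1 (Finset.mem_Iio.1 hi)
      rw [hxy i (by omega), hxy ⟨k, hk⟩ (Nat.lt_succ_self k)]
    · have : row h c k = fun _ => 0 := by ext x; simp [row, hk]
      rw [this]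
      exact measurable_const
  · by_cases hk : k < N
    · refine measurable_pastSigma (hh.bddMeas_rowVar c ⟨k, hk⟩).meas fun x y hxy => ?_
      rw [rowVar, rowVar, dif_pos hk, dif_pos hk]
      congr 1
      ext v
      congr 2
      refine Finset.sum_congr rfl fun i hi => ?_
      rw [hxy i (Fin.lt_def.1 (Finset.mem_Iio.1 hi))]
    · have : rowVar ν h c k = fun _ => 0 := by ext x; simp [rowVar, hk]
      rw [this]
      exact measurable_const
  · rw [rowVar]
    split_ifs
    · exact integral_nonneg fun v => sq_nonneg _
    · exact le_rfl
  · by_cases hk : k < N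
    · exact (hC ⟨k, hk⟩ x).trans (hle _).1
    · simpa [row, hk] using hK0
  · by_cases hk : k < N
    · exact (le_abs_self _).trans ((hD ⟨k, hk⟩ x).trans (hle _).2)
    · simpa [rowVar, hk] using hK0
  · by_cases hk : k < N
    swap
    · simp [row, hk]
    obtain ⟨k, rfl⟩ : ∃ k' : Fin N, k = k' := ⟨⟨k, hk⟩, rfl⟩
    have hBb : BddMeas B := ⟨hB.mono (pastSigma_le _) le_rfl, hM⟩
    rw [integral_pi_update ν k (hBb.mul (hh.bddMeas_row c k))]
    refine integral_eq_zero_of_ae (Eventually.of_forall fun x => ?_)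
    simp_rw [update_eq_of_measurable_pastSigma hB, integral_const_mul, row_coe,
      integral_const_mul, Function.update_self]
    have : ∀ v, ∑ i ∈ Finset.Iio k, h i k (Function.update x k v i) v
        = ∑ i ∈ Finset.Iio k, h i k (x i) v := fun v => Finset.sum_congr rfl fun i hi => by
      rw [Function.update_of_ne (Finset.mem_Iio.1 hi).ne]
    simp_rw [this]
    rw [integral_finsetSum _ fun i _ => ((hh.bddMeas i k).comp
      (by fun_prop : Measurable fun v : α => (x i, v))).integrable _]
    simp [hh.right]
  · by_cases hk : k < N
    swap
    · simp [row, rowVar, hk]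
    obtain ⟨k, rfl⟩ : ∃ k' : Fin N, k = k' := ⟨⟨k, hk⟩, rfl⟩
    have hBb : BddMeas B := ⟨hB.mono (pastSigma_le _) le_rfl, hM⟩
    rw [integral_pi_update ν k (hBb.mul ((hh.bddMeas_row c k).pow 2))]
    simp_rw [update_eq_of_measurable_pastSigma hB, integral_const_mul, row_coe, rowVar_coe,
      Function.update_self]
    have : ∀ x v, ∑ i ∈ Finset.Iio k, h i k (Function.update x k v i) v
        = ∑ i ∈ Finset.Iio k, h i k (x i) v := fun x v => Finset.sum_congr rfl fun i hi => by
      rw [Function.update_of_ne (Finset.mem_Iio.1 hi).ne]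
    simp_rw [this]

lemma bddMeas_condCov (hh : IsDegenerate ν h) (k i l : Fin N) :
    BddMeas fun p : α × α => condCov ν h k i l p.1 p.2 :=
  (((hh.bddMeas i k).comp (by fun_prop : Measurable fun q : (α × α) × α => (q.1.1, q.2))).mul
    ((hh.bddMeas l k).comp (by fun_prop : Measurable fun q : (α × α) × α => (q.1.2, q.2)))
    ).integral_right (ν k)

/-- The sum of the conditional variances splits into a sum of independent terms and a degenerate
`U`-statistic. -/
lemma sum_rowVar (hh : IsDegenerate ν h) (c : ℝ) (x : Fin N → α) :
    ∑ k ∈ Finset.range N, rowVar ν h c k x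
      = c ^ 2 * ∑ i, ∑ k ∈ Finset.Ioi i, condCov ν h k i i (x i) (x i)
        + 2 * c ^ 2 * ∑ p : Fin N × Fin N with p.1 < p.2,
          ∑ k ∈ Finset.Ioi p.2, condCov ν h k p.1 p.2 (x p.1) (x p.2) := by
  have h1 : ∀ k : Fin N, rowVar ν h c k x
      = c ^ 2 * ∑ i ∈ Finset.Iio k, ∑ l ∈ Finset.Iio k, condCov ν h k i l (x i) (x l) := by
    intro k
    have b : ∀ i l, BddMeas fun v => h i k (x i) v * h l k (x l) v := fun i l =>
      ((hh.bddMeas i k).comp (by fun_prop : Measurable fun v : α => (x i, v))).mul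
        ((hh.bddMeas l k).comp (by fun_prop : Measurable fun v : α => (x l, v)))
    rw [rowVar_coe]
    simp_rw [mul_pow, integral_const_mul, sq (∑ i ∈ Finset.Iio k, _), Finset.sum_mul_sum]
    rw [integral_finsetSum _ fun i _ => (BddMeas.sum _ fun l _ => b i l).integrable _]
    congr 1
    refine Finset.sum_congr rfl fun i _ => ?_
    rw [integral_finsetSum _ fun l _ => (b i l).integrable _]
    rfl
  rw [Finset.sum_range]
  simp_rw [h1, ← Finset.mul_sum]
  rw [sum_Iio_Iio_eq (fun k i l => condCov ν h k i l (x i) (x l)) fun k i l => by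
    simp_rw [condCov, mul_comm]]
  ring

/-- Summing the conditional covariances over the later coordinates gives a degenerate kernel. -/
lemma sum_condCov (hh : IsDegenerate ν h) :
    IsDegenerate ν fun i l a b => ∑ k ∈ Finset.Ioi l, condCov ν h k i l a b where
  bddMeas i l := BddMeas.sum _ fun k _ => hh.bddMeas_condCov k i l
  left i l b := by
    rw [integral_finsetSum _ fun k _ => ((hh.bddMeas_condCov k i l).comp
      (by fun_prop : Measurable fun a : α => (a, b))).integrable _]
    refine Finset.sum_eq_zero fun k _ => ?_
    simp_rw [condCov]
    rw [integral_integral_swap ((((hh.bddMeas i k).mul ((hh.bddMeas l k).comp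
      (by fun_prop : Measurable fun p : α × α => (b, p.2))))).integrable _)]
    simp [integral_mul_const, hh.left]
  right i l a := by
    rw [integral_finsetSum _ fun k _ => ((hh.bddMeas_condCov k i l).comp
      (by fun_prop : Measurable fun b : α => (a, b))).integrable _]
    refine Finset.sum_eq_zero fun k _ => ?_
    simp_rw [condCov]
    rw [integral_integral_swap (((((hh.bddMeas i k).comp
      (by fun_prop : Measurable fun p : α × α => (a, p.2)))).mul (hh.bddMeas l k)).integrable _)]
    simp [integral_const_mul, hh.left]

end IsDegenerate

end

/-! ### Central limit theorem for degenerate U-statistics -/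

/-- Bound on the mean square deviation from `1` of the sum of the conditional variances of a
degenerate `U`-statistic of `N` variables. -/
noncomputable def condVarBound (N C δ γ : ℝ) : ℝ := 3 * (δ ^ 2 + 16 * C / N + 64 * γ)

/-- Bound on the distance at `t` of the characteristic function of a degenerate `U`-statistic of `N`
variables from that of `N(0,1)`. -/
noncomputable def charFunBound (t N C δ γ : ℝ) : ℝ :=
  Real.exp (t ^ 2) * (4 * |t| ^ 3 * ((1 + 48 * C) / √N) + t ^ 4 / 4 * (48 * C / N))
    + Real.exp (t ^ 2) * (t ^ 2 / 2) * √(condVarBound N C δ γ) + 2 * condVarBound N C δ γ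

namespace IsDegenerate

variable {N : ℕ} {α : Type*} [MeasurableSpace α] {ν : Fin N → Measure α}
  {h : Fin N → Fin N → α → α → ℝ} [∀ i, IsProbabilityMeasure (ν i)]

lemma integral_scaled_row_pow_four_le (hh : IsDegenerate ν h) {C : ℝ} (hC0 : 0 ≤ C)
    (hC : ∀ i k, i ≠ k → ∫ a, ∫ b, h i k a b ^ 4 ∂(ν k) ∂(ν i) ≤ C) (c : ℝ) (k : Fin N) :
    ∫ x, row h c k x ^ 4 ∂(Measure.pi ν) ≤ c ^ 4 * (3 * (N : ℝ) ^ 2 * C) := by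
  simp_rw [row_coe, mul_pow]
  rw [integral_const_mul]
  refine mul_le_mul_of_nonneg_left ?_ (by positivity)
  refine (hh.integral_row_pow_four_le (fun i hi => hC i k hi) (Finset.Iio k) (by simp)).trans ?_
  rw [Fin.card_Iio]
  have : (k : ℝ) ≤ N := by exact_mod_cast k.2.le
  gcongr

/-- The independent part of the sum of the conditional variances concentrates. -/
lemma integral_diag_sub_sq_le (hh : IsDegenerate ν h) {C : ℝ}
    (hC : ∀ i k, i ≠ k → ∫ a, ∫ b, h i k a b ^ 4 ∂(ν k) ∂(ν i) ≤ C) (hC0 : 0 ≤ C) :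
    ∫ x, (∑ i, ∑ k ∈ Finset.Ioi i, condCov ν h k i i (x i) (x i)
        - ∑ p : Fin N × Fin N with p.1 < p.2, ∫ a, ∫ b, h p.1 p.2 a b ^ 2 ∂(ν p.2) ∂(ν p.1)) ^ 2
        ∂(Measure.pi ν) ≤ (N : ℝ) ^ 3 * C := by
  let d : Fin N → α → ℝ := fun i a => ∑ k ∈ Finset.Ioi i, condCov ν h k i i a a
  have bc : ∀ i k, BddMeas fun a => condCov ν h k i i a a := fun i k =>
    (hh.bddMeas_condCov k i i).comp (by fun_prop : Measurable fun a : α => (a, a))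
  have bd : ∀ i, BddMeas (d i) := fun i => BddMeas.sum _ fun k _ => bc i k
  have bde : ∀ i, BddMeas fun x : Fin N → α => d i (x i) := fun i =>
    (bd i).comp (measurable_pi_apply i)
  have hmean : ∫ x, ∑ i, d i (x i) ∂(Measure.pi ν)
      = ∑ p : Fin N × Fin N with p.1 < p.2, ∫ a, ∫ b, h p.1 p.2 a b ^ 2 ∂(ν p.2) ∂(ν p.1) := by
    rw [integral_finsetSum _ fun i _ => (bde i).integrable _,
      ← sum_Ioi_eq_sum_pairs (fun i k => ∫ a, ∫ b, h i k a b ^ 2 ∂(ν k) ∂(ν i))]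
    refine Finset.sum_congr rfl fun i _ => ?_
    rw [integral_pi_eval ν i (bd i), integral_finsetSum _ fun k _ => (bc i k).integrable _]
    simp_rw [condCov, sq]
  have hvar := variance_sum_pi (μ := ν) (X := d) fun i => by
    obtain ⟨D, hD⟩ := (bd i).bdd
    exact MemLp.of_bound (bd i).meas.aestronglyMeasurable D (Eventually.of_forall hD)
  have hfun : (∑ i, fun ω : Fin N → α => d i (ω i)) = fun ω => ∑ i, d i (ω i) := by
    ext ω; simp
  rw [hfun, variance_eq_integral (BddMeas.sum _ fun i _ => bde i).meas.aemeasurable, hmean] at hvar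
  rw [hvar]
  have h1 : ∀ i, Var[d i; ν i] ≤ (N : ℝ) ^ 2 * C := by
    intro i
    refine (variance_le_expectation_sq (bd i).meas.aestronglyMeasurable).trans ?_
    calc ∫ a, d i a ^ 2 ∂(ν i)
        ≤ ∫ a, (N : ℝ) * ∑ k ∈ Finset.Ioi i, ∫ b, h i k a b ^ 4 ∂(ν k) ∂(ν i) := by
          refine integral_mono (((bd i).pow 2).integrable _) (((BddMeas.sum _ fun k _ =>
            (((hh.bddMeas i k).pow 4).integral_right (ν k))).const_mul _).integrable _) fun a => ?_
          refine sq_sum_le_card_mul_sum_sq.trans ?_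
          have hcard : ((Finset.Ioi i).card : ℝ) ≤ N := by
            exact_mod_cast (Finset.card_le_univ _).trans (by simp)
          refine mul_le_mul hcard (Finset.sum_le_sum fun k _ => ?_)
            (Finset.sum_nonneg fun k _ => sq_nonneg _) (by positivity)
          have := sq_integral_le (ν k) (((hh.bddMeas i k).comp
            (by fun_prop : Measurable fun v : α => (a, v))).pow 2)
          rw [condCov]
          calc _ = (∫ b, h i k a b ^ 2 ∂(ν k)) ^ 2 := by simp_rw [sq (h i k a _)]
            _ ≤ _ := this
            _ = _ := by simp_rw [← pow_mul]
      _ = (N : ℝ) * ∑ k ∈ Finset.Ioi i, ∫ a, ∫ b, h i k a b ^ 4 ∂(ν k) ∂(ν i) := by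
          rw [integral_const_mul, integral_finsetSum _ fun k _ =>
            (((hh.bddMeas i k).pow 4).integral_right (ν k)).integrable _]
      _ ≤ (N : ℝ) * (N * C) := by
          gcongr
          calc _ ≤ ∑ k ∈ Finset.Ioi i, C :=
                Finset.sum_le_sum fun k hk => hC i k (Finset.mem_Ioi.1 hk).ne
            _ ≤ _ := by
                rw [Finset.sum_const, nsmul_eq_mul]
                gcongr
                exact (Finset.card_le_univ _).trans (by simp)
      _ = (N : ℝ) ^ 2 * C := by ring
  calc _ ≤ ∑ i : Fin N, (N : ℝ) ^ 2 * C := Finset.sum_le_sum fun i _ => h1 i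
    _ = _ := by simp; ring

/-- The degenerate part of the sum of the conditional variances is small in mean square. -/
lemma integral_offDiag_sq_le (hh : IsDegenerate ν h) {γ : ℝ} (hγ0 : 0 ≤ γ)
    (hγ : ∀ k i l, i < l → l < k →
      ∫ a, ∫ b, condCov ν h k i l a b ^ 2 ∂(ν l) ∂(ν i) ≤ γ) :
    ∫ x, (∑ p : Fin N × Fin N with p.1 < p.2,
          ∑ k ∈ Finset.Ioi p.2, condCov ν h k p.1 p.2 (x p.1) (x p.2)) ^ 2 ∂(Measure.pi ν)
      ≤ (N : ℝ) ^ 4 * γ := by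
  rw [hh.sum_condCov.integral_sum_sq]
  have h1 : ∀ p : Fin N × Fin N, p.1 < p.2 → ∫ a, ∫ b,
      (∑ k ∈ Finset.Ioi p.2, condCov ν h k p.1 p.2 a b) ^ 2 ∂(ν p.2) ∂(ν p.1)
      ≤ (N : ℝ) ^ 2 * γ := by
    intro p hp
    have b := fun k => (hh.bddMeas_condCov k p.1 p.2).pow 2
    have ba := fun a k => (b k).comp (by fun_prop : Measurable fun v : α => (a, v))
    have hcard : ((Finset.Ioi p.2).card : ℝ) ≤ N := by
      exact_mod_cast (Finset.card_le_univ _).trans (by simp)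
    calc _ ≤ ∫ a, ∫ b, (N : ℝ) * ∑ k ∈ Finset.Ioi p.2, condCov ν h k p.1 p.2 a b ^ 2
            ∂(ν p.2) ∂(ν p.1) := by
          refine integral_mono
            ((((hh.sum_condCov.bddMeas p.1 p.2).pow 2).integral_right _).integrable _)
            ((((BddMeas.sum _ fun k _ => b k).const_mul _).integral_right _).integrable _)
            fun a => integral_mono
              (((hh.sum_condCov.bddMeas p.1 p.2).pow 2).comp
                (by fun_prop : Measurable fun v : α => (a, v)) |>.integrable _)
              (((BddMeas.sum _ fun k _ => ba a k).const_mul _).integrable _) fun v => ?_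
          refine sq_sum_le_card_mul_sum_sq.trans ?_
          gcongr
      _ = (N : ℝ) * ∑ k ∈ Finset.Ioi p.2, ∫ a, ∫ b, condCov ν h k p.1 p.2 a b ^ 2
            ∂(ν p.2) ∂(ν p.1) := by
          rw [← integral_finsetSum _ fun k _ => ((b k).integral_right _).integrable _,
            ← integral_const_mul]
          congr 1
          ext a
          rw [integral_const_mul, integral_finsetSum _ fun k _ => (ba a k).integrable _]
      _ ≤ (N : ℝ) * (N * γ) := by
          gcongr
          calc _ ≤ ∑ k ∈ Finset.Ioi p.2, γ :=
                Finset.sum_le_sum fun k hk => hγ k p.1 p.2 hp (Finset.mem_Ioi.1 hk)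
            _ ≤ _ := by
                rw [Finset.sum_const, nsmul_eq_mul]
                gcongr
      _ = (N : ℝ) ^ 2 * γ := by ring
  calc _ ≤ ∑ p : Fin N × Fin N with p.1 < p.2, (N : ℝ) ^ 2 * γ :=
        Finset.sum_le_sum fun p hp => h1 p (Finset.mem_filter.1 hp).2
    _ ≤ (N : ℝ) ^ 2 * ((N : ℝ) ^ 2 * γ) := by
        rw [Finset.sum_const, nsmul_eq_mul]
        gcongr
        have : (Finset.univ.filter fun p : Fin N × Fin N => p.1 < p.2).card ≤ N * N :=
          (Finset.card_le_univ _).trans (by simp)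
        rw [sq]
        exact_mod_cast this
    _ = _ := by ring

/-- The factor `√(2 / (N (N - 1)))` normalizes the sum over the `N (N - 1) / 2` pairs. -/
lemma sq_scale {N : ℕ} (hN : 2 ≤ N) :
    √(2 / ((N : ℝ) * ((N : ℝ) - 1))) ^ 2 * ((N : ℝ) * (N - 1) / 2) = 1 := by
  have h2 : (2 : ℝ) ≤ N := by exact_mod_cast hN
  have h1 : 0 < (N : ℝ) - 1 := by linarith
  rw [Real.sq_sqrt (by positivity)]
  field_simp

lemma sq_scale_le {N : ℕ} (hN : 2 ≤ N) :
    √(2 / ((N : ℝ) * ((N : ℝ) - 1))) ^ 2 ≤ 4 / (N : ℝ) ^ 2 := by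
  have h2 : (2 : ℝ) ≤ N := by exact_mod_cast hN
  have h1 : 0 < (N : ℝ) - 1 := by linarith
  rw [Real.sq_sqrt (by positivity), div_le_div_iff₀ (by positivity) (by positivity)]
  nlinarith

/-- The sum of the conditional variances of the rows is close to `1` in mean square: it is the sum
of a deterministic, an independent and a degenerate part. -/
lemma integral_sum_rowVar_sub_one_sq_le (hh : IsDegenerate ν h) (hN : 2 ≤ N) {C δ γ : ℝ}
    (hC0 : 0 ≤ C) (hγ0 : 0 ≤ γ)
    (hC : ∀ i k, i ≠ k → ∫ a, ∫ b, h i k a b ^ 4 ∂(ν k) ∂(ν i) ≤ C)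
    (hδ : ∀ i k, i < k → |∫ a, ∫ b, h i k a b ^ 2 ∂(ν k) ∂(ν i) - 1| ≤ δ)
    (hγ : ∀ k i l, i < l → l < k →
      ∫ a, ∫ b, condCov ν h k i l a b ^ 2 ∂(ν l) ∂(ν i) ≤ γ) :
    ∫ x, (∑ k ∈ Finset.range N, rowVar ν h (√(2 / ((N : ℝ) * ((N : ℝ) - 1)))) k x - 1) ^ 2
      ∂(Measure.pi ν) ≤ condVarBound N C δ γ := by
  have hN0 : (0 : ℝ) < N := by positivity
  have hc1 := sq_scale hN
  have hc2 := sq_scale_le hN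
  set c := √(2 / ((N : ℝ) * ((N : ℝ) - 1)))
  set m := ∑ p : Fin N × Fin N with p.1 < p.2, ∫ a, ∫ b, h p.1 p.2 a b ^ 2 ∂(ν p.2) ∂(ν p.1)
    with hm
  have hm1 : |c ^ 2 * m - 1| ≤ δ := by
    have e : c ^ 2 * m - 1 = c ^ 2 * ∑ p : Fin N × Fin N with p.1 < p.2,
        (∫ a, ∫ b, h p.1 p.2 a b ^ 2 ∂(ν p.2) ∂(ν p.1) - 1) := by
      rw [Finset.sum_sub_distrib, ← hm, Finset.sum_const, nsmul_eq_mul, mul_one, card_pairs,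
        mul_sub, hc1]
    rw [e, abs_mul, abs_of_nonneg (sq_nonneg c)]
    calc _ ≤ c ^ 2 * ∑ p : Fin N × Fin N with p.1 < p.2, δ := by
          refine mul_le_mul_of_nonneg_left ((Finset.abs_sum_le_sum_abs _ _).trans
            (Finset.sum_le_sum fun p hp => hδ _ _ (Finset.mem_filter.1 hp).2)) (sq_nonneg c)
      _ = δ := by
          rw [Finset.sum_const, nsmul_eq_mul, card_pairs, ← mul_assoc, hc1, one_mul]
  have hm2 : (c ^ 2 * m - 1) ^ 2 ≤ δ ^ 2 := sq_le_sq' (by linarith [neg_le_of_abs_le hm1])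
    (le_of_abs_le hm1)
  have hD := hh.integral_diag_sub_sq_le hC hC0
  have hO := hh.integral_offDiag_sq_le hγ0 hγ
  have bD : BddMeas fun x : Fin N → α => ∑ i, ∑ k ∈ Finset.Ioi i, condCov ν h k i i (x i) (x i) :=
    BddMeas.sum _ fun i _ => BddMeas.sum _ fun k _ => (hh.bddMeas_condCov k i i).comp
      (by fun_prop : Measurable fun x : Fin N → α => (x i, x i))
  have bO : BddMeas fun x : Fin N → α => ∑ p : Fin N × Fin N with p.1 < p.2,
      ∑ k ∈ Finset.Ioi p.2, condCov ν h k p.1 p.2 (x p.1) (x p.2) :=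
    BddMeas.sum _ fun p _ => hh.sum_condCov.bddMeas_eval p.1 p.2
  have bV : BddMeas fun x => ∑ k ∈ Finset.range N, rowVar ν h c k x := by
    simp_rw [hh.sum_rowVar]
    exact (bD.const_mul _).add (bO.const_mul _)
  have b1 := ((bD.sub (BddMeas.const m)).pow 2).const_mul (3 * (c ^ 2) ^ 2)
  have b2 := (bO.pow 2).const_mul (12 * (c ^ 2) ^ 2)
  calc _ ≤ ∫ x, (3 * (c ^ 2) ^ 2 *
            (∑ i, ∑ k ∈ Finset.Ioi i, condCov ν h k i i (x i) (x i) - m) ^ 2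
          + 12 * (c ^ 2) ^ 2 * (∑ p : Fin N × Fin N with p.1 < p.2,
            ∑ k ∈ Finset.Ioi p.2, condCov ν h k p.1 p.2 (x p.1) (x p.2)) ^ 2
          + 3 * δ ^ 2) ∂(Measure.pi ν) := by
        refine integral_mono (((bV.sub (BddMeas.const 1)).pow 2).integrable _)
          (((b1.add b2).add (BddMeas.const _)).integrable _) fun x => ?_
        dsimp only
        rw [hh.sum_rowVar]
        generalize ∑ i, ∑ k ∈ Finset.Ioi i, condCov ν h k i i (x i) (x i) = D
        generalize ∑ p : Fin N × Fin N with p.1 < p.2,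
            ∑ k ∈ Finset.Ioi p.2, condCov ν h k p.1 p.2 (x p.1) (x p.2) = O
        nlinarith [sq_nonneg (c ^ 2 * (D - m) - 2 * c ^ 2 * O),
          sq_nonneg (c ^ 2 * (D - m) - (c ^ 2 * m - 1)),
          sq_nonneg (2 * c ^ 2 * O - (c ^ 2 * m - 1))]
    _ = 3 * (c ^ 2) ^ 2 * ∫ x, (∑ i, ∑ k ∈ Finset.Ioi i, condCov ν h k i i (x i) (x i) - m) ^ 2
            ∂(Measure.pi ν)
          + 12 * (c ^ 2) ^ 2 * ∫ x, (∑ p : Fin N × Fin N with p.1 < p.2,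
            ∑ k ∈ Finset.Ioi p.2, condCov ν h k p.1 p.2 (x p.1) (x p.2)) ^ 2 ∂(Measure.pi ν)
          + 3 * δ ^ 2 := by
        rw [integral_add ((b1.add b2).integrable _) (integrable_const _),
          integral_add (b1.integrable _) (b2.integrable _), integral_const_mul,
          integral_const_mul]
        simp
    _ ≤ 3 * (4 / (N : ℝ) ^ 2) ^ 2 * ((N : ℝ) ^ 3 * C)
          + 12 * (4 / (N : ℝ) ^ 2) ^ 2 * ((N : ℝ) ^ 4 * γ) + 3 * δ ^ 2 := by
        have hc4 : (c ^ 2) ^ 2 ≤ (4 / (N : ℝ) ^ 2) ^ 2 := pow_le_pow_left₀ (sq_nonneg c) hc2 2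
        refine add_le_add (add_le_add (mul_le_mul (by linarith) hD
          (integral_nonneg fun x => sq_nonneg _) (by positivity))
          (mul_le_mul (by linarith) hO
          (integral_nonneg fun x => sq_nonneg _) (by positivity))) le_rfl
    _ = condVarBound N C δ γ := by
        rw [condVarBound]
        field_simp
        ring

/-- Central limit theorem for degenerate `U`-statistics of independent, not identically distributed
variables, in quantitative form. It suffices to bound the fourth moments of the kernels by `C`, the
deviation of their second moments from `1` by `δ`, and the second moments of the conditional
covariances by `γ`. -/
theorem norm_integral_exp_sub_le (hh : IsDegenerate ν h) (hN : 2 ≤ N) {C δ γ : ℝ}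
    (hC0 : 0 ≤ C) (hγ0 : 0 ≤ γ)
    (hC : ∀ i k, i ≠ k → ∫ a, ∫ b, h i k a b ^ 4 ∂(ν k) ∂(ν i) ≤ C)
    (hδ : ∀ i k, i < k → |∫ a, ∫ b, h i k a b ^ 2 ∂(ν k) ∂(ν i) - 1| ≤ δ)
    (hγ : ∀ k i l, i < l → l < k →
      ∫ a, ∫ b, condCov ν h k i l a b ^ 2 ∂(ν l) ∂(ν i) ≤ γ) (t : ℝ) :
    ‖∫ x, Complex.exp ((t * (√(2 / ((N : ℝ) * ((N : ℝ) - 1))) *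
        ∑ p : Fin N × Fin N with p.1 < p.2, h p.1 p.2 (x p.1) (x p.2)) : ℝ) * Complex.I)
        ∂(Measure.pi ν) - (Real.exp (-(t ^ 2 / 2)) : ℂ)‖ ≤ charFunBound t N C δ γ := by
  have hN0 : (0 : ℝ) < N := by positivity
  have hV := hh.integral_sum_rowVar_sub_one_sq_le hN hC0 hγ0 hC hδ hγ
  have hc2 := sq_scale_le hN
  set c := √(2 / ((N : ℝ) * ((N : ℝ) - 1)))
  obtain ⟨K, hK⟩ := hh.isMartingaleDiff c
  have hmain := hK.norm_integral_exp_sub_le N t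
  simp_rw [sum_row] at hmain
  refine hmain.trans ?_
  have bV : BddMeas fun x => ∑ k ∈ Finset.range N, rowVar ν h c k x - 1 := by
    refine (BddMeas.sum _ fun k hk => ?_).sub (BddMeas.const 1)
    exact hh.bddMeas_rowVar c ⟨k, Finset.mem_range.1 hk⟩
  have hV1 : ∫ x, |∑ k ∈ Finset.range N, rowVar ν h c k x - 1| ∂(Measure.pi ν)
      ≤ √(condVarBound N C δ γ) := by
    refine Real.le_sqrt_of_sq_le ((sq_integral_le _ bV.abs).trans ?_)
    simp_rw [sq_abs]
    exact hV
  have hc4 : c ^ 4 ≤ 16 / (N : ℝ) ^ 4 := by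
    calc c ^ 4 = (c ^ 2) ^ 2 := by ring
      _ ≤ (4 / (N : ℝ) ^ 2) ^ 2 := pow_le_pow_left₀ (sq_nonneg c) hc2 2
      _ = _ := by rw [div_pow, ← pow_mul]; norm_num
  have h4 : ∀ k ∈ Finset.range N, ∫ x, row h c k x ^ 4 ∂(Measure.pi ν) ≤ 48 * C / (N : ℝ) ^ 2 := by
    intro k hk
    refine (hh.integral_scaled_row_pow_four_le hC0 hC c ⟨k, Finset.mem_range.1 hk⟩).trans ?_
    calc _ ≤ 16 / (N : ℝ) ^ 4 * (3 * (N : ℝ) ^ 2 * C) := by gcongr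
      _ = _ := by field_simp; ring
  have hs : 0 < √(N : ℝ) := Real.sqrt_pos.2 hN0
  have hs2 : √(N : ℝ) ^ 2 = N := Real.sq_sqrt hN0.le
  have h3 : ∀ k ∈ Finset.range N, ∫ x, |row h c k x| ^ 3 ∂(Measure.pi ν)
      ≤ (1 + 48 * C) / (√N * N) := by
    intro k hk
    have b : BddMeas (row h c k) := hh.bddMeas_row c ⟨k, Finset.mem_range.1 hk⟩
    calc _ ≤ ∫ x, (1 / (√N * N) + √N * row h c k x ^ 4) ∂(Measure.pi ν) := by
          refine integral_mono ((b.abs.pow 3).integrable _)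
            (((BddMeas.const _).add ((b.pow 4).const_mul _)).integrable _) fun x => ?_
          dsimp only
          -- `y ^ 3 ≤ 1 + y ^ 4` for `y = √N |row|`
          set y := √(N : ℝ) * |row h c k x| with hy
          have hy0 : 0 ≤ y := by positivity
          have hy1 : y ^ 3 ≤ 1 + y ^ 4 := by
            nlinarith [sq_nonneg (y ^ 2 - y), sq_nonneg (y - 1), sq_nonneg (y ^ 2 - 1),
              mul_nonneg hy0 (sq_nonneg (y - 1))]
          have e1 : |row h c k x| ^ 3 = y ^ 3 / (√N * N) := by
            rw [hy, mul_pow, eq_div_iff (by positivity)]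
            linear_combination (-(|row h c k x| ^ 3 * √(N : ℝ))) * hs2
          have e2 : √N * row h c k x ^ 4 = y ^ 4 / (√N * N) := by
            rw [hy, mul_pow, eq_div_iff (by positivity), (by decide : Even 4).pow_abs]
            linear_combination (-(row h c k x ^ 4 * √(N : ℝ) ^ 2)) * hs2
          rw [e1, e2, ← add_div]
          gcongr
      _ = 1 / (√N * N) + √N * ∫ x, row h c k x ^ 4 ∂(Measure.pi ν) := by
          rw [integral_add (integrable_const _) (((b.pow 4).const_mul _).integrable _),
            integral_const_mul]
          simp
      _ ≤ 1 / (√N * N) + √N * (48 * C / (N : ℝ) ^ 2) := by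
          gcongr
          exact h4 k hk
      _ = _ := by
          have : √(N : ℝ) * (48 * C / (N : ℝ) ^ 2) = 48 * C / (√N * N) := by
            rw [eq_div_iff (by positivity)]
            calc _ = √(N : ℝ) ^ 2 * (48 * C / N) := by field_simp
              _ = _ := by rw [hs2]; field_simp
          rw [this, add_div]
  rw [charFunBound]
  refine add_le_add (add_le_add (mul_le_mul_of_nonneg_left ?_ (by positivity))
    (mul_le_mul_of_nonneg_left hV1 (by positivity))) (mul_le_mul_of_nonneg_left hV (by norm_num))
  calc _ ≤ ∑ k ∈ Finset.range N, (4 * |t| ^ 3 * ((1 + 48 * C) / (√N * N))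
          + t ^ 4 / 4 * (48 * C / (N : ℝ) ^ 2)) :=
        Finset.sum_le_sum fun k hk => add_le_add
          (mul_le_mul_of_nonneg_left (h3 k hk) (by positivity))
          (mul_le_mul_of_nonneg_left (h4 k hk) (by positivity))
    _ = _ := by
        rw [Finset.sum_const, Finset.card_range, nsmul_eq_mul]
        field_simp

end IsDegenerate

lemma tendsto_charFunBound (t C : ℝ) {δ γ : ℕ → ℝ} (hδ : Tendsto δ atTop (𝓝 0))
    (hγ : Tendsto γ atTop (𝓝 0)) :
    Tendsto (fun N : ℕ => charFunBound t N C (δ N) (γ N)) atTop (𝓝 0) := by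
  have hN : Tendsto (fun N : ℕ => (N : ℝ)) atTop atTop := tendsto_natCast_atTop_atTop
  have hs : Tendsto (fun N : ℕ => √(N : ℝ)) atTop atTop := Real.tendsto_sqrt_atTop.comp hN
  have hv : Tendsto (fun N : ℕ => condVarBound N C (δ N) (γ N)) atTop (𝓝 0) := by
    have := (((hδ.pow 2).add (hN.const_div_atTop (16 * C))).add (hγ.const_mul 64)).const_mul 3
    simpa [condVarBound] using this
  have hsv := (Real.continuous_sqrt.tendsto 0).comp hv
  have := (((((hs.const_div_atTop (1 + 48 * C)).const_mul (4 * |t| ^ 3)).add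
    ((hN.const_div_atTop (48 * C)).const_mul (t ^ 4 / 4))).const_mul (Real.exp (t ^ 2))).add
    (hsv.const_mul (Real.exp (t ^ 2) * (t ^ 2 / 2)))).add (hv.const_mul 2)
  simpa [charFunBound] using this

/-! ### Orthogonal projections -/

section Projections

variable {E : Type*} [NormedAddCommGroup E] [InnerProductSpace ℝ E]

lemma IsProj.apply_apply {Q : E →ₗ[ℝ] E} (hQ : Q.IsSymmetricProjection) (x : E) :
    Q (Q x) = Q x := by
  have := hQ.isIdempotentElem
  exact congrArg (fun f : E →ₗ[ℝ] E => f x) this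

lemma IsProj.inner_apply {Q : E →ₗ[ℝ] E} (hQ : Q.IsSymmetricProjection) (x y : E) :
    inner ℝ (Q x) y = inner ℝ x (Q y) := hQ.isSymmetric x y

lemma IsProj.inner_self {Q : E →ₗ[ℝ] E} (hQ : Q.IsSymmetricProjection) (x : E) :
    inner ℝ x (Q x) = ‖Q x‖ ^ 2 := by
  rw [← real_inner_self_eq_norm_sq, IsProj.inner_apply hQ, IsProj.apply_apply hQ]

lemma IsProj.norm_le {Q : E →ₗ[ℝ] E} (hQ : Q.IsSymmetricProjection) (x : E) : ‖Q x‖ ≤ ‖x‖ := by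
  have h1 := IsProj.inner_self hQ x
  have h2 := real_inner_le_norm x (Q x)
  rcases (norm_nonneg (Q x)).eq_or_lt with h | h
  · rw [← h]; exact norm_nonneg x
  · rw [h1, sq] at h2
    exact le_of_mul_le_mul_right h2 h

lemma IsProj.norm_sub_sq {Q : E →ₗ[ℝ] E} (hQ : Q.IsSymmetricProjection) (x : E) :
    ‖x - Q x‖ ^ 2 = ‖x‖ ^ 2 - ‖Q x‖ ^ 2 := by
  rw [norm_sub_sq_real, IsProj.inner_self hQ]
  ring

lemma IsProj.one_sub {Q : E →ₗ[ℝ] E} (hQ : Q.IsSymmetricProjection) :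
    (1 - Q : E →ₗ[ℝ] E).IsSymmetricProjection :=
  ⟨hQ.isIdempotentElem.one_sub, LinearMap.IsSymmetric.sub (fun _ _ => rfl) hQ.isSymmetric⟩

lemma IsProj.sum_norm_sq {ι : Type*} [Fintype ι] (b : OrthonormalBasis ι ℝ E) {Q : E →ₗ[ℝ] E}
    (hQ : Q.IsSymmetricProjection) : ∑ t, ‖Q (b t)‖ ^ 2 = LinearMap.trace ℝ E Q := by
  rw [LinearMap.trace_eq_sum_inner Q b]
  exact Finset.sum_congr rfl fun t _ => (IsProj.inner_self hQ _).symm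

lemma IsProj.sum_norm_comp_sq {ι : Type*} [Fintype ι] (b : OrthonormalBasis ι ℝ E)
    {Q R : E →ₗ[ℝ] E} (hQ : Q.IsSymmetricProjection) (hR : R.IsSymmetricProjection) :
    ∑ t, ‖Q (R (b t))‖ ^ 2 = LinearMap.trace ℝ E (Q * R) := by
  have h1 : LinearMap.trace ℝ E (Q * R) = LinearMap.trace ℝ E (R * (Q * R)) := by
    rw [LinearMap.trace_mul_comm ℝ R (Q * R), mul_assoc, hR.isIdempotentElem]
  rw [h1, LinearMap.trace_eq_sum_inner _ b]
  refine Finset.sum_congr rfl fun t _ => ?_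
  rw [← IsProj.inner_self hQ, IsProj.inner_apply hR]
  rfl

lemma IsProj.trace_mul_sq {ι : Type*} [Fintype ι] (b : OrthonormalBasis ι ℝ E)
    {Q R : E →ₗ[ℝ] E} (hQ : Q.IsSymmetricProjection) (hR : R.IsSymmetricProjection) :
    LinearMap.trace ℝ E ((Q * R) ^ 2) = ∑ t, ‖R (Q (R (b t)))‖ ^ 2 := by
  have : LinearMap.trace ℝ E ((Q * R) ^ 2) = LinearMap.trace ℝ E (R * (Q * (R * (Q * R)))) := by
    rw [LinearMap.trace_mul_comm ℝ R, sq]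
    simp only [mul_assoc]
    rw [hR.isIdempotentElem]
  rw [this, LinearMap.trace_eq_sum_inner _ b]
  refine Finset.sum_congr rfl fun t _ => ?_
  rw [← IsProj.inner_self hR, IsProj.inner_apply hQ, IsProj.inner_apply hR]
  rfl

lemma IsProj.sum_inner_sq {ι : Type*} [Fintype ι] (b : OrthonormalBasis ι ℝ E) {Q : E →ₗ[ℝ] E}
    (hQ : Q.IsSymmetricProjection) (w : E) :
    ∑ t, inner ℝ (Q w) (Q (b t)) ^ 2 = ‖Q w‖ ^ 2 := by
  simp_rw [← IsProj.inner_apply hQ, IsProj.apply_apply hQ]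
  exact b.sum_sq_inner_left _

/-- The direction `Q e / ‖Q e‖` of the projection `Q e` (with value `0` if `Q e = 0`). -/
noncomputable def dir (Q : E →ₗ[ℝ] E) (e : E) : E := ‖Q e‖⁻¹ • Q e

lemma norm_dir_le (Q : E →ₗ[ℝ] E) (e : E) : ‖dir Q e‖ ≤ 1 := by
  rw [dir, norm_smul, norm_inv, norm_norm]
  exact inv_mul_le_one

lemma norm_dir_of_ne_zero {Q : E →ₗ[ℝ] E} {e : E} (he : Q e ≠ 0) : ‖dir Q e‖ = 1 := by
  rw [dir, norm_smul, norm_inv, norm_norm, inv_mul_cancel₀ (norm_ne_zero_iff.2 he)]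

lemma IsProj.apply_dir {Q : E →ₗ[ℝ] E} (hQ : Q.IsSymmetricProjection) (e : E) :
    Q (dir Q e) = dir Q e := by
  rw [dir, map_smul, IsProj.apply_apply hQ]

lemma IsProj.inner_dir {Q : E →ₗ[ℝ] E} (hQ : Q.IsSymmetricProjection) (e w : E) :
    inner ℝ (dir Q e) w = inner ℝ (dir Q e) (Q w) := by
  rw [← IsProj.inner_apply hQ, IsProj.apply_dir hQ]

variable [FiniteDimensional ℝ E]

lemma IsProj.trace_mul_le {Q R : E →ₗ[ℝ] E} (hQ : Q.IsSymmetricProjection)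
    (hR : R.IsSymmetricProjection) :
    LinearMap.trace ℝ E (Q * R) ≤ LinearMap.trace ℝ E R := by
  rw [← IsProj.sum_norm_comp_sq (stdOrthonormalBasis ℝ E) hQ hR,
    ← IsProj.sum_norm_sq (stdOrthonormalBasis ℝ E) hR]
  exact Finset.sum_le_sum fun t _ => pow_le_pow_left₀ (norm_nonneg _) (IsProj.norm_le hQ _) 2

lemma IsProj.trace_mul_nonneg {Q R : E →ₗ[ℝ] E} (hQ : Q.IsSymmetricProjection)
    (hR : R.IsSymmetricProjection) : 0 ≤ LinearMap.trace ℝ E (Q * R) := by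
  rw [← IsProj.sum_norm_comp_sq (stdOrthonormalBasis ℝ E) hQ hR]
  exact Finset.sum_nonneg fun t _ => sq_nonneg _

/-- Two subspaces of small codimension intersect in small codimension. -/
lemma IsProj.le_trace_mul {Q R : E →ₗ[ℝ] E} (hQ : Q.IsSymmetricProjection)
    (hR : R.IsSymmetricProjection) :
    LinearMap.trace ℝ E R - LinearMap.trace ℝ E (1 - Q) ≤ LinearMap.trace ℝ E (Q * R) := by
  have h := IsProj.trace_mul_le hR (IsProj.one_sub hQ)
  rw [mul_sub, mul_one, map_sub, LinearMap.trace_mul_comm ℝ R Q] at h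
  linarith

lemma IsProj.trace_mul_sq_nonneg {Q R : E →ₗ[ℝ] E} (hQ : Q.IsSymmetricProjection)
    (hR : R.IsSymmetricProjection) : 0 ≤ LinearMap.trace ℝ E ((Q * R) ^ 2) := by
  rw [IsProj.trace_mul_sq (stdOrthonormalBasis ℝ E) hQ hR]
  exact Finset.sum_nonneg fun t _ => sq_nonneg _

lemma IsProj.trace_mul_sq_le {Q R : E →ₗ[ℝ] E} (hQ : Q.IsSymmetricProjection)
    (hR : R.IsSymmetricProjection) :
    LinearMap.trace ℝ E ((Q * R) ^ 2) ≤ LinearMap.trace ℝ E R := by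
  rw [IsProj.trace_mul_sq (stdOrthonormalBasis ℝ E) hQ hR,
    ← IsProj.sum_norm_sq (stdOrthonormalBasis ℝ E) hR]
  exact Finset.sum_le_sum fun t _ => pow_le_pow_left₀ (norm_nonneg _)
    ((IsProj.norm_le hR _).trans (IsProj.norm_le hQ _)) 2

end Projections

/-! ### Moments of isotropic directions -/

section Directions

variable {E : Type*} [NormedAddCommGroup E] [InnerProductSpace ℝ E] [MeasurableSpace E]

/-- `γ` is invariant under all linear isometries and `Q` is the orthogonal projection onto a
subspace of dimension `n > 0`. Then `dir Q` is uniformly distributed on the unit sphere of that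
subspace; its moments are computed from the invariance alone. -/
structure IsIsotropic (γ : Measure E) (Q : E →ₗ[ℝ] E) (n : ℝ) : Prop where
  proj : Q.IsSymmetricProjection
  trace : LinearMap.trace ℝ E Q = n
  pos : 0 < n
  map_isometry : ∀ O : E ≃ₗᵢ[ℝ] E, γ.map O = γ
  ae_ne_zero : ∀ᵐ e ∂γ, Q e ≠ 0

lemma IsIsotropic.exists_unit {γ : Measure E} [IsProbabilityMeasure γ] {Q : E →ₗ[ℝ] E} {n : ℝ}
    (h : IsIsotropic γ Q n) : ∃ w, Q w = w ∧ ‖w‖ = 1 := by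
  obtain ⟨e, he⟩ := h.ae_ne_zero.exists
  exact ⟨dir Q e, IsProj.apply_dir h.proj e, norm_dir_of_ne_zero he⟩

variable [FiniteDimensional ℝ E] [BorelSpace E]

lemma measurable_dir (Q : E →ₗ[ℝ] E) : Measurable (dir Q) := by
  have : Measurable Q := Q.continuous_of_finiteDimensional.measurable
  unfold dir
  fun_prop

namespace IsIsotropic

variable {γ : Measure E} {Q : E →ₗ[ℝ] E} {n : ℝ}

lemma bddMeas_inner (Q : E →ₗ[ℝ] E) (w : E) : BddMeas fun e => inner ℝ (dir Q e) w := by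
  have hm := measurable_dir Q
  refine ⟨by fun_prop, ‖w‖, fun e => ?_⟩
  refine (abs_real_inner_le_norm _ _).trans ?_
  exact mul_le_of_le_one_left (norm_nonneg _) (norm_dir_le Q e)

/-- The law of a linear form depends on the length of its vector only: the reflection which
exchanges two vectors of the range of `Q` commutes with `Q`. -/
lemma integral_inner_pow_eq (h : IsIsotropic γ Q n) {w w' : E} (hw : Q w = w) (hw' : Q w' = w')
    (hn : ‖w‖ = ‖w'‖) (k : ℕ) :
    ∫ e, inner ℝ (dir Q e) w ^ k ∂γ = ∫ e, inner ℝ (dir Q e) w' ^ k ∂γ := by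
  let O : E ≃ₗᵢ[ℝ] E := (ℝ ∙ (w - w'))ᗮ.reflection
  have hOw : O w = w' := Submodule.reflection_sub hn
  have hOQ : ∀ e, Q (O e) = O (Q e) := fun e => by
    have hv : Q (w - w') = w - w' := by rw [map_sub, hw, hw']
    have hi : inner ℝ (w - w') (Q e) = inner ℝ (w - w') e := by
      rw [← IsProj.inner_apply h.proj, hv]
    simp only [O, Submodule.reflection_orthogonal_apply, Submodule.reflection_singleton_apply,
      map_neg, map_sub, hi]
    rw [map_nsmul, map_smul, map_sub, hw, hw']
  have hdir : ∀ e, dir Q (O e) = O (dir Q e) := fun e => by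
    rw [dir, dir, hOQ, LinearIsometryEquiv.norm_map, map_smul]
  conv_rhs => rw [← h.map_isometry O]
  rw [integral_map O.continuous.measurable.aemeasurable
    ((bddMeas_inner Q w').pow k).meas.aestronglyMeasurable]
  simp_rw [hdir, ← hOw, LinearIsometryEquiv.inner_map_map]

variable [IsProbabilityMeasure γ]

/-- The moments of the linear forms of a uniformly distributed direction. -/
lemma exists_moments (h : IsIsotropic γ Q n) :
    ∃ m : ℕ → ℝ, ∀ k w, ∫ e, inner ℝ (dir Q e) w ^ k ∂γ = m k * ‖Q w‖ ^ k := by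
  obtain ⟨w₀, h0, h1⟩ := h.exists_unit
  refine ⟨fun k => ∫ e, inner ℝ (dir Q e) w₀ ^ k ∂γ, fun k w => ?_⟩
  have e1 : ∫ e, inner ℝ (dir Q e) w ^ k ∂γ = ∫ e, inner ℝ (dir Q e) (Q w) ^ k ∂γ := by
    simp_rw [IsProj.inner_dir h.proj _ w]
  rw [e1, h.integral_inner_pow_eq (IsProj.apply_apply h.proj w) (w' := ‖Q w‖ • w₀)
    (by rw [map_smul, h0]) (by rw [norm_smul, h1]; simp)]
  simp_rw [real_inner_smul_right, mul_pow]
  rw [integral_const_mul, mul_comm]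

/-- Binomial expansion of the even moments of the linear form of `w + r e`. -/
lemma sum_mixed_moments {m : ℕ → ℝ}
    (hm : ∀ k w, ∫ e, inner ℝ (dir Q e) w ^ k ∂γ = m k * ‖Q w‖ ^ k) (l : ℕ) (w e : E) (r : ℝ) :
    ∑ j ∈ Finset.range (2 * l + 1), (∫ x, inner ℝ (dir Q x) w ^ j *
        inner ℝ (dir Q x) e ^ (2 * l - j) ∂γ) * r ^ (2 * l - j) * ((2 * l).choose j : ℝ)
      = m (2 * l) * (‖Q w‖ ^ 2 + 2 * r * inner ℝ (Q w) (Q e) + r ^ 2 * ‖Q e‖ ^ 2) ^ l := by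
  have h1 := hm (2 * l) (w + r • e)
  have h2 : ‖Q (w + r • e)‖ ^ (2 * l)
      = (‖Q w‖ ^ 2 + 2 * r * inner ℝ (Q w) (Q e) + r ^ 2 * ‖Q e‖ ^ 2) ^ l := by
    rw [pow_mul, map_add, map_smul, norm_add_sq_real, real_inner_smul_right, norm_smul, mul_pow,
      Real.norm_eq_abs, sq_abs]
    ring
  rw [← h2, ← h1]
  simp_rw [inner_add_right, real_inner_smul_right, add_pow]
  have b : ∀ j, BddMeas fun x => inner ℝ (dir Q x) w ^ j * inner ℝ (dir Q x) e ^ (2 * l - j) :=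
    fun j => ((bddMeas_inner Q w).pow j).mul ((bddMeas_inner Q e).pow _)
  have e1 : ∀ x, ∑ j ∈ Finset.range (2 * l + 1), inner ℝ (dir Q x) w ^ j *
        (r * inner ℝ (dir Q x) e) ^ (2 * l - j) * ((2 * l).choose j : ℝ)
      = ∑ j ∈ Finset.range (2 * l + 1), (r ^ (2 * l - j) * ((2 * l).choose j : ℝ)) *
        (inner ℝ (dir Q x) w ^ j * inner ℝ (dir Q x) e ^ (2 * l - j)) := fun x =>
    Finset.sum_congr rfl fun j _ => by rw [mul_pow]; ring
  simp_rw [e1]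
  rw [integral_finsetSum _ fun j _ => ((b j).const_mul _).integrable γ]
  refine Finset.sum_congr rfl fun j _ => ?_
  rw [integral_const_mul]
  ring

/-- Summing a second-order mixed moment over an orthonormal basis removes the second form. -/
lemma sum_integral_mul_inner_sq (h : IsIsotropic γ Q n) {ι : Type*} [Fintype ι]
    (b : OrthonormalBasis ι ℝ E) {f : E → ℝ} (hf : BddMeas f) :
    ∑ t, ∫ e, f e * inner ℝ (dir Q e) (b t) ^ 2 ∂γ = ∫ e, f e ∂γ := by
  rw [← integral_finsetSum _ fun t _ => (hf.mul ((bddMeas_inner Q (b t)).pow 2)).integrable γ]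
  refine integral_congr_ae ?_
  filter_upwards [h.ae_ne_zero] with e he
  rw [← Finset.mul_sum, b.sum_sq_inner_left, norm_dir_of_ne_zero he]
  ring

/-- The second moments of linear forms. -/
lemma integral_inner_sq (h : IsIsotropic γ Q n) (w : E) :
    ∫ e, inner ℝ (dir Q e) w ^ 2 ∂γ = ‖Q w‖ ^ 2 / n := by
  obtain ⟨m, hm⟩ := h.exists_moments
  have hs := h.sum_integral_mul_inner_sq (stdOrthonormalBasis ℝ E) (BddMeas.const 1)
  simp only [one_mul, hm, ← Finset.mul_sum, IsProj.sum_norm_sq _ h.proj, h.trace, integral_const,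
    probReal_univ, one_smul] at hs
  rw [hm, eq_div_iff h.pos.ne']
  linear_combination ‖Q w‖ ^ 2 * hs

/-- The fourth mixed moments of linear forms. -/
lemma integral_inner_sq_mul_inner_sq (h : IsIsotropic γ Q n) (w w' : E) :
    ∫ e, inner ℝ (dir Q e) w ^ 2 * inner ℝ (dir Q e) w' ^ 2 ∂γ
      = (‖Q w‖ ^ 2 * ‖Q w'‖ ^ 2 + 2 * inner ℝ (Q w) (Q w') ^ 2) / (n * (n + 2)) := by
  have hn := h.pos
  obtain ⟨m, hm⟩ := h.exists_moments
  have key : ∀ w w' : E, ∫ e, inner ℝ (dir Q e) w ^ 2 * inner ℝ (dir Q e) w' ^ 2 ∂γ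
      = m 4 / 3 * (‖Q w‖ ^ 2 * ‖Q w'‖ ^ 2 + 2 * inner ℝ (Q w) (Q w') ^ 2) := fun w w' => by
    -- the even part of the expansion in `r` at `r = 1`
    have h1 := sum_mixed_moments hm 2 w w' 1
    have h2 := sum_mixed_moments hm 2 w w' (-1)
    have h3 := hm 4 w
    have h4 := hm 4 w'
    simp [Finset.sum_range_succ, Nat.choose] at h1 h2
    linear_combination (h1 + h2) / 12 - h3 / 6 - h4 / 6
  obtain ⟨w₀, h0, h1⟩ := h.exists_unit
  have hs := h.sum_integral_mul_inner_sq (stdOrthonormalBasis ℝ E)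
    ((bddMeas_inner Q w₀).pow 2)
  simp_rw [key, ← Finset.mul_sum, Finset.sum_add_distrib, ← Finset.mul_sum,
    IsProj.sum_inner_sq _ h.proj, IsProj.sum_norm_sq _ h.proj, h.trace, h.integral_inner_sq,
    h0, h1] at hs
  have hm4 : m 4 / 3 = 1 / (n * (n + 2)) := by
    field_simp at hs ⊢
    linarith
  rw [key, hm4]
  ring

lemma integral_inner_pow_four (h : IsIsotropic γ Q n) (w : E) :
    ∫ e, inner ℝ (dir Q e) w ^ 4 ∂γ = 3 * ‖Q w‖ ^ 4 / (n * (n + 2)) := by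
  have := h.integral_inner_sq_mul_inner_sq w w
  simp_rw [← pow_add] at this
  rw [this, real_inner_self_eq_norm_sq]
  ring

/-- The eighth moments of linear forms are of the order `n⁻⁴`. -/
lemma integral_inner_pow_eight_le (h : IsIsotropic γ Q n) (w : E) :
    ∫ e, inner ℝ (dir Q e) w ^ 8 ∂γ ≤ 105 / n ^ 4 * ‖w‖ ^ 8 := by
  have hn := h.pos
  obtain ⟨m, hm⟩ := h.exists_moments
  -- the coefficient of `r ^ 2` in the moments of `w + r w'` is isolated by evaluating at
  -- several `r`
  have key6 : ∀ w w' : E, ∫ e, inner ℝ (dir Q e) w ^ 4 * inner ℝ (dir Q e) w' ^ 2 ∂γ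
      = m 6 / 5 * (‖Q w‖ ^ 4 * ‖Q w'‖ ^ 2 + 4 * ‖Q w‖ ^ 2 * inner ℝ (Q w) (Q w') ^ 2) :=
    fun w w' => by
    have h1 := sum_mixed_moments hm 3 w w' 1
    have h2 := sum_mixed_moments hm 3 w w' (-1)
    have h3 := sum_mixed_moments hm 3 w w' 2
    have h4 := sum_mixed_moments hm 3 w w' (-2)
    have h5 := hm 6 w
    have h6 := hm 6 w'
    simp [Finset.sum_range_succ, Nat.choose] at h1 h2 h3 h4
    linear_combination (16 * (h1 + h2) - (h3 + h4)) / 360 - 30 * h5 / 360 + 96 * h6 / 360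
  have key8 : ∀ w w' : E, ∫ e, inner ℝ (dir Q e) w ^ 6 * inner ℝ (dir Q e) w' ^ 2 ∂γ
      = m 8 / 7 * (‖Q w‖ ^ 6 * ‖Q w'‖ ^ 2 + 6 * ‖Q w‖ ^ 4 * inner ℝ (Q w) (Q w') ^ 2) :=
    fun w w' => by
    have h1 := sum_mixed_moments hm 4 w w' 1
    have h2 := sum_mixed_moments hm 4 w w' (-1)
    have h3 := sum_mixed_moments hm 4 w w' 2
    have h4 := sum_mixed_moments hm 4 w w' (-2)
    have h5 := sum_mixed_moments hm 4 w w' 3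
    have h6 := sum_mixed_moments hm 4 w w' (-3)
    have h7 := hm 8 w
    have h8 := hm 8 w'
    simp [Finset.sum_range_succ, Nat.choose] at h1 h2 h3 h4 h5 h6
    linarith
  obtain ⟨w₀, h0, h1⟩ := h.exists_unit
  have hs6 := h.sum_integral_mul_inner_sq (stdOrthonormalBasis ℝ E)
    ((bddMeas_inner Q w₀).pow 4)
  simp_rw [key6, ← Finset.mul_sum, Finset.sum_add_distrib, ← Finset.mul_sum,
    IsProj.sum_inner_sq _ h.proj, IsProj.sum_norm_sq _ h.proj, h.trace,
    h.integral_inner_pow_four, h0, h1] at hs6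
  have hs8 := h.sum_integral_mul_inner_sq (stdOrthonormalBasis ℝ E)
    ((bddMeas_inner Q w₀).pow 6)
  simp_rw [key8, ← Finset.mul_sum, Finset.sum_add_distrib, ← Finset.mul_sum,
    IsProj.sum_inner_sq _ h.proj, IsProj.sum_norm_sq _ h.proj, h.trace, hm, h0, h1] at hs8
  have hm8 : m 8 = 105 / (n * (n + 2) * (n + 4) * (n + 6)) := by
    have hm6 : m 6 = 15 / (n * (n + 2) * (n + 4)) := by
      field_simp at hs6 ⊢
      linarith
    rw [hm6] at hs8
    field_simp at hs8 ⊢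
    linarith
  rw [hm, hm8]
  have h2 : ‖Q w‖ ^ 8 ≤ ‖w‖ ^ 8 := pow_le_pow_left₀ (norm_nonneg _) (IsProj.norm_le h.proj w) 8
  refine mul_le_mul ?_ h2 (by positivity) (by positivity)
  gcongr
  nlinarith [mul_pos hn hn, mul_pos (mul_pos hn hn) hn]

end IsIsotropic
end Directions

/-! ### The Hoeffding decomposition of a squared correlation -/

section

variable {E : Type*} [NormedAddCommGroup E] [InnerProductSpace ℝ E]

/-- The squared length of the projection to the range of `R` of the direction of `Q e`, centred for
`e` isotropic and `Q` of rank `n`. -/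
noncomputable def projLength (n : ℝ) (Q R : E →ₗ[ℝ] E) (e : E) : ℝ :=
  ‖R (dir Q e)‖ ^ 2 - LinearMap.trace ℝ E (Q * R) / n

/-- The degenerate part of `n ⟪u, v⟫² - tr (Q R) / n`, where `u` and `v` are independent random
directions in the ranges of the projections `Q` and `R`. -/
noncomputable def dirKernel (n : ℝ) (Q R : E →ₗ[ℝ] E) (a b : E) : ℝ :=
  n * inner ℝ (dir Q a) (dir R b) ^ 2 - ‖R (dir Q a)‖ ^ 2 - ‖Q (dir R b)‖ ^ 2
    + LinearMap.trace ℝ E (Q * R) / n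

lemma dirKernel_comm (n : ℝ) (Q R : E →ₗ[ℝ] E) (a b : E) :
    dirKernel n Q R a b = dirKernel n R Q b a := by
  rw [dirKernel, dirKernel, real_inner_comm, LinearMap.trace_mul_comm]
  ring

/-- Hoeffding decomposition of the squared inner product of two random directions. -/
lemma dirKernel_add_projLength (n : ℝ) (Q R : E →ₗ[ℝ] E) (a b : E) :
    n * inner ℝ (dir Q a) (dir R b) ^ 2 - LinearMap.trace ℝ E (Q * R) / n
      = dirKernel n Q R a b + projLength n Q R a + projLength n R Q b := by
  rw [dirKernel, projLength, projLength, LinearMap.trace_mul_comm ℝ R Q]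
  ring

variable [FiniteDimensional ℝ E] [MeasurableSpace E]

namespace IsIsotropic

variable {γ γ' : Measure E} {Q R : E →ₗ[ℝ] E} {n : ℝ}

lemma trace_mul_div_mem (h : IsIsotropic γ Q n) (h' : IsIsotropic γ' R n) :
    0 ≤ LinearMap.trace ℝ E (Q * R) / n ∧ LinearMap.trace ℝ E (Q * R) / n ≤ 1 := by
  refine ⟨div_nonneg (IsProj.trace_mul_nonneg h.proj h'.proj) h.pos.le, ?_⟩
  rw [div_le_one h.pos, ← h'.trace]
  exact IsProj.trace_mul_le h.proj h'.proj

lemma abs_dirKernel_le (h : IsIsotropic γ Q n) (h' : IsIsotropic γ' R n) (a b : E) :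
    |dirKernel n Q R a b| ≤ n * inner ℝ (dir R b) (dir Q a) ^ 2 + 2 := by
  have hn := h.pos
  have h1 : ‖R (dir Q a)‖ ^ 2 ≤ 1 := pow_le_one₀ (norm_nonneg _)
    ((IsProj.norm_le h'.proj _).trans (norm_dir_le Q a))
  have h2 : ‖Q (dir R b)‖ ^ 2 ≤ 1 := pow_le_one₀ (norm_nonneg _)
    ((IsProj.norm_le h.proj _).trans (norm_dir_le R b))
  have h3 := h.trace_mul_div_mem h'
  have h4 : 0 ≤ n * inner ℝ (dir R b) (dir Q a) ^ 2 := by positivity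
  have h5 := sq_nonneg ‖R (dir Q a)‖
  have h6 := sq_nonneg ‖Q (dir R b)‖
  rw [dirKernel, real_inner_comm, abs_le]
  constructor <;> linarith [h3.1, h3.2]

end IsIsotropic

variable [BorelSpace E]

lemma bddMeas_normSq (Q R : E →ₗ[ℝ] E) (hR : R.IsSymmetricProjection) :
    BddMeas fun e => ‖R (dir Q e)‖ ^ 2 := by
  have hm := measurable_dir Q
  have hRm : Measurable R := R.continuous_of_finiteDimensional.measurable
  refine ⟨(hRm.comp hm).norm.pow_const 2, 1, fun e => ?_⟩
  rw [abs_of_nonneg (sq_nonneg _)]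
  exact pow_le_one₀ (norm_nonneg _) ((IsProj.norm_le hR _).trans (norm_dir_le Q e))

lemma bddMeas_projLength (n : ℝ) (Q R : E →ₗ[ℝ] E) (hR : R.IsSymmetricProjection) :
    BddMeas (projLength n Q R) :=
  (bddMeas_normSq Q R hR).sub (BddMeas.const _)

lemma bddMeas_inner_dir (Q R : E →ₗ[ℝ] E) :
    BddMeas fun p : E × E => inner ℝ (dir Q p.1) (dir R p.2) := by
  have hm := measurable_dir Q
  have hm' := measurable_dir R
  refine ⟨by fun_prop, 1, fun p => ?_⟩
  refine (abs_real_inner_le_norm _ _).trans ?_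
  exact mul_le_one₀ (norm_dir_le Q _) (norm_nonneg _) (norm_dir_le R _)

lemma bddMeas_dirKernel (n : ℝ) {Q R : E →ₗ[ℝ] E} (hQ : Q.IsSymmetricProjection)
    (hR : R.IsSymmetricProjection) : BddMeas fun p : E × E => dirKernel n Q R p.1 p.2 :=
  (((((bddMeas_inner_dir Q R).pow 2).const_mul n).sub
    ((bddMeas_normSq Q R hR).comp measurable_fst)).sub
    ((bddMeas_normSq R Q hQ).comp measurable_snd)).add (BddMeas.const _)

lemma bddMeas_dirKernel_right (n : ℝ) {Q R : E →ₗ[ℝ] E} (hQ : Q.IsSymmetricProjection)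
    (hR : R.IsSymmetricProjection) (a : E) : BddMeas fun b : E => dirKernel n Q R a b := by
  have hm : Measurable (Prod.mk a : E → E × E) := measurable_prodMk_left
  have := (bddMeas_dirKernel n hQ hR).comp hm
  dsimp only at this
  exact this

namespace IsIsotropic

variable {γ γ' γ₀ : Measure E} {Q R K : E →ₗ[ℝ] E} {n p : ℝ}
  [IsProbabilityMeasure γ] [IsProbabilityMeasure γ'] [IsProbabilityMeasure γ₀]

lemma integral_norm_sq (h : IsIsotropic γ Q n) (hR : R.IsSymmetricProjection) :
    ∫ e, ‖R (dir Q e)‖ ^ 2 ∂γ = LinearMap.trace ℝ E (Q * R) / n := by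
  let b := stdOrthonormalBasis ℝ E
  have e1 : ∀ e, ‖R (dir Q e)‖ ^ 2 = ∑ t, inner ℝ (dir Q e) (R (b t)) ^ 2 := fun e => by
    rw [← b.sum_sq_inner_left]
    simp_rw [IsProj.inner_apply hR]
  simp_rw [e1]
  rw [integral_finsetSum _ fun t _ => ((bddMeas_inner Q _).pow 2).integrable γ]
  simp_rw [h.integral_inner_sq, ← Finset.sum_div, IsProj.sum_norm_comp_sq b h.proj hR]

/-- A random direction has a short projection to a subspace of small dimension. -/
lemma integral_norm_pow_four_le (h : IsIsotropic γ Q n) (hR : R.IsSymmetricProjection) :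
    ∫ e, (‖R (dir Q e)‖ ^ 2) ^ 2 ∂γ ≤ 3 * LinearMap.trace ℝ E R ^ 2 / n ^ 2 := by
  have hn := h.pos
  let b := stdOrthonormalBasis ℝ E
  have e1 : ∀ e, (‖R (dir Q e)‖ ^ 2) ^ 2 = ∑ t, ∑ r,
      inner ℝ (dir Q e) (R (b t)) ^ 2 * inner ℝ (dir Q e) (R (b r)) ^ 2 := fun e => by
    rw [← b.sum_sq_inner_left, sq, Finset.sum_mul_sum]
    simp_rw [IsProj.inner_apply hR]
  have hb : ∀ t r, BddMeas fun e =>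
      inner ℝ (dir Q e) (R (b t)) ^ 2 * inner ℝ (dir Q e) (R (b r)) ^ 2 := fun t r =>
    ((bddMeas_inner Q _).pow 2).mul ((bddMeas_inner Q _).pow 2)
  simp_rw [e1]
  rw [integral_finsetSum _ fun t _ => (BddMeas.sum _ fun r _ => hb t r).integrable γ]
  calc _ = ∑ t, ∑ r, ∫ e, inner ℝ (dir Q e) (R (b t)) ^ 2 * inner ℝ (dir Q e) (R (b r)) ^ 2 ∂γ :=
        Finset.sum_congr rfl fun t _ => integral_finsetSum _ fun r _ => (hb t r).integrable γ
    _ ≤ ∑ t, ∑ r, 3 / n ^ 2 * (‖R (b t)‖ ^ 2 * ‖R (b r)‖ ^ 2) := by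
        refine Finset.sum_le_sum fun t _ => Finset.sum_le_sum fun r _ => ?_
        rw [h.integral_inner_sq_mul_inner_sq]
        have h1 : ‖Q (R (b t))‖ ^ 2 ≤ ‖R (b t)‖ ^ 2 :=
          pow_le_pow_left₀ (norm_nonneg _) (IsProj.norm_le h.proj _) 2
        have h2 : ‖Q (R (b r))‖ ^ 2 ≤ ‖R (b r)‖ ^ 2 :=
          pow_le_pow_left₀ (norm_nonneg _) (IsProj.norm_le h.proj _) 2
        have h3 : inner ℝ (Q (R (b t))) (Q (R (b r))) ^ 2
            ≤ ‖Q (R (b t))‖ ^ 2 * ‖Q (R (b r))‖ ^ 2 := by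
          rw [← mul_pow, ← sq_abs]
          exact pow_le_pow_left₀ (abs_nonneg _) (abs_real_inner_le_norm _ _) 2
        have h4 : ‖Q (R (b t))‖ ^ 2 * ‖Q (R (b r))‖ ^ 2 ≤ ‖R (b t)‖ ^ 2 * ‖R (b r)‖ ^ 2 :=
          mul_le_mul h1 h2 (by positivity) (by positivity)
        rw [div_mul_eq_mul_div]
        refine div_le_div₀ (by positivity) (by linarith) (by positivity) (by nlinarith)
    _ = 3 * LinearMap.trace ℝ E R ^ 2 / n ^ 2 := by
        simp_rw [← Finset.mul_sum, ← Finset.sum_mul, IsProj.sum_norm_sq b hR]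
        ring

lemma integral_projLength (h : IsIsotropic γ Q n) (hR : R.IsSymmetricProjection) :
    ∫ e, projLength n Q R e ∂γ = 0 := by
  unfold projLength
  rw [integral_sub ((bddMeas_normSq Q R hR).integrable γ) (integrable_const _),
    h.integral_norm_sq hR]
  simp

/-- The length of the projection of a random direction to a subspace of bounded codimension is
nearly deterministic, since the complementary projection is short. -/
lemma integral_projLength_sq_le (h : IsIsotropic γ Q n) (hR : R.IsSymmetricProjection)
    (hp : LinearMap.trace ℝ E (1 - R) = p) :
    ∫ e, projLength n Q R e ^ 2 ∂γ ≤ 3 * p ^ 2 / n ^ 2 := by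
  have hn := h.pos
  have hM := IsProj.one_sub hR
  have hb := bddMeas_normSq Q (1 - R) hM
  have e1 : ∫ e, projLength n Q R e ^ 2 ∂γ
      = ∫ e, (‖(1 - R) (dir Q e)‖ ^ 2 - ∫ e, ‖(1 - R) (dir Q e)‖ ^ 2 ∂γ) ^ 2 ∂γ := by
    refine integral_congr_ae ?_
    filter_upwards [h.ae_ne_zero] with e he
    rw [h.integral_norm_sq hM, mul_sub, mul_one, map_sub, h.trace, LinearMap.sub_apply,
      Module.End.one_apply, IsProj.norm_sub_sq hR, norm_dir_of_ne_zero he, projLength, sub_div,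
      div_self hn.ne']
    ring
  rw [e1, ← hp]
  refine le_trans ?_ (h.integral_norm_pow_four_le hM)
  have := variance_le_expectation_sq (μ := γ) hb.meas.aestronglyMeasurable
  rw [variance_eq_integral hb.meas.aemeasurable] at this
  exact this

lemma integral_dirKernel_right (h' : IsIsotropic γ' R n) (hQ : Q.IsSymmetricProjection) (a : E) :
    ∫ b, dirKernel n Q R a b ∂γ' = 0 := by
  have hn := h'.pos
  have b1 : BddMeas fun b => n * inner ℝ (dir R b) (dir Q a) ^ 2 :=
    ((bddMeas_inner R _).pow 2).const_mul n
  simp_rw [dirKernel, fun b => real_inner_comm (dir R b) (dir Q a)]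
  rw [integral_add (((b1.sub (BddMeas.const _)).sub (bddMeas_normSq R Q hQ)).integrable _)
    (integrable_const _), integral_sub ((b1.sub (BddMeas.const _)).integrable _)
    ((bddMeas_normSq R Q hQ).integrable _), integral_sub (b1.integrable _) (integrable_const _),
    integral_const_mul, h'.integral_inner_sq, h'.integral_norm_sq hQ,
    LinearMap.trace_mul_comm ℝ R Q]
  simp
  field_simp
  ring

lemma integral_dirKernel_left (h : IsIsotropic γ Q n) (hR : R.IsSymmetricProjection) (b : E) :
    ∫ a, dirKernel n Q R a b ∂γ = 0 := by
  simp_rw [dirKernel_comm n Q R]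
  exact h.integral_dirKernel_right hR b

/-- The fourth moments of the kernel are bounded, since the inner product of two independent
directions has an eighth moment of the order `n⁻⁴`. -/
lemma integral_dirKernel_pow_four_le (h : IsIsotropic γ Q n) (h' : IsIsotropic γ' R n) :
    ∫ a, ∫ b, dirKernel n Q R a b ^ 4 ∂γ' ∂γ ≤ 968 := by
  have hn := h.pos
  have hb := (bddMeas_dirKernel n h.proj h'.proj).pow 4
  have h1 : ∀ a, ∫ b, dirKernel n Q R a b ^ 4 ∂γ' ≤ 968 := fun a => by
    have b8 := ((bddMeas_inner R (dir Q a)).pow 8).const_mul (8 * n ^ 4)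
    calc _ ≤ ∫ b, (8 * n ^ 4 * inner ℝ (dir R b) (dir Q a) ^ 8 + 128) ∂γ' := by
          refine integral_mono
            ((hb.comp (by fun_prop : Measurable fun b : E => (a, b))).integrable _)
            ((b8.add (BddMeas.const _)).integrable _) fun b => ?_
          have hk := h.abs_dirKernel_le h' a b
          dsimp only
          set y := n * inner ℝ (dir R b) (dir Q a) ^ 2 with hy
          have hy0 : 0 ≤ y := by positivity
          have e : 8 * n ^ 4 * inner ℝ (dir R b) (dir Q a) ^ 8 = 8 * y ^ 4 := by
            rw [hy]; ring
          rw [e, ← (by decide : Even 4).pow_abs]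
          refine (pow_le_pow_left₀ (abs_nonneg _) hk 4).trans ?_
          nlinarith [sq_nonneg (y - 2), sq_nonneg (y ^ 2 - 4), sq_nonneg (y ^ 2 - 2 * y),
            mul_nonneg hy0 (sq_nonneg (y - 2))]
      _ ≤ 8 * n ^ 4 * (105 / n ^ 4 * 1) + 128 := by
          rw [integral_add (b8.integrable _) (integrable_const _), integral_const_mul]
          have h8 := h'.integral_inner_pow_eight_le (dir Q a)
          have h9 : ‖dir Q a‖ ^ 8 ≤ 1 := pow_le_one₀ (norm_nonneg _) (norm_dir_le Q a)
          simp only [integral_const, probReal_univ, one_smul]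
          gcongr
          refine h8.trans ?_
          gcongr
      _ = 968 := by field_simp; norm_num
  calc _ ≤ ∫ _, (968 : ℝ) ∂γ :=
        integral_mono ((hb.integral_right γ').integrable _) (integrable_const _) h1
    _ = 968 := by simp

/-- The second moment of the centred squared inner product, conditionally on the first
direction. -/
lemma integral_sq_inner_sub (h' : IsIsotropic γ' R n) (τ : ℝ)
    (hτ : τ = LinearMap.trace ℝ E (Q * R) / n) (a : E) :
    ∫ b, (n * inner ℝ (dir Q a) (dir R b) ^ 2 - τ) ^ 2 ∂γ'
      = 3 * n / (n + 2) * (projLength n Q R a + τ) ^ 2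
        - 2 * τ * (projLength n Q R a + τ) + τ ^ 2 := by
  have hn := h'.pos
  have b4 := ((bddMeas_inner R (dir Q a)).pow 4).const_mul (n ^ 2)
  have b2 := ((bddMeas_inner R (dir Q a)).pow 2).const_mul (2 * τ * n)
  have e : ∀ b, (n * inner ℝ (dir Q a) (dir R b) ^ 2 - τ) ^ 2
      = n ^ 2 * inner ℝ (dir R b) (dir Q a) ^ 4 - 2 * τ * n * inner ℝ (dir R b) (dir Q a) ^ 2
        + τ ^ 2 := fun b => by rw [real_inner_comm]; ring
  have hg : projLength n Q R a + τ = ‖R (dir Q a)‖ ^ 2 := by rw [projLength, hτ]; ring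
  simp_rw [e]
  rw [integral_add ((b4.sub b2).integrable _) (integrable_const _),
    integral_sub (b4.integrable _) (b2.integrable _), integral_const_mul, integral_const_mul,
    h'.integral_inner_pow_four, h'.integral_inner_sq, hg]
  simp only [integral_const, probReal_univ, one_smul]
  field_simp

/-- The same second moment through the Hoeffding decomposition. -/
lemma integral_sq_inner_sub' (h' : IsIsotropic γ' R n) (hQ : Q.IsSymmetricProjection) (τ : ℝ)
    (hτ : τ = LinearMap.trace ℝ E (Q * R) / n) (a : E) :
    ∫ b, (n * inner ℝ (dir Q a) (dir R b) ^ 2 - τ) ^ 2 ∂γ'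
      = ∫ b, dirKernel n Q R a b ^ 2 ∂γ' + projLength n Q R a ^ 2
        + ∫ b, projLength n R Q b ^ 2 ∂γ'
        + 2 * ∫ b, dirKernel n Q R a b * projLength n R Q b ∂γ' := by
  have e : ∀ b, (n * inner ℝ (dir Q a) (dir R b) ^ 2 - τ) ^ 2
      = dirKernel n Q R a b ^ 2 + projLength n Q R a ^ 2 + projLength n R Q b ^ 2
        + 2 * (dirKernel n Q R a b * projLength n R Q b)
        + 2 * projLength n Q R a * (dirKernel n Q R a b + projLength n R Q b) := fun b => by
    rw [hτ, dirKernel_add_projLength]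
    ring
  have bg' := bddMeas_projLength n R Q hQ
  have bH' := bddMeas_dirKernel_right n hQ h'.proj a
  have c1 := bH'.pow 2
  have c2 : BddMeas fun _ : E => projLength n Q R a ^ 2 := BddMeas.const _
  have c3 := bg'.pow 2
  have c4 := (bH'.mul bg').const_mul 2
  have c5 := (bH'.add bg').const_mul (2 * projLength n Q R a)
  simp_rw [e]
  rw [integral_add ((((c1.add c2).add c3).add c4).integrable _) (c5.integrable _),
    integral_add (((c1.add c2).add c3).integrable _) (c4.integrable _),
    integral_add ((c1.add c2).integrable _) (c3.integrable _),
    integral_add (c1.integrable _) (c2.integrable _), integral_const_mul, integral_const_mul,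
    integral_add (bH'.integrable _) (bg'.integrable _),
    h'.integral_dirKernel_right hQ, h'.integral_projLength hQ]
  simp

/-- The second moment of the kernel, from the orthogonality of the Hoeffding decomposition. -/
lemma integral_dirKernel_sq (h : IsIsotropic γ Q n) (h' : IsIsotropic γ' R n) (τ : ℝ)
    (hτ : τ = LinearMap.trace ℝ E (Q * R) / n) :
    ∫ a, ∫ b, dirKernel n Q R a b ^ 2 ∂γ' ∂γ
      = 3 * n / (n + 2) * (∫ a, projLength n Q R a ^ 2 ∂γ + τ ^ 2) - τ ^ 2
        - ∫ a, projLength n Q R a ^ 2 ∂γ - ∫ b, projLength n R Q b ^ 2 ∂γ' := by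
  have bH := bddMeas_dirKernel n h.proj h'.proj
  have bg := bddMeas_projLength n Q R h'.proj
  have bg' := bddMeas_projLength n R Q h.proj
  have e3 : ∫ a, ∫ b, dirKernel n Q R a b * projLength n R Q b ∂γ' ∂γ = 0 := by
    rw [integral_integral_swap ((bH.mul (bg'.comp measurable_snd)).integrable _)]
    simp_rw [integral_mul_const, h.integral_dirKernel_left h'.proj]
    simp
  have e4 : ∀ a, ∫ b, dirKernel n Q R a b ^ 2 ∂γ'
      = (3 * n / (n + 2) - 1) * projLength n Q R a ^ 2
        + (2 * τ * (3 * n / (n + 2)) - 2 * τ) * projLength n Q R a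
        + (3 * n / (n + 2) * τ ^ 2 - τ ^ 2 - ∫ b, projLength n R Q b ^ 2 ∂γ')
        - 2 * ∫ b, dirKernel n Q R a b * projLength n R Q b ∂γ' := fun a => by
    have := (h'.integral_sq_inner_sub τ hτ a).symm.trans
      (h'.integral_sq_inner_sub' h.proj τ hτ a)
    linear_combination -this
  simp_rw [e4]
  have d1 := (bg.pow 2).const_mul (3 * n / (n + 2) - 1)
  have d2 := bg.const_mul (2 * τ * (3 * n / (n + 2)) - 2 * τ)
  have d4 := ((bH.mul (bg'.comp measurable_snd)).integral_right γ').const_mul 2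
  rw [integral_sub (((d1.add d2).add (BddMeas.const _)).integrable _) (d4.integrable _),
    integral_add ((d1.add d2).integrable _) (integrable_const _),
    integral_add (d1.integrable _) (d2.integrable _), integral_const_mul, integral_const_mul,
    integral_const_mul, e3, h.integral_projLength h'.proj]
  simp only [integral_const, probReal_univ, one_smul]
  ring

/-- The second moment of the kernel is close to `2`. -/
lemma abs_integral_dirKernel_sq_sub_le (h : IsIsotropic γ Q n) (h' : IsIsotropic γ' R n)
    (hn1 : 1 ≤ n) (hpQ : LinearMap.trace ℝ E (1 - Q) = p) (hpR : LinearMap.trace ℝ E (1 - R) = p) :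
    |∫ a, ∫ b, dirKernel n Q R a b ^ 2 ∂γ' ∂γ - 2| ≤ (6 + 4 * p + 6 * p ^ 2) / n := by
  have hn := h.pos
  have hp0 : 0 ≤ p := by
    rw [← hpQ, ← IsProj.sum_norm_sq (stdOrthonormalBasis ℝ E) (IsProj.one_sub h.proj)]
    exact Finset.sum_nonneg fun t _ => sq_nonneg _
  rw [h.integral_dirKernel_sq h' _ rfl]
  have hτ := h.trace_mul_div_mem h'
  have hτ' : 1 - p / n ≤ LinearMap.trace ℝ E (Q * R) / n := by
    have := IsProj.le_trace_mul h.proj h'.proj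
    rw [hpQ, h'.trace] at this
    rw [le_div_iff₀ hn]
    field_simp
    linarith
  have g1 := h.integral_projLength_sq_le h'.proj hpR
  have g2 := h'.integral_projLength_sq_le h.proj hpQ
  have g10 : 0 ≤ ∫ a, projLength n Q R a ^ 2 ∂γ := integral_nonneg fun _ => sq_nonneg _
  have g20 : 0 ≤ ∫ a, projLength n R Q a ^ 2 ∂γ' := integral_nonneg fun _ => sq_nonneg _
  generalize LinearMap.trace ℝ E (Q * R) / n = τ at *
  generalize ∫ a, projLength n Q R a ^ 2 ∂γ = G at *
  generalize ∫ a, projLength n R Q a ^ 2 ∂γ' = G' at *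
  have hq : 3 * p ^ 2 / n ^ 2 ≤ 3 * p ^ 2 / n := by
    gcongr
    nlinarith
  have hr : 3 * n / (n + 2) = 3 - 6 / (n + 2) := by field_simp; ring
  have hr1 : 6 / (n + 2) ≤ 2 := by rw [div_le_iff₀ (by positivity)]; linarith
  have hr2 : 6 / (n + 2) ≤ 6 / n := by gcongr; linarith
  have hr3 : 0 ≤ 6 / (n + 2) := by positivity
  have e : (6 + 4 * p + 6 * p ^ 2) / n = 6 / n + 4 * (p / n) + 2 * (3 * p ^ 2 / n) := by ring
  rw [e, hr]
  generalize 6 / (n + 2) = u at *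
  generalize 6 / n = w at *
  generalize 3 * p ^ 2 / n = z at *
  have hpn : 0 ≤ p / n := by positivity
  generalize p / n = π at *
  have hsq : 1 - 2 * π ≤ τ ^ 2 := by nlinarith [sq_nonneg (1 - τ), hτ.2]
  have hsq1 : τ ^ 2 ≤ 1 := by nlinarith [hτ.1, hτ.2]
  have hsq0 := sq_nonneg τ
  rw [abs_le]
  constructor
  · nlinarith [mul_nonneg hr3 hsq0, mul_nonneg hr3 g10, mul_nonneg hr3 (sub_nonneg.2 hsq1),
      mul_nonneg (sub_nonneg.2 hr1) g10]
  · nlinarith [mul_nonneg hr3 hsq0, mul_nonneg hr3 g10, mul_nonneg hr3 (sub_nonneg.2 hsq1),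
      mul_nonneg (sub_nonneg.2 hr1) g10]

/-- The conditional covariances of the kernel are governed by the squared inner product of the two
fixed directions, which is of the order `1 / n`. -/
lemma abs_integral_dirKernel_mul_le (h₀ : IsIsotropic γ₀ K n) (hQ : Q.IsSymmetricProjection)
    (hR : R.IsSymmetricProjection) (hpQ : LinearMap.trace ℝ E (1 - Q) = p)
    (hpR : LinearMap.trace ℝ E (1 - R) = p) (hn1 : 1 ≤ n) (a b : E) :
    |∫ c, dirKernel n Q K a c * dirKernel n R K b c ∂γ₀|
      ≤ 2 * inner ℝ (dir Q a) (K (dir R b)) ^ 2 + (2 + 6 * p + 3 * p ^ 2) / n := by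
  have hn := h₀.pos
  have hp0 : 0 ≤ p := by
    rw [← hpQ, ← IsProj.sum_norm_sq (stdOrthonormalBasis ℝ E) (IsProj.one_sub hQ)]
    exact Finset.sum_nonneg fun t _ => sq_nonneg _
  -- the main part of the kernel, for a fixed vector `w`
  let X : E → E → ℝ := fun w c => n * inner ℝ (dir K c) w ^ 2 - ‖K w‖ ^ 2
  have bX : ∀ w, BddMeas (X w) := fun w =>
    (((bddMeas_inner K w).pow 2).const_mul n).sub (BddMeas.const _)
  have hdec : ∀ (S : E →ₗ[ℝ] E) (a c : E),
      dirKernel n S K a c = X (dir S a) c - projLength n K S c := fun S a c => by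
    rw [dirKernel, projLength, real_inner_comm, LinearMap.trace_mul_comm ℝ K S]
    ring
  have hXX : ∀ w w', ∫ c, X w c * X w' c ∂γ₀
      = (2 * n * inner ℝ w (K w') ^ 2 - 2 * (‖K w‖ ^ 2 * ‖K w'‖ ^ 2)) / (n + 2) := fun w w' => by
    have e : ∀ c, X w c * X w' c
        = n ^ 2 * (inner ℝ (dir K c) w ^ 2 * inner ℝ (dir K c) w' ^ 2)
          - n * ‖K w'‖ ^ 2 * inner ℝ (dir K c) w ^ 2 - n * ‖K w‖ ^ 2 * inner ℝ (dir K c) w' ^ 2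
          + ‖K w‖ ^ 2 * ‖K w'‖ ^ 2 := fun c => by simp only [X]; ring
    simp_rw [e]
    have c1 := (((bddMeas_inner K w).pow 2).mul ((bddMeas_inner K w').pow 2)).const_mul (n ^ 2)
    have c2 := ((bddMeas_inner K w).pow 2).const_mul (n * ‖K w'‖ ^ 2)
    have c3 := ((bddMeas_inner K w').pow 2).const_mul (n * ‖K w‖ ^ 2)
    rw [integral_add (((c1.sub c2).sub c3).integrable _) (integrable_const _),
      integral_sub ((c1.sub c2).integrable _) (c3.integrable _),
      integral_sub (c1.integrable _) (c2.integrable _), integral_const_mul, integral_const_mul,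
      integral_const_mul, h₀.integral_inner_sq_mul_inner_sq, h₀.integral_inner_sq,
      h₀.integral_inner_sq, IsProj.inner_apply h₀.proj, IsProj.apply_apply h₀.proj]
    simp only [integral_const, probReal_univ, one_smul]
    field_simp
    ring
  have hK1 : ∀ (S : E →ₗ[ℝ] E) (a : E), ‖K (dir S a)‖ ^ 2 ≤ 1 := fun S a =>
    pow_le_one₀ (norm_nonneg _) ((IsProj.norm_le h₀.proj _).trans (norm_dir_le S a))
  have hX2 : ∀ (S : E →ₗ[ℝ] E) (a : E), ∫ c, X (dir S a) c ^ 2 ∂γ₀ ≤ 2 := fun S a => by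
    have h1 := hXX (dir S a) (dir S a)
    simp_rw [← sq] at h1
    rw [h1, IsProj.inner_self h₀.proj, div_le_iff₀ (by positivity)]
    have h2 := hK1 S a
    have h3 := sq_nonneg ‖K (dir S a)‖
    nlinarith [mul_nonneg h3 (sub_nonneg.2 h2), mul_nonneg hn.le (mul_nonneg h3 (sub_nonneg.2 h2))]
  have hY2 : ∀ (S : E →ₗ[ℝ] E), S.IsSymmetricProjection → LinearMap.trace ℝ E (1 - S) = p →
      ∫ c, projLength n K S c ^ 2 ∂γ₀ ≤ 3 * p ^ 2 / n ^ 2 := fun S hS hp =>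
    h₀.integral_projLength_sq_le hS hp
  have hXY : ∀ (S S' : E →ₗ[ℝ] E) (a : E), S'.IsSymmetricProjection →
      LinearMap.trace ℝ E (1 - S') = p →
      |∫ c, X (dir S a) c * projLength n K S' c ∂γ₀| ≤ 3 * p / n := fun S S' a hS' hp => by
    refine abs_le_of_sq_le_sq ?_ (by positivity)
    refine (sq_integral_mul_le γ₀ (bX _) (bddMeas_projLength n K S' hS')).trans ?_
    calc _ ≤ 2 * (3 * p ^ 2 / n ^ 2) := mul_le_mul (hX2 S a) (hY2 S' hS' hp)
          (integral_nonneg fun _ => sq_nonneg _) (by norm_num)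
      _ ≤ (3 * p / n) ^ 2 := by
          rw [div_pow, mul_div_assoc', div_le_div_iff_of_pos_right (by positivity)]
          nlinarith [sq_nonneg p]
  have hYY : |∫ c, projLength n K Q c * projLength n K R c ∂γ₀| ≤ 3 * p ^ 2 / n := by
    refine abs_le_of_sq_le_sq ?_ (by positivity)
    refine (sq_integral_mul_le γ₀ (bddMeas_projLength n K Q hQ)
      (bddMeas_projLength n K R hR)).trans ?_
    calc _ ≤ 3 * p ^ 2 / n ^ 2 * (3 * p ^ 2 / n ^ 2) :=
          mul_le_mul (hY2 Q hQ hpQ) (hY2 R hR hpR)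
            (integral_nonneg fun _ => sq_nonneg _) (by positivity)
      _ = (3 * p ^ 2 / n ^ 2) ^ 2 := by ring
      _ ≤ (3 * p ^ 2 / n) ^ 2 := by
          gcongr
          nlinarith
  have hmain : |∫ c, X (dir Q a) c * X (dir R b) c ∂γ₀|
      ≤ 2 * inner ℝ (dir Q a) (K (dir R b)) ^ 2 + 2 / n := by
    rw [hXX]
    have h1 := hK1 Q a
    have h2 := hK1 R b
    have h3 : ‖K (dir Q a)‖ ^ 2 * ‖K (dir R b)‖ ^ 2 ≤ 1 := mul_le_one₀ h1 (sq_nonneg _) h2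
    have h4 : 0 ≤ ‖K (dir Q a)‖ ^ 2 * ‖K (dir R b)‖ ^ 2 := by positivity
    have h5 := sq_nonneg (inner ℝ (dir Q a) (K (dir R b)))
    generalize ‖K (dir Q a)‖ ^ 2 * ‖K (dir R b)‖ ^ 2 = q at *
    generalize inner ℝ (dir Q a) (K (dir R b)) ^ 2 = r at *
    have e1 : (2 * n * r - 2 * q) / (n + 2) = 2 * r * (n / (n + 2)) - 2 * q / (n + 2) := by ring
    have e2 : n / (n + 2) ≤ 1 := by rw [div_le_one (by positivity)]; linarith
    have e3 : 0 ≤ n / (n + 2) := by positivity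
    have e4 : 2 * q / (n + 2) ≤ 2 / n := by gcongr <;> linarith
    have e5 : 0 ≤ 2 * q / (n + 2) := by positivity
    have e6 : 0 ≤ 2 / n := by positivity
    rw [e1, abs_le]
    constructor
    · nlinarith [mul_nonneg h5 e3]
    · nlinarith [mul_nonneg h5 (sub_nonneg.2 e2)]
  have bQ := bddMeas_projLength n K Q hQ
  have bR := bddMeas_projLength n K R hR
  have e : ∀ c, dirKernel n Q K a c * dirKernel n R K b c
      = X (dir Q a) c * X (dir R b) c - X (dir Q a) c * projLength n K R c
        - X (dir R b) c * projLength n K Q c + projLength n K Q c * projLength n K R c :=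
    fun c => by rw [hdec, hdec]; ring
  simp_rw [e]
  have c1 := (bX (dir Q a)).mul (bX (dir R b))
  have c2 := (bX (dir Q a)).mul bR
  have c3 := (bX (dir R b)).mul bQ
  have c4 := bQ.mul bR
  rw [integral_add (((c1.sub c2).sub c3).integrable _) (c4.integrable _),
    integral_sub ((c1.sub c2).integrable _) (c3.integrable _),
    integral_sub (c1.integrable _) (c2.integrable _)]
  have k1 := hXY Q R a hR hpR
  have k2 := hXY R Q b hQ hpQ
  have e9 : (2 + 6 * p + 3 * p ^ 2) / n = 2 / n + 2 * (3 * p / n) + 3 * p ^ 2 / n := by ring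
  rw [e9]
  rw [abs_le] at *
  constructor <;> linarith [k1.1, k1.2, k2.1, k2.2, hYY.1, hYY.2, hmain.1, hmain.2]

/-- The conditional covariances of the kernel are small in mean square. -/
lemma integral_sq_integral_dirKernel_mul_le (h₀ : IsIsotropic γ₀ K n) (h : IsIsotropic γ Q n)
    (h' : IsIsotropic γ' R n) (hpQ : LinearMap.trace ℝ E (1 - Q) = p)
    (hpR : LinearMap.trace ℝ E (1 - R) = p) (hn1 : 1 ≤ n) :
    ∫ a, ∫ b, (∫ c, dirKernel n Q K a c * dirKernel n R K b c ∂γ₀) ^ 2 ∂γ' ∂γ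
      ≤ (24 + 2 * (2 + 6 * p + 3 * p ^ 2) ^ 2) / n ^ 2 := by
  have hn := h.pos
  have bG : BddMeas fun q : E × E => ∫ c, dirKernel n Q K q.1 c * dirKernel n R K q.2 c ∂γ₀ :=
    (((bddMeas_dirKernel n h.proj h₀.proj).comp
      (by fun_prop : Measurable fun q : (E × E) × E => (q.1.1, q.2))).mul
      ((bddMeas_dirKernel n h'.proj h₀.proj).comp
      (by fun_prop : Measurable fun q : (E × E) × E => (q.1.2, q.2)))).integral_right γ₀
  have h1 : ∀ b, ∫ a, (∫ c, dirKernel n Q K a c * dirKernel n R K b c ∂γ₀) ^ 2 ∂γ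
      ≤ (24 + 2 * (2 + 6 * p + 3 * p ^ 2) ^ 2) / n ^ 2 := fun b => by
    have b4 := ((bddMeas_inner Q (K (dir R b))).pow 4).const_mul 8
    calc _ ≤ ∫ a, (8 * inner ℝ (dir Q a) (K (dir R b)) ^ 4
            + 2 * ((2 + 6 * p + 3 * p ^ 2) / n) ^ 2) ∂γ := by
          refine integral_mono (((bG.pow 2).comp
            (by fun_prop : Measurable fun a : E => (a, b))).integrable _)
            ((b4.add (BddMeas.const _)).integrable _) fun a => ?_
          have hk := h₀.abs_integral_dirKernel_mul_le h.proj h'.proj hpQ hpR hn1 a b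
          dsimp only
          rw [← sq_abs]
          refine (pow_le_pow_left₀ (abs_nonneg _) hk 2).trans ?_
          nlinarith [sq_nonneg (2 * inner ℝ (dir Q a) (K (dir R b)) ^ 2
            - (2 + 6 * p + 3 * p ^ 2) / n)]
      _ = 8 * (3 * ‖Q (K (dir R b))‖ ^ 4 / (n * (n + 2)))
            + 2 * ((2 + 6 * p + 3 * p ^ 2) / n) ^ 2 := by
          rw [integral_add (b4.integrable _) (integrable_const _), integral_const_mul,
            h.integral_inner_pow_four]
          simp
      _ ≤ 8 * (3 / n ^ 2) + 2 * ((2 + 6 * p + 3 * p ^ 2) / n) ^ 2 := by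
          have : ‖Q (K (dir R b))‖ ^ 4 ≤ 1 := pow_le_one₀ (norm_nonneg _)
            ((IsProj.norm_le h.proj _).trans
              ((IsProj.norm_le h₀.proj _).trans (norm_dir_le R b)))
          gcongr
          · linarith
          · nlinarith
      _ = _ := by ring
  rw [integral_integral_swap ((bG.pow 2).integrable _)]
  calc _ ≤ ∫ _, (24 + 2 * (2 + 6 * p + 3 * p ^ 2) ^ 2) / n ^ 2 ∂γ' :=
        integral_mono (((bG.pow 2).comp measurable_swap).integral_right γ |>.integrable _)
          (integrable_const _) h1
    _ = _ := by simp

end IsIsotropic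

end

/-! ### Normal approximation for sums of squared correlations -/

section Approximation

/-- The second moment of a sum of independent centred variables. -/
lemma integral_sq_sum_eval {N : ℕ} {α : Type*} [MeasurableSpace α] {ν : Fin N → Measure α}
    [∀ i, IsProbabilityMeasure (ν i)] {f : Fin N → α → ℝ} (hf : ∀ i, BddMeas (f i))
    (h0 : ∀ i, ∫ a, f i a ∂(ν i) = 0) :
    ∫ x, (∑ i, f i (x i)) ^ 2 ∂(Measure.pi ν) = ∑ i, ∫ a, f i a ^ 2 ∂(ν i) := by
  have hb : ∀ i, BddMeas fun x : Fin N → α => f i (x i) := fun i =>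
    (hf i).comp (measurable_pi_apply i)
  simp_rw [sq (∑ i, f i _), Finset.sum_mul_sum]
  rw [integral_finsetSum _ fun i _ => (BddMeas.sum _ fun j _ => (hb i).mul (hb j)).integrable _]
  refine Finset.sum_congr rfl fun i _ => ?_
  rw [integral_finsetSum _ fun j _ => ((hb i).mul (hb j)).integrable _,
    Finset.sum_eq_single_of_mem i (Finset.mem_univ i) fun j _ hj => ?_]
  · simp_rw [← sq]
    exact integral_pi_eval ν i ((hf i).pow 2)
  · rw [integral_pi_eval₂ ν hj.symm (f := fun q : α × α => f i q.1 * f j q.2)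
      (((hf i).comp measurable_fst).mul ((hf j).comp measurable_snd))]
    simp [integral_const_mul, h0]

lemma sum_pairs_add {N : ℕ} (f : Fin N → Fin N → ℝ) :
    ∑ q : Fin N × Fin N with q.1 < q.2, (f q.1 q.2 + f q.2 q.1)
      = ∑ i, ∑ j ∈ Finset.univ.erase i, f i j := by
  rw [Finset.sum_add_distrib, ← sum_Ioi_eq_sum_pairs, ← sum_Iio_eq_sum_pairs fun i k => f k i,
    ← Finset.sum_add_distrib]
  refine Finset.sum_congr rfl fun i _ => ?_
  rw [← Finset.sum_union]
  · congr 1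
    ext j
    simp [lt_or_lt_iff_ne, eq_comm]
  · rw [Finset.disjoint_left]
    intro j hj hj'
    simp only [Finset.mem_Ioi, Finset.mem_Iio] at hj hj'
    exact lt_asymm hj hj'

variable {N : ℕ} {E : Type*} [NormedAddCommGroup E] [InnerProductSpace ℝ E]
  [FiniteDimensional ℝ E] [MeasurableSpace E] [BorelSpace E] {ν : Fin N → Measure E}
  [∀ i, IsProbabilityMeasure (ν i)] {Q : Fin N → E →ₗ[ℝ] E} {n p : ℝ} {v : Fin N → Fin N → ℝ}

lemma isDegenerate_dirKernel (hν : ∀ i, IsIsotropic (ν i) (Q i) n) (v : Fin N → Fin N → ℝ) :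
    IsDegenerate ν fun i j a b => (v i j)⁻¹ * dirKernel n (Q i) (Q j) a b where
  bddMeas i j := (bddMeas_dirKernel n (hν i).proj (hν j).proj).const_mul _
  left i j b := by rw [integral_const_mul, (hν i).integral_dirKernel_left (hν j).proj, mul_zero]
  right i j a := by rw [integral_const_mul, (hν j).integral_dirKernel_right (hν i).proj, mul_zero]

/-- The linear part of the statistic is negligible if `N / n²` is small. -/
lemma integral_sq_sum_projLength_le (hν : ∀ i, IsIsotropic (ν i) (Q i) n)
    (hQp : ∀ i, LinearMap.trace ℝ E (1 - Q i) = p) (hN : 2 ≤ N) (hv : ∀ i j, 1 ≤ v i j) :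
    ∫ x, (√(2 / ((N : ℝ) * (N - 1))) * ∑ i, ∑ j ∈ Finset.univ.erase i,
      (v i j)⁻¹ * projLength n (Q i) (Q j) (x i)) ^ 2 ∂(Measure.pi ν)
      ≤ 12 * p ^ 2 * (N / n ^ 2) := by
  have hb : ∀ i j, BddMeas fun a => (v i j)⁻¹ * projLength n (Q i) (Q j) a := fun i j =>
    (bddMeas_projLength n (Q i) (Q j) (hν j).proj).const_mul _
  have hF : ∀ i, BddMeas fun a => ∑ j ∈ Finset.univ.erase i,
      (v i j)⁻¹ * projLength n (Q i) (Q j) a := fun i => BddMeas.sum _ fun j _ => hb i j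
  have hvi : ∀ i j, (v i j)⁻¹ ^ 2 ≤ 1 := fun i j =>
    pow_le_one₀ (inv_nonneg.2 (zero_le_one.trans (hv i j))) (inv_le_one_of_one_le₀ (hv i j))
  have h1 : ∀ i j, ∫ a, ((v i j)⁻¹ * projLength n (Q i) (Q j) a) ^ 2 ∂(ν i)
      ≤ 3 * p ^ 2 / n ^ 2 := fun i j => by
    simp_rw [mul_pow]
    rw [integral_const_mul]
    refine (mul_le_of_le_one_left (integral_nonneg fun _ => sq_nonneg _) (hvi i j)).trans ?_
    exact (hν i).integral_projLength_sq_le (hν j).proj (hQp j)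
  have h2 : ∀ i, ∫ a, (∑ j ∈ Finset.univ.erase i, (v i j)⁻¹ * projLength n (Q i) (Q j) a) ^ 2 ∂(ν i)
      ≤ (N : ℝ) ^ 2 * (3 * p ^ 2 / n ^ 2) := fun i => by
    calc _ ≤ ∫ a, ((N : ℝ) * ∑ j, ((v i j)⁻¹ * projLength n (Q i) (Q j) a) ^ 2) ∂(ν i) := by
          refine integral_mono (((hF i).pow 2).integrable _)
            (((BddMeas.sum _ fun j _ => (hb i j).pow 2).const_mul _).integrable _) fun a => ?_
          refine sq_sum_le_card_mul_sum_sq.trans ?_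
          have hc : ((Finset.univ.erase i).card : ℝ) ≤ N := by
            exact_mod_cast (Finset.card_le_univ _).trans_eq (Fintype.card_fin N)
          refine mul_le_mul hc (Finset.sum_le_sum_of_subset_of_nonneg (Finset.erase_subset _ _)
            fun _ _ _ => sq_nonneg _) (Finset.sum_nonneg fun _ _ => sq_nonneg _) (by positivity)
      _ ≤ (N : ℝ) * ∑ j : Fin N, 3 * p ^ 2 / n ^ 2 := by
          rw [integral_const_mul, integral_finsetSum _ fun j _ => ((hb i j).pow 2).integrable _]
          gcongr with j
          exact h1 i j
      _ = _ := by simp; ring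
  simp_rw [mul_pow]
  rw [integral_const_mul, integral_sq_sum_eval hF fun i => ?_]
  · have hN0 : (0 : ℝ) < N := by exact_mod_cast (by omega : 0 < N)
    calc _ ≤ 4 / (N : ℝ) ^ 2 * ∑ i : Fin N, (N : ℝ) ^ 2 * (3 * p ^ 2 / n ^ 2) := by
          refine mul_le_mul (IsDegenerate.sq_scale_le hN) (Finset.sum_le_sum fun i _ => h2 i)
            (Finset.sum_nonneg fun i _ => integral_nonneg fun _ => sq_nonneg _) (by positivity)
      _ = _ := by simp; field_simp; ring
  · rw [integral_finsetSum _ fun j _ => (hb i j).integrable _]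
    refine Finset.sum_eq_zero fun j _ => ?_
    rw [integral_const_mul, (hν i).integral_projLength (hν j).proj, mul_zero]

/-- A quantitative central limit theorem for the sum of the centred squared correlations of
independent isotropic directions. -/
theorem norm_integral_exp_sub_le (hν : ∀ i, IsIsotropic (ν i) (Q i) n)
    (hQp : ∀ i, LinearMap.trace ℝ E (1 - Q i) = p) (hN : 2 ≤ N) (hn : 1 ≤ n)
    (hv : ∀ i j, 1 ≤ v i j) (hvs : ∀ i j, v i j = v j i) {κ : ℝ}
    (hv2 : ∀ i j, |v i j ^ 2 - 2| ≤ κ / n) (t : ℝ) :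
    ‖∫ x, Complex.exp ((t * (√(2 / ((N : ℝ) * (N - 1))) * ∑ i, ∑ j ∈ Finset.Ioi i,
        (n * inner ℝ (dir (Q i) (x i)) (dir (Q j) (x j)) ^ 2
          - LinearMap.trace ℝ E (Q i * Q j) / n) / v i j) : ℝ) * Complex.I) ∂(Measure.pi ν)
      - (Real.exp (-(t ^ 2 / 2)) : ℂ)‖
      ≤ charFunBound t N 968 ((6 + 4 * p + 6 * p ^ 2 + κ) / n)
          ((24 + 2 * (2 + 6 * p + 3 * p ^ 2) ^ 2) / n ^ 2) + |t| * √(12 * p ^ 2 * (N / n ^ 2)) := by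
  have hn0 : 0 < n := by linarith
  have hvi0 : ∀ i j, 0 ≤ (v i j)⁻¹ := fun i j => inv_nonneg.2 (zero_le_one.trans (hv i j))
  have hvi1 : ∀ i j, (v i j)⁻¹ ≤ 1 := fun i j => inv_le_one_of_one_le₀ (hv i j)
  have hh := isDegenerate_dirKernel hν v
  set c := √(2 / ((N : ℝ) * (N - 1))) with hc
  let U : (Fin N → E) → ℝ := fun x => c * ∑ q : Fin N × Fin N with q.1 < q.2,
    (v q.1 q.2)⁻¹ * dirKernel n (Q q.1) (Q q.2) (x q.1) (x q.2)
  let R : (Fin N → E) → ℝ := fun x => c * ∑ i, ∑ j ∈ Finset.univ.erase i,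
    (v i j)⁻¹ * projLength n (Q i) (Q j) (x i)
  have hU : BddMeas U := (BddMeas.sum _ fun q _ => hh.bddMeas_eval q.1 q.2).const_mul c
  have hR : BddMeas R := (BddMeas.sum _ fun i _ => BddMeas.sum _ fun j _ =>
    ((bddMeas_projLength n (Q i) (Q j) (hν j).proj).comp
      (measurable_pi_apply i)).const_mul _).const_mul c
  have hdec : ∀ x : Fin N → E, c * ∑ i, ∑ j ∈ Finset.Ioi i,
      (n * inner ℝ (dir (Q i) (x i)) (dir (Q j) (x j)) ^ 2
        - LinearMap.trace ℝ E (Q i * Q j) / n) / v i j = U x + R x := fun x => by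
    simp only [U, R]
    rw [sum_Ioi_eq_sum_pairs fun i j => (n * inner ℝ (dir (Q i) (x i)) (dir (Q j) (x j)) ^ 2
        - LinearMap.trace ℝ E (Q i * Q j) / n) / v i j,
      ← sum_pairs_add fun i j => (v i j)⁻¹ * projLength n (Q i) (Q j) (x i), ← mul_add,
      ← Finset.sum_add_distrib]
    congr 1
    refine Finset.sum_congr rfl fun q _ => ?_
    rw [dirKernel_add_projLength, hvs q.2 q.1]
    ring
  have hfourth : ∀ i k, i ≠ k → ∫ a, ∫ b, ((v i k)⁻¹ * dirKernel n (Q i) (Q k) a b) ^ 4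
      ∂(ν k) ∂(ν i) ≤ 968 := fun i k _ => by
    simp_rw [mul_pow, integral_const_mul]
    refine (mul_le_of_le_one_left (integral_nonneg fun a => integral_nonneg fun b => by positivity)
      (pow_le_one₀ (hvi0 i k) (hvi1 i k))).trans ?_
    exact (hν i).integral_dirKernel_pow_four_le (hν k)
  have hsecond : ∀ i k, i < k → |∫ a, ∫ b, ((v i k)⁻¹ * dirKernel n (Q i) (Q k) a b) ^ 2
      ∂(ν k) ∂(ν i) - 1| ≤ (6 + 4 * p + 6 * p ^ 2 + κ) / n := fun i k _ => by
    simp_rw [mul_pow, integral_const_mul]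
    have h1 := (hν i).abs_integral_dirKernel_sq_sub_le (hν k) hn (hQp i) (hQp k)
    have h2 := hv2 i k
    generalize ∫ a, ∫ b, dirKernel n (Q i) (Q k) a b ^ 2 ∂(ν k) ∂(ν i) = S at *
    have hv0 : v i k ≠ 0 := by linarith [hv i k]
    have e : (v i k)⁻¹ ^ 2 * S - 1 = (v i k)⁻¹ ^ 2 * (S - v i k ^ 2) := by field_simp
    rw [e, abs_mul, abs_of_nonneg (sq_nonneg _)]
    refine (mul_le_of_le_one_left (abs_nonneg _) (pow_le_one₀ (hvi0 i k) (hvi1 i k))).trans ?_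
    rw [add_div _ κ]
    rw [abs_le] at *
    constructor <;> linarith [h1.1, h1.2, h2.1, h2.2]
  have hcov : ∀ k i l, i < l → l < k → ∫ a, ∫ b, IsDegenerate.condCov ν
      (fun i j a b => (v i j)⁻¹ * dirKernel n (Q i) (Q j) a b) k i l a b ^ 2 ∂(ν l) ∂(ν i)
      ≤ (24 + 2 * (2 + 6 * p + 3 * p ^ 2) ^ 2) / n ^ 2 := fun k i l _ _ => by
    have e : ∀ a b, IsDegenerate.condCov ν
        (fun i j a b => (v i j)⁻¹ * dirKernel n (Q i) (Q j) a b) k i l a b ^ 2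
        = ((v i k)⁻¹ * (v l k)⁻¹) ^ 2
          * (∫ c, dirKernel n (Q i) (Q k) a c * dirKernel n (Q l) (Q k) b c ∂(ν k)) ^ 2 :=
      fun a b => by
        rw [← mul_pow, ← integral_const_mul]
        unfold IsDegenerate.condCov
        congr 2
        ext c
        ring
    simp_rw [e, integral_const_mul]
    refine (mul_le_of_le_one_left (integral_nonneg fun a => integral_nonneg fun b => by positivity)
      (pow_le_one₀ (mul_nonneg (hvi0 i k) (hvi0 l k))
        (mul_le_one₀ (hvi1 i k) (hvi0 l k) (hvi1 l k)))).trans ?_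
    exact (hν k).integral_sq_integral_dirKernel_mul_le (hν i) (hν l) (hQp i) (hQp l) hn
  have hp0 : 0 ≤ p := by
    have i : Fin N := ⟨0, by omega⟩
    rw [← hQp i, ← IsProj.sum_norm_sq (stdOrthonormalBasis ℝ E) (IsProj.one_sub (hν i).proj)]
    exact Finset.sum_nonneg fun t _ => sq_nonneg _
  have hmain := hh.norm_integral_exp_sub_le hN (by norm_num) (by positivity) hfourth hsecond hcov t
  have hR2 : ∫ x, R x ^ 2 ∂(Measure.pi ν) ≤ 12 * p ^ 2 * (N / n ^ 2) :=
    integral_sq_sum_projLength_le hν hQp hN hv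
  have hR1 : ∫ x, |R x| ∂(Measure.pi ν) ≤ √(12 * p ^ 2 * (N / n ^ 2)) := by
    refine Real.le_sqrt_of_sq_le ((sq_integral_le _ hR.abs).trans ?_)
    simpa only [sq_abs] using hR2
  have hmeas : ∀ f : (Fin N → E) → ℝ, Measurable f →
      Integrable (fun x => Complex.exp ((t * f x : ℝ) * Complex.I)) (Measure.pi ν) := fun f hf =>
    integrable_of_norm_le (by fun_prop) 1 fun x => by rw [Complex.norm_exp_ofReal_mul_I]
  simp_rw [hdec]
  -- replacing `U + R` by `U` costs at most `|t| ∫ |R|`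
  calc _ = ‖(∫ x, (Complex.exp ((t * (U x + R x) : ℝ) * Complex.I)
          - Complex.exp ((t * U x : ℝ) * Complex.I)) ∂(Measure.pi ν))
          + (∫ x, Complex.exp ((t * U x : ℝ) * Complex.I) ∂(Measure.pi ν)
            - (Real.exp (-(t ^ 2 / 2)) : ℂ))‖ := by
        rw [integral_sub (hmeas (fun x => U x + R x) (hU.meas.add hR.meas)) (hmeas _ hU.meas)]
        congr 1
        ring
    _ ≤ ∫ x, |t| * |R x| ∂(Measure.pi ν) + charFunBound t N 968 ((6 + 4 * p + 6 * p ^ 2 + κ) / n)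
          ((24 + 2 * (2 + 6 * p + 3 * p ^ 2) ^ 2) / n ^ 2) := by
        refine (norm_add_le _ _).trans (add_le_add ?_ hmain)
        refine norm_integral_le_of_norm_le ((hR.abs.const_mul _).integrable _)
          (Eventually.of_forall fun x => ?_)
        refine (norm_exp_mul_I_sub_exp_mul_I_le _ _).trans_eq ?_
        rw [← abs_mul]
        congr 1
        ring
    _ ≤ _ := by
        rw [integral_const_mul, add_comm]
        gcongr

end Approximation

/-! ### The panel regression model -/

section Panel

variable {T p : ℕ}

/-- The projection onto the orthogonal complement of the column space of the design matrix, as a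
linear map of Euclidean space. -/
noncomputable def residualMap (x : Matrix (Fin T) (Fin p) ℝ) :
    EuclideanSpace ℝ (Fin T) →ₗ[ℝ] EuclideanSpace ℝ (Fin T) :=
  Matrix.toEuclideanLin (residualProj x)

lemma trace_toEuclideanLin (A : Matrix (Fin T) (Fin T) ℝ) :
    LinearMap.trace ℝ (EuclideanSpace ℝ (Fin T)) (Matrix.toEuclideanLin A) = A.trace := by
  rw [Matrix.toEuclideanLin_eq_toLin_orthonormal, Matrix.trace_toLin_eq]

variable {x x' : Matrix (Fin T) (Fin p) ℝ}

lemma trace_residualMap_mul :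
    LinearMap.trace ℝ (EuclideanSpace ℝ (Fin T)) (residualMap x * residualMap x')
      = (residualProj x * residualProj x').trace := by
  rw [← trace_toEuclideanLin, Matrix.toLpLin_mul_same]
  rfl

lemma trace_residualMap_mul_sq :
    LinearMap.trace ℝ (EuclideanSpace ℝ (Fin T))
        ((residualMap x * residualMap x') ^ 2)
      = ((residualProj x * residualProj x') ^ 2).trace := by
  rw [← trace_toEuclideanLin, Matrix.toLpLin_pow, Matrix.toLpLin_mul_same]
  rfl

lemma isSymmetricProjection_residualMap (hx : IsUnit (xᵀ * x)) :
    (residualMap x).IsSymmetricProjection := by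
  have hdet := (Matrix.isUnit_iff_isUnit_det _).1 hx
  constructor
  · have h : residualProj x * residualProj x = residualProj x := by
      have e : x * (xᵀ * x)⁻¹ * xᵀ * (x * (xᵀ * x)⁻¹ * xᵀ) = x * (xᵀ * x)⁻¹ * xᵀ := by
        calc _ = x * ((xᵀ * x)⁻¹ * (xᵀ * x)) * (xᵀ * x)⁻¹ * xᵀ := by
              simp only [Matrix.mul_assoc]
          _ = _ := by rw [Matrix.nonsing_inv_mul _ hdet, Matrix.mul_one]
      rw [residualProj, Matrix.sub_mul, Matrix.mul_sub, Matrix.mul_sub, Matrix.one_mul,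
        Matrix.mul_one, Matrix.one_mul, e]
      simp
    rw [IsIdempotentElem, residualMap, Module.End.mul_eq_comp, ← Matrix.toLpLin_mul_same, h]
  · rw [residualMap, Matrix.isSymmetric_toEuclideanLin_iff, Matrix.IsHermitian,
      Matrix.conjTranspose_eq_transpose_of_trivial, residualProj]
    simp [Matrix.transpose_nonsing_inv, Matrix.mul_assoc]

lemma trace_residualMap (hx : IsUnit (xᵀ * x)) :
    LinearMap.trace ℝ (EuclideanSpace ℝ (Fin T)) (residualMap x) = (T : ℝ) - p := by
  have hdet := (Matrix.isUnit_iff_isUnit_det _).1 hx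
  rw [residualMap, trace_toEuclideanLin, residualProj, Matrix.trace_sub, Matrix.mul_assoc,
    Matrix.trace_mul_comm, Matrix.mul_assoc, Matrix.nonsing_inv_mul _ hdet]
  simp

lemma trace_one_sub_residualMap (hx : IsUnit (xᵀ * x)) :
    LinearMap.trace ℝ (EuclideanSpace ℝ (Fin T)) (1 - residualMap x) = p := by
  rw [map_sub, trace_residualMap hx, LinearMap.trace_one]
  simp

lemma olsResidual_add (hx : IsUnit (xᵀ * x)) (b : Fin p → ℝ) (e : Fin T → ℝ) :
    olsResidual x (fun t => (x *ᵥ b) t + e t) = residualProj x *ᵥ e := by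
  have hdet := (Matrix.isUnit_iff_isUnit_det _).1 hx
  have h : (fun t => (x *ᵥ b) t + e t) = x *ᵥ b + e := rfl
  have h2 : (xᵀ * x)⁻¹ *ᵥ (xᵀ *ᵥ (x *ᵥ b)) = b := by
    rw [Matrix.mulVec_mulVec, Matrix.mulVec_mulVec, Matrix.mul_assoc,
      Matrix.nonsing_inv_mul _ hdet, Matrix.one_mulVec]
  rw [h, olsResidual, olsEstimator, Matrix.mulVec_add, Matrix.mulVec_add, h2, Matrix.mulVec_add,
    residualProj, Matrix.sub_mulVec, Matrix.one_mulVec]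
  simp only [Matrix.mulVec_mulVec, Matrix.mul_assoc]
  abel

lemma sampleCorr_eq_inner (u v : EuclideanSpace ℝ (Fin T)) :
    sampleCorr u.ofLp v.ofLp = inner ℝ (‖u‖⁻¹ • u) (‖v‖⁻¹ • v) := by
  rw [real_inner_smul_left, real_inner_smul_right, sampleCorr, Real.sqrt_mul
    (Finset.sum_nonneg fun _ _ => sq_nonneg _), EuclideanSpace.norm_eq, EuclideanSpace.norm_eq,
    PiLp.inner_apply]
  simp only [Real.norm_eq_abs, sq_abs, RCLike.inner_apply, conj_trivial]
  rw [div_eq_mul_inv, mul_inv]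
  simp_rw [mul_comm (v.ofLp _)]
  ring

variable {N : ℕ} {X : Fin N → Matrix (Fin T) (Fin p) ℝ}

/-- The statistic depends on the errors only through the directions of their projections. If a
residual vector vanishes, its correlations and its direction are zero by convention, so that the
identity needs no exception. -/
lemma lmAdj_eq (hX : ∀ i, IsUnit ((X i)ᵀ * X i)) (β : Fin N → Fin p → ℝ)
    (e : Fin N → EuclideanSpace ℝ (Fin T)) :
    lmAdj X (fun i t => (X i *ᵥ β i) t + e i t)
      = √(2 / ((N : ℝ) * (N - 1))) * ∑ i, ∑ j ∈ Finset.Ioi i,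
        (((T : ℝ) - p) * inner ℝ (dir (residualMap (X i)) (e i)) (dir (residualMap (X j)) (e j)) ^ 2
          - LinearMap.trace ℝ (EuclideanSpace ℝ (Fin T)) (residualMap (X i) * residualMap (X j))
            / ((T : ℝ) - p)) / vAdj X i j := by
  unfold lmAdj
  refine congrArg _ (Finset.sum_congr rfl fun i _ => Finset.sum_congr rfl fun j _ => ?_)
  rw [trace_residualMap_mul, muAdj, rhoHat, olsResidual_add (hX i), olsResidual_add (hX j)]
  rw [show sampleCorr (residualProj (X i) *ᵥ (e i).ofLp) (residualProj (X j) *ᵥ (e j).ofLp)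
    = inner ℝ (dir (residualMap (X i)) (e i)) (dir (residualMap (X j)) (e j)) from
    sampleCorr_eq_inner (residualMap (X i) (e i)) (residualMap (X j) (e j))]
  congr 2
  ring

lemma measurable_lmAdj (hX : ∀ i, IsUnit ((X i)ᵀ * X i)) (β : Fin N → Fin p → ℝ) :
    Measurable fun e : Fin N → EuclideanSpace ℝ (Fin T) =>
      lmAdj X (fun i t => (X i *ᵥ β i) t + e i t) := by
  simp_rw [lmAdj_eq hX]
  have h : ∀ i, Measurable fun e : Fin N → EuclideanSpace ℝ (Fin T) =>
      dir (residualMap (X i)) (e i) := fun i => (measurable_dir _).comp (measurable_pi_apply i)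
  refine measurable_const.mul (Finset.measurable_sum _ fun i _ => Finset.measurable_sum _
    fun j _ => ?_)
  have hi := h i
  have hj := h j
  fun_prop

/-- The coefficient `a_{2N}` is `3 / (n + 2)²` with `n = T - p`. -/
lemma a2_eq (h : 4 < (T : ℝ) - p) : a2 T p = 3 / ((T : ℝ) - p + 2) ^ 2 := by
  unfold a2
  generalize (T : ℝ) - p = n at *
  have h2 : n - 2 ≠ 0 := by linarith
  have h4 : n - 4 ≠ 0 := by linarith
  have h6 : n + 2 ≠ 0 := by linarith
  have e : (n - 8) * (n + 2) + 24 = (n - 2) * (n - 4) := by ring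
  rw [e]
  field_simp

lemma vAdj_comm (i j : Fin N) : vAdj X i j = vAdj X j i := by
  have h : ((residualProj (X i) * residualProj (X j)) ^ 2).trace
      = ((residualProj (X j) * residualProj (X i)) ^ 2).trace := by
    rw [sq, sq, Matrix.mul_assoc, Matrix.trace_mul_comm, Matrix.mul_assoc, Matrix.mul_assoc,
      Matrix.mul_assoc]
  rw [vAdj, vAdj, h, Matrix.trace_mul_comm (residualProj (X i))]

/-- The scaling is nearly `√2`. -/
lemma abs_vAdj_sq_sub_le (hX : ∀ i, IsUnit ((X i)ᵀ * X i)) (h : 12 + 4 * (p : ℝ) ≤ (T : ℝ) - p)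
    (i j : Fin N) : 1 ≤ vAdj X i j ∧ |vAdj X i j ^ 2 - 2| ≤ (12 + 4 * p) / ((T : ℝ) - p) := by
  have hi := isSymmetricProjection_residualMap (hX i)
  have hj := isSymmetricProjection_residualMap (hX j)
  have hp0 : (0 : ℝ) ≤ p := Nat.cast_nonneg p
  have t1 := IsProj.trace_mul_le hi hj
  have t2 := IsProj.le_trace_mul hi hj
  have t3 := IsProj.trace_mul_sq_nonneg hi hj
  have t4 := IsProj.trace_mul_sq_le hi hj
  rw [trace_residualMap_mul] at t1 t2
  rw [trace_residualMap_mul_sq] at t3 t4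
  rw [trace_residualMap (hX j)] at t1 t2 t4
  rw [trace_one_sub_residualMap (hX i)] at t2
  have key : |(a1 T p * (residualProj (X i) * residualProj (X j)).trace ^ 2 +
      2 * a2 T p * ((residualProj (X i) * residualProj (X j)) ^ 2).trace) - 2|
      ≤ (12 + 4 * p) / ((T : ℝ) - p) := by
    rw [a1, a2_eq (by linarith)]
    generalize (residualProj (X i) * residualProj (X j)).trace = τ at *
    generalize ((residualProj (X i) * residualProj (X j)) ^ 2).trace = s at *
    generalize (T : ℝ) - p = n at *
    generalize (p : ℝ) = q at *
    have hn : 0 < n := by linarith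
    have hr : 3 / (n + 2) ^ 2 ≤ 3 / n ^ 2 := by gcongr; linarith
    have hτ0 : 0 ≤ τ := by linarith
    have hτ2 : τ ^ 2 ≤ n ^ 2 := pow_le_pow_left₀ hτ0 t1 2
    have hτ3 : n ^ 2 - 2 * q * n ≤ τ ^ 2 := by nlinarith
    have hs : 2 * (3 / (n + 2) ^ 2) * s ≤ 6 / n := by
      calc _ ≤ 2 * (3 / n ^ 2) * n := by gcongr
        _ = 6 / n := by field_simp; norm_num
    have hs0 : 0 ≤ 2 * (3 / (n + 2) ^ 2) * s := by positivity
    have hu : 3 / (n + 2) ^ 2 - 1 / n ^ 2 ≤ 2 / n ^ 2 := by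
      rw [show 2 / n ^ 2 = 3 / n ^ 2 - 1 / n ^ 2 by ring]
      linarith
    have hl : (2 - 12 / n) / n ^ 2 ≤ 3 / (n + 2) ^ 2 - 1 / n ^ 2 := by
      have : (3 - 12 / n) / n ^ 2 ≤ 3 / (n + 2) ^ 2 := by
        rw [div_le_div_iff₀ (by positivity) (by positivity)]
        have e : (3 - 12 / n) * (n + 2) ^ 2 = 3 * n ^ 2 - 36 - 48 / n := by field_simp; ring
        have : 0 ≤ 48 / n := by positivity
        linarith
      rw [show (2 - 12 / n) / n ^ 2 = (3 - 12 / n) / n ^ 2 - 1 / n ^ 2 by ring]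
      linarith
    have h12 : 0 ≤ 2 - 12 / n := by
      rw [sub_nonneg, div_le_iff₀ hn]
      linarith
    have up : (3 / (n + 2) ^ 2 - 1 / n ^ 2) * τ ^ 2 ≤ 2 := by
      calc _ ≤ 2 / n ^ 2 * τ ^ 2 := by gcongr
        _ ≤ 2 / n ^ 2 * n ^ 2 := by gcongr
        _ = 2 := by field_simp
    have lo : 2 - (12 + 4 * q) / n ≤ (3 / (n + 2) ^ 2 - 1 / n ^ 2) * τ ^ 2 := by
      calc 2 - (12 + 4 * q) / n ≤ (2 - 12 / n) * (1 - 2 * q / n) := by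
            have : 0 ≤ 12 / n * (2 * q / n) := by positivity
            have e : (12 + 4 * q) / n = 12 / n + 2 * (2 * q / n) := by ring
            rw [e]
            linarith
        _ = (2 - 12 / n) / n ^ 2 * (n ^ 2 - 2 * q * n) := by field_simp
        _ ≤ (2 - 12 / n) / n ^ 2 * τ ^ 2 := by gcongr
        _ ≤ _ := by gcongr
    have h6 : 6 / n ≤ (12 + 4 * q) / n := by gcongr; linarith
    rw [abs_le]
    constructor <;> linarith
  have h1 : (12 + 4 * (p : ℝ)) / ((T : ℝ) - p) ≤ 1 := by
    rw [div_le_one (by linarith)]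
    exact h
  have h2 := (abs_le.1 key).1
  refine ⟨Real.one_le_sqrt.2 (by linarith), ?_⟩
  rw [vAdj, Real.sq_sqrt (by linarith)]
  exact key

lemma charFun_errorLaw (s : ℝ) (u : EuclideanSpace ℝ (Fin T)) :
    charFun (multivariateGaussian 0 (s ^ 2 • (1 : Matrix (Fin T) (Fin T) ℝ))) u
      = Complex.exp (-(s ^ 2 * ‖u‖ ^ 2 / 2 : ℝ)) := by
  rw [charFun_multivariateGaussian (Matrix.PosSemidef.one.smul (sq_nonneg s))]
  congr 1
  rw [Matrix.smul_mulVec, Matrix.one_mulVec, dotProduct_smul, inner_zero_right,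
    EuclideanSpace.norm_sq_eq]
  simp [dotProduct, sq]

/-- Spherical normal errors have a uniformly distributed direction in the range of the residual
projection. -/
lemma isIsotropic_errorLaw (hx : IsUnit (xᵀ * x)) (hn : 0 < (T : ℝ) - p) {s : ℝ} (hs : 0 < s) :
    IsIsotropic (multivariateGaussian 0 (s ^ 2 • (1 : Matrix (Fin T) (Fin T) ℝ)))
      (residualMap x) ((T : ℝ) - p) where
  proj := isSymmetricProjection_residualMap hx
  trace := trace_residualMap hx
  pos := hn
  map_isometry O := by
    refine Measure.ext_of_charFun (funext fun u => ?_)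
    rw [charFun_errorLaw, charFun_apply, integral_map O.continuous.measurable.aemeasurable
      (by fun_prop)]
    have e : ∀ a, inner ℝ (O a) u = inner ℝ a (O.symm u) := fun a => by
      rw [← O.inner_map_map a, O.apply_symm_apply]
    simp_rw [e]
    rw [← charFun_apply, charFun_errorLaw, O.symm.norm_map]
  ae_ne_zero := by
    have hQ := isSymmetricProjection_residualMap hx
    obtain ⟨w, hw⟩ : ∃ w, residualMap x w ≠ 0 := by
      by_contra! h
      have h0 : residualMap x = 0 := LinearMap.ext h
      have := trace_residualMap hx
      rw [h0, map_zero] at this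
      linarith
    set g := multivariateGaussian 0 (s ^ 2 • (1 : Matrix (Fin T) (Fin T) ℝ)) with hg
    set z := residualMap x w with hz
    have hmap : g.map (fun e => inner ℝ e z) = gaussianReal 0 (s ^ 2 * ‖z‖ ^ 2).toNNReal := by
      refine Measure.ext_of_charFun (funext fun r => ?_)
      rw [charFun_apply, integral_map (by fun_prop) (by fun_prop), charFun_gaussianReal,
        Real.coe_toNNReal _ (by positivity)]
      have e : ∀ a, inner ℝ (inner ℝ a z : ℝ) r = inner ℝ a (r • z) := fun a => by
        rw [real_inner_smul_right]
        simp
      simp_rw [e]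
      rw [← charFun_apply, hg, charFun_errorLaw, norm_smul, mul_pow, Real.norm_eq_abs, sq_abs]
      congr 1
      push_cast
      ring
    have hz0 : 0 < ‖z‖ := norm_pos_iff.2 hw
    have : NullSingletonClass (gaussianReal 0 (s ^ 2 * ‖z‖ ^ 2).toNNReal) :=
      nullSingletonClass_gaussianReal (Real.toNNReal_pos.2 (by positivity)).ne'
    have hnull : ∀ᵐ r ∂(g.map fun e => inner ℝ e z), r ≠ 0 := by
      rw [hmap, ae_iff]
      simp
    filter_upwards [ae_of_ae_map (by fun_prop) hnull] with e he h0
    apply he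
    rw [hz, ← IsProj.inner_apply hQ, h0, inner_zero_left]

end Panel

/-- The two consequences of `T / √N → ∞` on which the limit rests. -/
lemma tendsto_sub_const_of_div_sqrt {T : ℕ → ℕ} (p : ℕ)
    (hT : Tendsto (fun N : ℕ => (T N : ℝ) / √(N : ℝ)) atTop atTop) :
    Tendsto (fun N => (T N : ℝ) - p) atTop atTop
      ∧ Tendsto (fun N : ℕ => (N : ℝ) / ((T N : ℝ) - p) ^ 2) atTop (𝓝 0) := by
  have hs : Tendsto (fun N : ℕ => √(N : ℝ)) atTop atTop :=
    Real.tendsto_sqrt_atTop.comp tendsto_natCast_atTop_atTop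
  have h1 : Tendsto (fun N : ℕ => ((T N : ℝ) - p) / √(N : ℝ)) atTop atTop := by
    have := hT.atTop_add (hs.const_div_atTop (p : ℝ)).neg
    refine this.congr fun N => ?_
    ring
  constructor
  · refine (h1.atTop_mul_atTop₀ hs).congr' ?_
    filter_upwards [hs.eventually_gt_atTop 0] with N hN
    rw [div_mul_cancel₀ _ hN.ne']
  · refine (((tendsto_pow_atTop two_ne_zero).comp h1).inv_tendsto_atTop).congr fun N => ?_
    simp [div_pow, Real.sq_sqrt (Nat.cast_nonneg N)]

end PanelData

theorem theorem2
    (p : ℕ) (T : ℕ → ℕ)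
    (hT : Tendsto (fun N : ℕ => (T N : ℝ) / √(N : ℝ)) atTop atTop)
    (x : (N : ℕ) → Fin N → Matrix (Fin (T N)) (Fin p) ℝ)
    (hx : ∀ N i, IsUnit ((x N i)ᵀ * x N i))
    (β : (N : ℕ) → Fin N → Fin p → ℝ)
    (σ : (N : ℕ) → Fin N → ℝ) (hσ : ∀ N i, 0 < σ N i)
    {Ω : ℕ → Type*} [∀ N, MeasurableSpace (Ω N)]
    (P : (N : ℕ) → Measure (Ω N)) [∀ N, IsProbabilityMeasure (P N)]
    (ε : (N : ℕ) → Fin N → Ω N → EuclideanSpace ℝ (Fin (T N)))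
    (hε_indep : ∀ N, iIndepFun (ε N) (P N))
    (hε_law : ∀ N i, HasLaw (ε N i)
      (multivariateGaussian 0 (σ N i ^ 2 • (1 : Matrix (Fin (T N)) (Fin (T N)) ℝ))) (P N))
    (y : (N : ℕ) → Fin N → Ω N → Fin (T N) → ℝ)
    (hy : ∀ N i ω t, y N i ω t = (x N i *ᵥ β N i) t + ε N i ω t) :
    TendstoInDistribution
      (fun (N : ℕ) (ω : Ω N) => PanelData.lmAdj (x N) (fun i => y N i ω))
      atTop (id : ℝ → ℝ) P (gaussianReal 0 1) := by
  let F : (N : ℕ) → (Fin N → EuclideanSpace ℝ (Fin (T N))) → ℝ := fun N e =>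
    PanelData.lmAdj (x N) fun i t => (x N i *ᵥ β N i) t + e i t
  have hF : ∀ N, Measurable (F N) := fun N => PanelData.measurable_lmAdj (hx N) (β N)
  have hε : ∀ N, AEMeasurable (fun ω i => ε N i ω) (P N) := fun N =>
    aemeasurable_pi_lambda _ fun i => (hε_law N i).aemeasurable
  have hstat : ∀ N, (fun ω => PanelData.lmAdj (x N) (fun i => y N i ω))
      = fun ω => F N fun i => ε N i ω := fun N => by
    funext ω
    exact congrArg _ (funext fun i => funext fun t => hy N i ω t)
  have hmeas : ∀ N, AEMeasurable (fun ω => PanelData.lmAdj (x N) (fun i => y N i ω)) (P N) :=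
    fun N => by
      rw [hstat]
      exact (hF N).comp_aemeasurable (hε N)
  let ν : (N : ℕ) → Fin N → Measure (EuclideanSpace ℝ (Fin (T N))) := fun N i =>
    multivariateGaussian 0 (σ N i ^ 2 • (1 : Matrix (Fin (T N)) (Fin (T N)) ℝ))
  have hlaw : ∀ N, (P N).map (fun ω i => ε N i ω) = Measure.pi (ν N) := fun N => by
    rw [(iIndepFun_iff_map_fun_eq_pi_map fun i => (hε_law N i).aemeasurable).1 (hε_indep N)]
    congr 1
    exact funext fun i => (hε_law N i).map_eq
  -- Lévy's continuity theorem
  refine ⟨hmeas, aemeasurable_id,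
    ProbabilityMeasure.tendsto_iff_tendsto_charFun.2 fun t => ?_⟩
  simp only [ProbabilityMeasure.coe_mk, Measure.map_id]
  have hchar : ∀ N, charFun ((P N).map fun ω => PanelData.lmAdj (x N) (fun i => y N i ω)) t
      = ∫ e, Complex.exp ((t * F N e : ℝ) * Complex.I) ∂(Measure.pi (ν N)) := fun N => by
    have h := AEMeasurable.map_map_of_aemeasurable (hF N).aemeasurable (hε N)
    rw [hstat, ← Function.comp_def (F N), ← h, hlaw, charFun_apply_real,
      integral_map (hF N).aemeasurable (by fun_prop)]
    push_cast
    rfl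
  have hlim : charFun (gaussianReal 0 1) t = (Real.exp (-(t ^ 2 / 2)) : ℂ) := by
    rw [charFun_gaussianReal]
    push_cast
    congr 1
    ring
  obtain ⟨hn, hNn⟩ := PanelData.tendsto_sub_const_of_div_sqrt p hT
  set n : ℕ → ℝ := fun N => (T N : ℝ) - p
  have hn2 : Tendsto (fun N => n N ^ 2) atTop atTop := (tendsto_pow_atTop two_ne_zero).comp hn
  rw [hlim, tendsto_iff_norm_sub_tendsto_zero]
  have hbound := (PanelData.tendsto_charFunBound t 968
    (hn.const_div_atTop (6 + 4 * (p : ℝ) + 6 * p ^ 2 + (12 + 4 * p)))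
    (hn2.const_div_atTop (24 + 2 * (2 + 6 * (p : ℝ) + 3 * p ^ 2) ^ 2))).add
    (((Real.continuous_sqrt.tendsto _).comp (hNn.const_mul (12 * (p : ℝ) ^ 2))).const_mul |t|)
  simp only [mul_zero, Real.sqrt_zero, add_zero] at hbound
  refine squeeze_zero' (Eventually.of_forall fun N => norm_nonneg _) ?_ hbound
  filter_upwards [eventually_ge_atTop 2, hn.eventually_ge_atTop (12 + 4 * (p : ℝ))] with N hN hnN
  have hp0 : (0 : ℝ) ≤ p := Nat.cast_nonneg p
  have hnN' : 12 + 4 * (p : ℝ) ≤ (T N : ℝ) - p := hnN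
  have hv := PanelData.abs_vAdj_sq_sub_le (hx N) hnN'
  have hmain := PanelData.norm_integral_exp_sub_le (ν := ν N)
    (Q := fun i => PanelData.residualMap (x N i)) (n := (T N : ℝ) - p) (p := p)
    (v := PanelData.vAdj (x N))
    (fun i => PanelData.isIsotropic_errorLaw (hx N i) (by linarith) (hσ N i))
    (fun i => PanelData.trace_one_sub_residualMap (hx N i)) hN (by linarith)
    (fun i j => (hv i j).1) PanelData.vAdj_comm (fun i j => (hv i j).2) t
  simp_rw [← PanelData.lmAdj_eq (hx N) (β N)] at hmain
  rw [hchar]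
  exact hmain
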